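/- Let $k$ be a field and let $A$ be a symmetric $k$-algebra, i.e. a finite-dimensional unital associative algebra with a symmetric bilinear form $\langle\cdot,\cdot\rangle$ such that $\langle a,bc\rangle=\langle ab,c\rangle$ and $a\mapsto\langle a,-\rangle$ is an isomorphism $A\to\mathrm{Hom}_k(A,k)$. Let $(e_\lambda)$ be a basis of $A$ with dual basis $(e^\lambda)$, $\langle e_\lambda,e^\mu\rangle=\delta_{\lambda\mu}$; sums over repeated indices $\lambda$ are understood. Put $\overline A=A/k\cdot 1$, $C_p(A,A)=A\otimes\overline A^{\otimes p}$ and $C^m(A,A)=\mathrm{Hom}_k(\overline A^{\otimes m},A)$ (normalized Hochschild chains and cochains), and let $$\mathcal D^*(A,A):\ \cdots\xrightarrow{b}C_1(A,A)\xrightarrow{b}C_0(A,A)\xrightarrow{\tau}C^0(A,A)\xrightarrow{\delta^0}C^1(A,A)\to\cdots$$ with $C^m(A,A)$ in degree $m$ and $C_p(A,A)$ in degree $-p-1$, where $b,\delta$ are the Hochschild differentials and $\tau(x)=\sum_\lambda e_\lambda xe^\lambda$. For $\alpha=a_0\otimes\overline a_1\otimes\cdots\otimes\overline a_p\in C_p(A,A)$,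 $\beta=b_0\otimes\overline b_1\otimes\cdots\otimes\overline b_q\in C_q(A,A)$ and $f,g\in C^0(A,A)=A$ put $$\alpha\star\beta=\sum_\lambda b_0e_\lambda a_0\otimes\overline a_1\otimes\cdots\otimes\overline a_p\otimes\overline{e^\lambda}\otimes\overline b_1\otimes\cdots\otimes\overline b_q,$$ $$\alpha\star f=fa_0\otimes\overline a_1\otimes\cdots\otimes\overline a_p,\qquad f\star\alpha=a_0f\otimes\overline a_1\otimes\cdots\otimes\overline a_p,\qquad f\star g=gf,$$ $$\{\alpha,\beta\}=\alpha\bullet\beta-(-1)^{pq}\beta\bullet\alpha,\qquad \beta\bullet\alpha=\sum_\lambda\sum_{i=1}^{p+1}(-1)^{qi}a_0\otimes\overline a_1\otimes\cdots\otimes\overline a_{i-1}\otimes\overline{e_\lambda b_0}\otimes\overline b_1\otimes\cdots\otimes\overline b_q\otimes\overline{e^\lambda}\otimes\overline a_i\otimes\cdots\otimes\overline a_p,$$ $\{f,g\}=0$, and let $\{\alpha,f\},\{f,\alpha\}\in C_{p+1}(A,A)$ be the unique elements with $\langle\{\alpha,f\},h\rangle=-\langle\alpha,[f,h]\rangle$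 and $\langle\{f,\alpha\},h\rangle=-\langle\alpha,[h,f]\rangle$ for all $h\in C^{p+1}(A,A)$, where $[\cdot,\cdot]$ is the Gerstenhaber bracket, so that $[h,f]=\sum_{i=1}^{p+1}(-1)^{i-1}h(\cdots\otimes\overline a_{i-1}\otimes\overline f\otimes\overline a_i\otimes\cdots)$ and $[f,h]=-(-1)^p[h,f]$, and $\langle h,a_0\otimes\overline a_1\otimes\cdots\otimes\overline a_p\rangle=\langle a_0,h(\overline a_1\otimes\cdots\otimes\overline a_p)\rangle$. Explicitly, $\{\alpha,f\}=\sum_{i=1}^{p+1}(-1)^{p+i-1}a_0\otimes\cdots\otimes\overline a_{i-1}\otimes\overline f\otimes\overline a_i\otimes\cdots\otimes\overline a_p$ and $\{f,\alpha\}=-(-1)^p\{\alpha,f\}$. Let $B$ be Connes' operator, $$B(a_0\otimes\overline a_1\otimes\cdots\otimes\overline a_p)=\sum_{i=1}^{p+1}(-1)^{pi}\,1\otimes\overline a_i\otimes\cdots\otimes\overline a_p\otimes\overline a_0\otimes\overline a_1\otimes\cdots\otimes\overline a_{i-1},$$ extended by $B=0$ on $C^0(A,A)$. Then $\star$, $\{\cdot,\cdot\}$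 and $B$ induce well-defined operations on the non-positive part $H^{\le0}(\mathcal D^*(A,A))=\bigoplus_{n\ge0}H^{-n}(\mathcal D^*(A,A))$, of degrees $0,-1,-1$, such that, writing $|a|$ for the degree of a homogeneous class $a$: 1. $(H^{\le0}(\mathcal D^*(A,A)),\star)$ is a graded commutative associative algebra, with unit the class of $1\in C^0(A,A)$. 2. With $B$ it is a Batalin–Vilkovisky algebra: $B(1)=0$, $B^2=0$, and $$B(abc)=B(ab)c+(-1)^{|a|}aB(bc)+(-1)^{|b|(|a|-1)}bB(ac)-B(a)bc-(-1)^{|a|}aB(b)c-(-1)^{|a|+|b|}abB(c).$$ 3. With $\{\cdot,\cdot\}$ it is a Gerstenhaber algebra: $\{a,b\}=-(-1)^{(|a|-1)(|b|-1)}\{b,a\}$, $\{a,\{b,c\}\}=\{\{a,b\},c\}+(-1)^{(|a|-1)(|b|-1)}\{b,\{a,c\}\}$ and $\{a,b\star c\}=\{a,b\}\star c+(-1)^{(|a|-1)|b|}b\star\{a,c\}$. 4. The bracket is given by $B$ through the BV identity: for $a$ of degree $|a|=-p-1$, $$\{a,b\}=(-1)^p\bigl(B(a\star b)-B(a)\star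 b-(-1)^{p-1}a\star B(b)\bigr).$$ -/

import Mathlib

open scoped TensorProduct

namespace TateHochschild

section Chains

variable (k : Type*) [Field k] (A : Type*) [Ring A] [Algebra k A]

/-- `Ā = A / (k · 1)`. -/
def Bar : Type _ := A ⧸ (Submodule.span k {(1 : A)})

instance : AddCommGroup (Bar k A) :=
  inferInstanceAs (AddCommGroup (A ⧸ (Submodule.span k {(1 : A)})))

instance : Module k (Bar k A) :=
  inferInstanceAs (Module k (A ⧸ (Submodule.span k {(1 : A)})))

/-- The projection `A → Ā`. -/
def bar : A →ₗ[k] Bar k A := (Submodule.span k {(1 : A)}).mkQ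

theorem bar_surjective : Function.Surjective (bar k A) := Submodule.mkQ_surjective _

theorem bar_one : bar k A 1 = 0 :=
  (Submodule.Quotient.mk_eq_zero _).2 (Submodule.mem_span_singleton_self _)

theorem bar_eq_zero_iff (a : A) : bar k A a = 0 ↔ ∃ c : k, c • (1 : A) = a :=
  (Submodule.Quotient.mk_eq_zero _).trans Submodule.mem_span_singleton

/-- The tensor power `Ā ⊗ ⋯ ⊗ Ā` with `p` factors. -/
abbrev BarPow (p : ℕ) : Type _ := ⨂[k] _ : Fin p, Bar k A

/-- Normalized Hochschild chains `C_p(A, A) = A ⊗ Ā^{⊗ p}`. -/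
abbrev Chain (p : ℕ) : Type _ := A ⊗[k] BarPow k A p

/-- Normalized Hochschild cochains `C^p(A, A) = Hom(Ā^{⊗ p}, A)`. -/
abbrev Cochain (p : ℕ) : Type _ := BarPow k A p →ₗ[k] A

variable {k A}

/-- The index bijection that puts a block of `r` entries in front of the entry number `i`
(counted from `0`) of a tuple with `p` entries. -/
def blockEquiv {p r N : ℕ} (h : p + r = N) (i : Fin (p + 1)) : Fin N ≃ Fin p ⊕ Fin r where
  toFun j :=
    if h1 : (j : ℕ) < i then Sum.inl ⟨j, by omega⟩
    else if h2 : (j : ℕ) < i + r then Sum.inr ⟨j - i, by omega⟩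
    else Sum.inl ⟨j - r, by omega⟩
  invFun := Sum.elim
    (fun l => if (l : ℕ) < i then ⟨l, by omega⟩ else ⟨l + r, by omega⟩)
    (fun l => ⟨i + l, by omega⟩)
  left_inv j := by
    rcases lt_or_ge (j : ℕ) i with h1 | h1
    · simp [h1]
    · rcases lt_or_ge (j : ℕ) (i + r) with h2 | h2
      · simp [h1.not_gt, h2, Fin.ext_iff]; omega
      · have h3 : ¬ ((j : ℕ) - r < i) := by omega
        simp [h1.not_gt, h2.not_gt, h3, Fin.ext_iff]; omega
  right_inv s := by
    rcases s with l | l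
    · rcases lt_or_ge (l : ℕ) i with h1 | h1
      · simp [h1]
      · have h3 : ¬ ((l : ℕ) + r < i) := by omega
        simp [h1.not_gt, h3]
    · simp

/-- `(a_1 ⊗ ⋯ ⊗ a_p, w_1 ⊗ ⋯ ⊗ w_r) ↦ a_1 ⊗ ⋯ ⊗ a_i ⊗ w_1 ⊗ ⋯ ⊗ w_r ⊗ a_{i+1} ⊗ ⋯ ⊗ a_p`. -/
noncomputable def insertBlock {p r N : ℕ} (h : p + r = N) (i : Fin (p + 1)) :
    BarPow k A p →ₗ[k] BarPow k A r →ₗ[k] BarPow k A N :=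
  TensorProduct.curry
    ((PiTensorProduct.reindex k (fun _ => Bar k A) (blockEquiv h i).symm).toLinearMap ∘ₗ
      (PiTensorProduct.tmulEquiv k (Bar k A)).toLinearMap)

theorem insertBlock_tprod {p r N : ℕ} (h : p + r = N) (i : Fin (p + 1))
    (a : Fin p → Bar k A) (w : Fin r → Bar k A) :
    insertBlock h i (PiTensorProduct.tprod k a) (PiTensorProduct.tprod k w) =
      PiTensorProduct.tprod k (fun j : Fin N =>
        if h1 : (j : ℕ) < i then a ⟨j, by omega⟩
        else if h2 : (j : ℕ) < i + r then w ⟨j - i, by omega⟩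
        else a ⟨j - r, by omega⟩) := by
  simp only [insertBlock, TensorProduct.curry_apply, LinearMap.comp_apply, LinearEquiv.coe_coe,
    PiTensorProduct.tmulEquiv_apply]
  erw [PiTensorProduct.reindex_tprod]
  congr 1
  funext j
  simp only [Equiv.symm_symm, blockEquiv, Equiv.coe_fn_mk]
  split_ifs <;> rfl

/-- Concatenation of tensors. -/
noncomputable def concat {p r N : ℕ} (h : p + r = N) :
    BarPow k A p →ₗ[k] BarPow k A r →ₗ[k] BarPow k A N :=
  insertBlock h (Fin.last p)

/-- `(x, a_1 ⊗ ⋯ ⊗ a_p) ↦ a_1 ⊗ ⋯ ⊗ a_i ⊗ x̄ ⊗ a_{i+1} ⊗ ⋯ ⊗ a_p` for `x` in `A`. -/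
noncomputable def insertOne {p N : ℕ} (h : p + 1 = N) (i : Fin (p + 1)) :
    A →ₗ[k] BarPow k A p →ₗ[k] BarPow k A N :=
  (insertBlock h i).flip ∘ₗ
    (PiTensorProduct.subsingletonEquiv (R := k) (s := fun _ : Fin 1 => Bar k A)
      0).symm.toLinearMap ∘ₗ bar k A

theorem insertOne_tprod {p N : ℕ} (h : p + 1 = N) (i : Fin (p + 1)) (x : A)
    (a : Fin p → Bar k A) :
    insertOne h i x (PiTensorProduct.tprod k a) =
      PiTensorProduct.tprod k (fun j : Fin N => i.insertNth (α := fun _ => Bar k A)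
        (bar k A x) a (Fin.cast h.symm j)) := by
  subst h
  simp only [insertOne, LinearMap.comp_apply, LinearMap.flip_apply, LinearEquiv.coe_coe,
    PiTensorProduct.subsingletonEquiv_symm_apply', insertBlock_tprod]
  congr 1
  funext j
  rcases lt_trichotomy j i with h1 | h1 | h1
  · have h1' : (j : ℕ) < i := h1
    simp [Fin.insertNth_apply_below h1, h1']
    rfl
  · subst h1; simp
  · have h1' : (i : ℕ) < j := h1
    have h2 : ¬ ((j : ℕ) < i) := by omega
    have h3 : ¬ ((j : ℕ) < i + 1) := by omega
    simp [Fin.insertNth_apply_above h1, h2, h3]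
    rfl

/-- The class `a_0 ⊗ ā_1 ⊗ ⋯ ⊗ ā_p` in `C_p(A, A)` of a tuple `(a_0, …, a_p)` in `A`. -/
noncomputable def pureChain (p : ℕ) : MultilinearMap k (fun _ : Fin (p + 1) => A) (Chain k A p) :=
  LinearMap.uncurryLeft
    { toFun := fun a₀ => (TensorProduct.mk k A (BarPow k A p) a₀).compMultilinearMap
        ((PiTensorProduct.tprod k).compLinearMap (fun _ : Fin p => bar k A))
      map_add' := fun x y => by ext; simp
      map_smul' := fun c x => by ext; simp [TensorProduct.smul_tmul'] }

theorem pureChain_apply {p : ℕ} (a : Fin (p + 1) → A) :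
    pureChain (k := k) p a =
      a 0 ⊗ₜ[k] PiTensorProduct.tprod k (fun i : Fin p => bar k A (a i.succ)) := rfl

theorem pureChain_eq_zero {p : ℕ} (a : Fin (p + 1) → A) (i : Fin p)
    (hi : a i.succ = 1) : pureChain (k := k) p a = 0 := by
  rw [pureChain_apply, MultilinearMap.map_coord_zero _ i, TensorProduct.tmul_zero]
  rw [hi, bar_one]

theorem contractNth_update {n : ℕ} (j : Fin n) (c : Fin (n + 1) → A)
    (i : Fin (n + 1)) : ∃ (o : Fin n) (L : A →ₗ[k] A), ∀ x,
      Fin.contractNth j.castSucc (· * ·) (Function.update c i x) =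
        Function.update (Fin.contractNth j.castSucc (· * ·) c) o (L x) := by
  rcases lt_trichotomy (i : ℕ) j with h | h | h
  · refine ⟨⟨i, by omega⟩, LinearMap.id, fun x => ?_⟩
    funext l
    simp only [Fin.contractNth, Function.update_apply, Fin.ext_iff, Fin.val_castSucc, Fin.val_succ,
      LinearMap.id_apply]
    split_ifs <;> first | rfl | omega
  · refine ⟨j, LinearMap.mulRight k (c j.succ), fun x => ?_⟩
    funext l
    simp only [Fin.contractNth, Function.update_apply, Fin.ext_iff, Fin.val_castSucc, Fin.val_succ,
      LinearMap.mulRight_apply]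
    split_ifs <;> first | rfl | omega | skip
    rename_i h1 h2 h3 h4 h5
    congr 2
    ext; simp; omega
  · rcases Nat.eq_or_lt_of_le (Nat.succ_le_of_lt h) with h' | h'
    · refine ⟨j, LinearMap.mulLeft k (c j.castSucc), fun x => ?_⟩
      funext l
      simp only [Fin.contractNth, Function.update_apply, Fin.ext_iff, Fin.val_castSucc,
        Fin.val_succ, LinearMap.mulLeft_apply]
      split_ifs <;> first | rfl | omega | skip
      rename_i h1 h2 h3 h4 h5
      congr 2
      ext; simp; omega
    · refine ⟨⟨i - 1, by omega⟩, LinearMap.id, fun x => ?_⟩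
      funext l
      simp only [Fin.contractNth, Function.update_apply, Fin.ext_iff, Fin.val_castSucc,
        Fin.val_succ, LinearMap.id_apply]
      split_ifs <;> first | rfl | omega

/-- `(a_0, …, a_{p+1}) ↦ a_0 ⊗ ⋯ ⊗ a_j a_{j+1} ⊗ ⋯ ⊗ a_{p+1}` for `0 ≤ j ≤ p`. -/
noncomputable def face (p : ℕ) (j : Fin (p + 1)) :
    MultilinearMap k (fun _ : Fin (p + 2) => A) (Chain k A p) where
  toFun c := pureChain p (Fin.contractNth j.castSucc (· * ·) c)
  map_update_add' {inst} c i x y := by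
    obtain rfl : inst = instDecidableEqFin _ := Subsingleton.elim _ _
    obtain ⟨o, L, h⟩ := contractNth_update (k := k) j c i
    simp only [h, map_add, MultilinearMap.map_update_add]
  map_update_smul' {inst} c i r x := by
    obtain rfl : inst = instDecidableEqFin _ := Subsingleton.elim _ _
    obtain ⟨o, L, h⟩ := contractNth_update (k := k) j c i
    simp only [h, map_smul, MultilinearMap.map_update_smul]

/-- The multilinear map `(a_0, …, a_{p+1}) ↦ b (a_0 ⊗ ā_1 ⊗ ⋯ ⊗ ā_{p+1})`. -/
noncomputable def hochschildBAux (p : ℕ) :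
    MultilinearMap k (fun _ : Fin (p + 2) => A) (Chain k A p) :=
  ∑ j : Fin (p + 1), (-1 : k) ^ (j : ℕ) • face p j +
    (-1 : k) ^ (p + 1) • (face p 0).domDomCongr (finRotate (p + 2)).symm

theorem hochschildBAux_apply (p : ℕ) (a : Fin (p + 2) → A) :
    hochschildBAux (k := k) p a =
      ∑ j : Fin (p + 1), (-1 : k) ^ (j : ℕ) •
          pureChain p (Fin.contractNth j.castSucc (· * ·) a) +
        (-1 : k) ^ (p + 1) • pureChain p
          (Fin.cons (a (Fin.last (p + 1)) * a 0) (fun l : Fin p => a l.succ.castSucc)) := by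
  have h0 : (finRotate (p + 2)).symm 0 = Fin.last (p + 1) := by
    rw [Equiv.symm_apply_eq, finRotate_last]
  have h1 : ∀ l : Fin (p + 1), (finRotate (p + 2)).symm l.succ = l.castSucc := fun l => by
    rw [Equiv.symm_apply_eq, finRotate_apply, Fin.coeSucc_eq_succ]
  simp only [hochschildBAux, face, add_apply, sum_apply, smul_apply, MultilinearMap.coe_mk, MultilinearMap.domDomCongr_apply]
  congr 3
  funext l
  refine Fin.cases ?_ (fun l => ?_) l
  · simp only [Fin.contractNth, Fin.castSucc_zero, Fin.val_zero, lt_irrefl, if_false, if_true,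
      Fin.cons_zero, h0]
    rw [h1]; rfl
  · rw [Fin.contractNth_apply_of_gt _ _ _ _ (by simp), Fin.cons_succ, h1]

theorem hochschildBAux_eq_zero_of_one (p : ℕ) (a : Fin (p + 2) → A) (i : Fin (p + 1))
    (hi : a i.succ = 1) : hochschildBAux (k := k) p a = 0 := by
  have key : ∀ j : Fin (p + 1), ((j : ℕ) = i ∨ (j : ℕ) = i + 1) →
      Fin.contractNth j.castSucc (· * ·) a = fun l => a (i.succ.succAbove l) := by
    intro j hj
    funext l
    simp only [Fin.contractNth, Fin.succAbove, Fin.lt_def, Fin.val_castSucc, Fin.val_succ]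
    rcases hj with hj | hj
    · split_ifs <;> first | rfl | omega | skip
      have : l.succ = i.succ := by ext; simp; omega
      rw [this, hi, mul_one]
    · split_ifs <;> first | rfl | omega | skip
      have : l.castSucc = i.succ := by ext; simp; omega
      rw [this, hi, one_mul]
  have other : ∀ j : Fin (p + 1), (j : ℕ) ≠ i → (j : ℕ) ≠ i + 1 →
      pureChain (k := k) p (Fin.contractNth j.castSucc (· * ·) a) = 0 := by
    intro j h1 h2
    rcases lt_or_gt_of_ne h1 with h | h
    · refine pureChain_eq_zero _ ⟨i - 1, by omega⟩ ?_
      simp only [Fin.contractNth, Fin.val_castSucc, Fin.val_succ]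
      rw [if_neg (by omega), if_neg (by omega), ← hi]
      congr 1
      ext; simp; omega
    · refine pureChain_eq_zero _ ⟨i, by omega⟩ ?_
      simp only [Fin.contractNth, Fin.val_castSucc, Fin.val_succ]
      rw [if_pos (by omega), ← hi]
      rfl
  rw [hochschildBAux_apply]
  rcases Nat.lt_or_ge i p with hip | hip
  · have hlast : pureChain (k := k) p
        (Fin.cons (a (Fin.last (p + 1)) * a 0) (fun l : Fin p => a l.succ.castSucc)) = 0 := by
      refine pureChain_eq_zero _ ⟨i, hip⟩ ?_
      rw [Fin.cons_succ, ← hi]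
      rfl
    rw [hlast, smul_zero, add_zero,
      Finset.sum_eq_add (i : Fin (p + 1)) ⟨i + 1, by omega⟩
        (by simp [Fin.ext_iff])
        (fun j _ hj => by
          rw [other j (fun h => hj.1 (Fin.ext h)) (fun h => hj.2 (Fin.ext h)), smul_zero])
        (by simp) (by simp)]
    rw [key i (Or.inl rfl), key ⟨i + 1, by omega⟩ (Or.inr rfl), ← add_smul]
    simp [pow_succ]
  · have hip' : i = Fin.last p := by ext; simp; omega
    have hlast : (Fin.cons (a (Fin.last (p + 1)) * a 0) (fun l : Fin p => a l.succ.castSucc) :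
        Fin (p + 1) → A) = fun l => a (i.succ.succAbove l) := by
      subst hip'
      funext l
      rw [Fin.succ_last] at *
      rw [Fin.succAbove_last]
      refine Fin.cases ?_ (fun l => ?_) l
      · simp [hi]
      · simp
    rw [hlast, Finset.sum_eq_single i
        (fun j _ hj => by
          rw [other j (fun h => hj (Fin.ext h)) (by omega), smul_zero]) (by simp),
      key i (Or.inl rfl), ← add_smul, hip']
    simp [pow_succ]

theorem hochschildBAux_eq_zero (p : ℕ) (a : Fin (p + 2) → A) (i : Fin (p + 1))
    (hi : bar k A (a i.succ) = 0) : hochschildBAux (k := k) p a = 0 := by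
  obtain ⟨c, hc⟩ := (bar_eq_zero_iff k A _).1 hi
  have : a = Function.update (Function.update a i.succ 1) i.succ (c • 1) := by simp [hc]
  rw [this, MultilinearMap.map_update_smul,
    hochschildBAux_eq_zero_of_one p _ i (by simp), smul_zero]

/-- A multilinear map that vanishes as soon as one of its arguments is `0` in `Ā` depends only on
the classes of its arguments in `Ā`. -/
theorem apply_eq_of_bar_eq {M : Type*} [AddCommGroup M] [Module k M] {n : ℕ}
    (f : MultilinearMap k (fun _ : Fin n => A) M)
    (hf : ∀ (a : Fin n → A) (i : Fin n), bar k A (a i) = 0 → f a = 0) (a b : Fin n → A)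
    (h : ∀ i, bar k A (a i) = bar k A (b i)) : f b = f a := by
  have h1 : ∀ (a : Fin n → A) (i : Fin n) (x y : A), bar k A x = bar k A y →
      f (Function.update a i x) = f (Function.update a i y) := fun a i x y h => by
    rw [← sub_eq_zero, ← MultilinearMap.map_update_sub]
    exact hf _ i (by simp [h])
  have h2 : ∀ s : Finset (Fin n), f (s.piecewise b a) = f a := fun s => by
    induction s using Finset.induction_on with
    | empty => simp
    | insert i s his ih =>
      rw [Finset.piecewise_insert, ← ih]
      conv_rhs => rw [← Function.update_eq_self i (s.piecewise b a)]
      rw [Finset.piecewise_eq_of_notMem _ _ _ his]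
      exact (h1 _ i _ _ (h i)).symm
  simpa using h2 Finset.univ

variable (k) in
/-- A representative in `A` of an element of `Ā`. -/
noncomputable def barLift (x : Bar k A) : A := (bar_surjective k A x).choose

theorem bar_barLift (x : Bar k A) : bar k A (barLift k x) = x := (bar_surjective k A x).choose_spec

/-- A multilinear map that vanishes as soon as one of its arguments is `0` in `Ā` descends to a
multilinear map on `Ā`. -/
noncomputable def descend {M : Type*} [AddCommGroup M] [Module k M] {n : ℕ}
    (f : MultilinearMap k (fun _ : Fin n => A) M)
    (hf : ∀ (a : Fin n → A) (i : Fin n), bar k A (a i) = 0 → f a = 0) :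
    MultilinearMap k (fun _ : Fin n => Bar k A) M :=
  have hu : ∀ (v : Fin n → Bar k A) (i : Fin n) (x : Bar k A) (y : A), bar k A y = x →
      f (fun j => barLift k (Function.update v i x j)) =
        f (Function.update (fun j => barLift k (v j)) i y) := fun v i x y hy => by
    refine apply_eq_of_bar_eq f hf _ _ (fun j => ?_)
    rcases eq_or_ne j i with rfl | hj
    · simp [bar_barLift, hy]
    · simp only [Function.update_of_ne hj]
  { toFun := fun v => f (fun i => barLift k (v i))
    map_update_add' := fun {inst} v i x y => by
      obtain rfl : inst = instDecidableEqFin _ := Subsingleton.elim _ _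
      rw [hu v i x _ (bar_barLift x), hu v i y _ (bar_barLift y),
        hu v i (x + y) (barLift k x + barLift k y) (by rw [map_add, bar_barLift, bar_barLift]),
        MultilinearMap.map_update_add]
    map_update_smul' := fun {inst} v i c x => by
      obtain rfl : inst = instDecidableEqFin _ := Subsingleton.elim _ _
      rw [hu v i x _ (bar_barLift x), hu v i (c • x) (c • barLift k x) (by rw [map_smul, bar_barLift]),
        MultilinearMap.map_update_smul] }

theorem descend_bar {M : Type*} [AddCommGroup M] [Module k M] {n : ℕ}
    (f : MultilinearMap k (fun _ : Fin n => A) M)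
    (hf : ∀ (a : Fin n → A) (i : Fin n), bar k A (a i) = 0 → f a = 0) (a : Fin n → A) :
    descend f hf (fun i => bar k A (a i)) = f a :=
  apply_eq_of_bar_eq f hf _ _ (fun _ => (bar_barLift _).symm)

theorem hochschildBAux_curryLeft_eq_zero (p : ℕ) (a₀ : A) (a : Fin (p + 1) → A) (i : Fin (p + 1))
    (hi : bar k A (a i) = 0) :
    (hochschildBAux (k := k) p).curryLeft a₀ a = 0 :=
  hochschildBAux_eq_zero p (Fin.cons a₀ a) i hi

/-- The Hochschild differential `b : C_{p+1}(A, A) → C_p(A, A)`. -/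
noncomputable def hochschildB (p : ℕ) : Chain k A (p + 1) →ₗ[k] Chain k A p :=
  TensorProduct.lift
    { toFun := fun a₀ => PiTensorProduct.lift
        (descend ((hochschildBAux (k := k) p).curryLeft a₀)
          (hochschildBAux_curryLeft_eq_zero p a₀))
      map_add' := fun x y => by
        rw [← map_add]
        congr 1
        ext v
        simp [descend]
      map_smul' := fun c x => by
        rw [RingHom.id_apply, ← map_smul]
        congr 1
        ext v
        simp [descend] }

/-- On pure tensors,
`b (a_0 ⊗ ā_1 ⊗ ⋯ ⊗ ā_{p+1})` is the sum of `(-1)^j a_0 ⊗ ⋯ ⊗ a_j a_{j+1} ⊗ ⋯ ⊗ a_{p+1}` over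
`0 ≤ j ≤ p` and of `(-1)^{p+1} a_{p+1} a_0 ⊗ a_1 ⊗ ⋯ ⊗ a_p`. -/
theorem hochschildB_pureChain (p : ℕ) (a : Fin (p + 2) → A) :
    hochschildB p (pureChain (k := k) (p + 1) a) =
      ∑ j : Fin (p + 1), (-1 : k) ^ (j : ℕ) •
          pureChain p (Fin.contractNth j.castSucc (· * ·) a) +
        (-1 : k) ^ (p + 1) • pureChain p
          (Fin.cons (a (Fin.last (p + 1)) * a 0) (fun l : Fin p => a l.succ.castSucc)) := by
  rw [← hochschildBAux_apply]
  have h := descend_bar _ (hochschildBAux_curryLeft_eq_zero (k := k) p (a 0))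
    (fun i => a i.succ)
  rw [MultilinearMap.curryLeft_apply] at h
  simp only [pureChain_apply, hochschildB, TensorProduct.lift.tmul, LinearMap.coe_mk,
    AddHom.coe_mk, PiTensorProduct.lift.tprod]
  exact h.trans (congrArg (hochschildBAux (k := k) p) (Fin.cons_self_tail a))

/-- The identification `C^0(A, A) ≅ A`. -/
noncomputable def cochainZeroEquiv : Cochain k A 0 ≃ₗ[k] A :=
  (LinearEquiv.arrowCongr (PiTensorProduct.isEmptyEquiv (R := k) (s := fun _ => Bar k A) (Fin 0))
    (LinearEquiv.refl k A)) ≪≫ₗ LinearMap.ringLmapEquivSelf k k A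

theorem cochainZeroEquiv_apply (f : Cochain k A 0) (v : Fin 0 → Bar k A) :
    cochainZeroEquiv f = f (PiTensorProduct.tprod k v) := by
  rw [Subsingleton.elim v isEmptyElim]
  simp [cochainZeroEquiv]

/-- A linear map that vanishes on `1` descends to `Ā`. -/
def liftBar {M : Type*} [AddCommGroup M] [Module k M] (f : A →ₗ[k] M) (hf : f 1 = 0) :
    Bar k A →ₗ[k] M :=
  (Submodule.span k {(1 : A)}).liftQ f (by
    rw [Submodule.span_le, Set.singleton_subset_iff]
    exact hf)

theorem liftBar_bar {M : Type*} [AddCommGroup M] [Module k M] (f : A →ₗ[k] M) (hf : f 1 = 0)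
    (a : A) : liftBar f hf (bar k A a) = f a := rfl

/-- The Hochschild differential `δ⁰ : C^0(A, A) → C^1(A, A)`, `f ↦ (ā ↦ f a - a f)`. -/
noncomputable def hochschildDeltaZero : Cochain k A 0 →ₗ[k] Cochain k A 1 where
  toFun f :=
    liftBar
      (LinearMap.mulLeft k (cochainZeroEquiv f) - LinearMap.mulRight k (cochainZeroEquiv f))
      (by simp) ∘ₗ
    (PiTensorProduct.subsingletonEquiv (R := k) (s := fun _ : Fin 1 => Bar k A) 0).toLinearMap
  map_add' f g := by
    ext v
    obtain ⟨x, hx⟩ := bar_surjective k A (v 0)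
    simp [← hx, liftBar_bar, add_mul, mul_add]
    abel
  map_smul' c f := by
    ext v
    obtain ⟨x, hx⟩ := bar_surjective k A (v 0)
    simp [← hx, liftBar_bar, smul_sub]

theorem hochschildDeltaZero_apply (f : Cochain k A 0) (a : A) :
    hochschildDeltaZero f (PiTensorProduct.tprod k (fun _ : Fin 1 => bar k A a)) =
      cochainZeroEquiv f * a - a * cochainZeroEquiv f := by
  simp [hochschildDeltaZero, liftBar_bar]

/-- Connes' operator `B : C_m(A, A) → C_{m+1}(A, A)`, the sum over `0 ≤ i ≤ m` of
`(-1)^{m i} 1 ⊗ ā_i ⊗ ⋯ ⊗ ā_m ⊗ ā_0 ⊗ ⋯ ⊗ ā_{i-1}`. -/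
noncomputable def connesB (m : ℕ) : Chain k A m →ₗ[k] Chain k A (m + 1) :=
  ∑ i : Fin (m + 1), (-1 : k) ^ (m * (i : ℕ)) •
    (TensorProduct.mk k A (BarPow k A (m + 1)) 1 ∘ₗ
      (PiTensorProduct.reindex k (fun _ => Bar k A) (Equiv.addRight i).symm).toLinearMap ∘ₗ
      TensorProduct.lift (insertOne rfl 0))

/-- The index `j + i` is computed modulo `m + 1`. -/
theorem connesB_pureChain (m : ℕ) (a : Fin (m + 1) → A) :
    connesB m (pureChain (k := k) m a) =
      ∑ i : Fin (m + 1), (-1 : k) ^ (m * (i : ℕ)) •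
        ((1 : A) ⊗ₜ[k] PiTensorProduct.tprod k (fun j : Fin (m + 1) => bar k A (a (j + i)))) := by
  simp only [connesB, pureChain_apply, LinearMap.sum_apply, LinearMap.smul_apply,
    LinearMap.comp_apply, TensorProduct.lift.tmul, insertOne_tprod, LinearEquiv.coe_coe,
    TensorProduct.mk_apply]
  refine Finset.sum_congr rfl fun i _ => ?_
  erw [PiTensorProduct.reindex_tprod]
  congr 3
  funext j
  simp only [Equiv.symm_symm, Equiv.coe_addRight, Fin.cast_eq_self]
  refine Fin.cases ?_ (fun l => ?_) (j + i)
  · simp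
  · simp

section Form

variable {ι : Type*} [Fintype ι]

/-- `τ : C_0(A, A) = A → A = C^0(A, A)`, `τ(x) = ∑ e_λ x e^λ`. -/
noncomputable def traceMap (e e' : ι → A) : Chain k A 0 →ₗ[k] Cochain k A 0 :=
  cochainZeroEquiv.symm.toLinearMap ∘ₗ
    (∑ l, LinearMap.mulLeft k (e l) ∘ₗ LinearMap.mulRight k (e' l)) ∘ₗ
    (TensorProduct.rid k A).toLinearMap ∘ₗ
    LinearMap.lTensor A
      (PiTensorProduct.isEmptyEquiv (R := k) (s := fun _ => Bar k A) (Fin 0)).toLinearMap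

theorem traceMap_pureChain (e e' : ι → A) (a : Fin 1 → A) :
    cochainZeroEquiv (traceMap (k := k) e e' (pureChain 0 a)) = ∑ l, e l * a 0 * e' l := by
  simp [traceMap, pureChain_apply, mul_assoc]

/-- The product `C_p(A, A) ⊗ C_q(A, A) → C_{p+q+1}(A, A)`,
`α ⋆ β = ∑ b_0 e_λ a_0 ⊗ ā_1 ⊗ ⋯ ⊗ ā_p ⊗ ē^λ ⊗ b̄_1 ⊗ ⋯ ⊗ b̄_q`. -/
noncomputable def starChainChain (e e' : ι → A) {p q N : ℕ} (h : p + 1 + q = N) :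
    Chain k A p →ₗ[k] Chain k A q →ₗ[k] Chain k A N :=
  ∑ l, TensorProduct.map₂
    ((LinearMap.mul k A).flip ∘ₗ LinearMap.mulLeft k (e l))
    (concat h ∘ₗ insertOne rfl (Fin.last p) (e' l))

theorem starChainChain_tmul (e e' : ι → A) {p q N : ℕ} (h : p + 1 + q = N) (a₀ b₀ : A)
    (a : Fin p → Bar k A) (b : Fin q → Bar k A) :
    starChainChain e e' h (a₀ ⊗ₜ[k] PiTensorProduct.tprod k a)
        (b₀ ⊗ₜ[k] PiTensorProduct.tprod k b) =
      ∑ l, (b₀ * e l * a₀) ⊗ₜ[k] PiTensorProduct.tprod k (fun j : Fin N =>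
        Fin.append (Fin.snoc (α := fun _ => Bar k A) a (bar k A (e' l))) b (Fin.cast h.symm j)) := by
  subst h
  simp only [starChainChain, LinearMap.sum_apply, TensorProduct.map₂_apply_tmul,
    TensorProduct.map_tmul, LinearMap.comp_apply, insertOne_tprod, concat, insertBlock_tprod, LinearMap.flip_apply,
    LinearMap.mulLeft_apply, LinearMap.mul_apply', mul_assoc, Fin.cast_eq_self]
  refine Finset.sum_congr rfl fun l _ => ?_
  congr 2
  funext j
  refine Fin.addCases (fun j => ?_) (fun j => ?_) j
  · simp [Fin.append_left]
    omega
  · simp [Fin.append_right]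
    omega

/-- The product `C_p(A, A) ⊗ C^0(A, A) → C_p(A, A)`, `α ⋆ f = f a_0 ⊗ ā_1 ⊗ ⋯ ⊗ ā_p`. -/
noncomputable def starChainCochain {p : ℕ} :
    Chain k A p →ₗ[k] Cochain k A 0 →ₗ[k] Chain k A p :=
  (LinearMap.rTensorHom (BarPow k A p) ∘ₗ LinearMap.mul k A ∘ₗ
    cochainZeroEquiv.toLinearMap).flip

/-- The product `C^0(A, A) ⊗ C_p(A, A) → C_p(A, A)`, `f ⋆ α = a_0 f ⊗ ā_1 ⊗ ⋯ ⊗ ā_p`. The number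
`N = p` is kept apart from `p` to avoid casts. -/
noncomputable def starCochainChain {p N : ℕ} (h : p + 0 = N) :
    Cochain k A 0 →ₗ[k] Chain k A p →ₗ[k] Chain k A N :=
  (LinearMap.rTensorHom (BarPow k A N) ∘ₗ (LinearMap.mul k A).flip ∘ₗ
    cochainZeroEquiv.toLinearMap).compl₂
      (LinearMap.lTensor A (PiTensorProduct.reindex k (fun _ => Bar k A) (finCongr h)).toLinearMap)

theorem starCochainChain_tmul {p N : ℕ} (h : p + 0 = N) (f : Cochain k A 0) (a₀ : A)
    (a : Fin p → Bar k A) :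
    starCochainChain h f (a₀ ⊗ₜ[k] PiTensorProduct.tprod k a) =
      (a₀ * cochainZeroEquiv f) ⊗ₜ[k] PiTensorProduct.tprod k (fun j => a (Fin.cast h.symm j)) := by
  simp only [starCochainChain, LinearMap.compl₂_apply, LinearMap.lTensor_tmul,
    LinearMap.comp_apply, LinearMap.coe_rTensorHom, LinearMap.rTensor_tmul, LinearEquiv.coe_coe,
    LinearMap.flip_apply, LinearMap.mul_apply']
  erw [PiTensorProduct.reindex_tprod]
  rfl

theorem starChainCochain_tmul {p : ℕ} (f : Cochain k A 0) (a₀ : A) (t : BarPow k A p) :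
    starChainCochain (a₀ ⊗ₜ[k] t) f = (cochainZeroEquiv f * a₀) ⊗ₜ[k] t := by
  simp [starChainCochain]

/-- The product `C^0(A, A) ⊗ C^0(A, A) → C^0(A, A)`, `f ⋆ g = f ∪ g = g f`. -/
noncomputable def starCochainCochain :
    Cochain k A 0 →ₗ[k] Cochain k A 0 →ₗ[k] Cochain k A 0 :=
  ((LinearMap.mul k A).flip.compl₁₂ cochainZeroEquiv.toLinearMap
    cochainZeroEquiv.toLinearMap).compr₂ cochainZeroEquiv.symm.toLinearMap

theorem starCochainCochain_apply (f g : Cochain k A 0) :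
    cochainZeroEquiv (starCochainCochain f g) = cochainZeroEquiv g * cochainZeroEquiv f := by
  simp [starCochainCochain]

/-- `β • α = ∑ (-1)^{q i} a_0 ⊗ ā_1 ⊗ ⋯ ⊗ ā_{i-1} ⊗ (e_λ b_0)‾ ⊗ b̄_1 ⊗ ⋯ ⊗ b̄_q ⊗ ē^λ ⊗ ā_i ⊗ ⋯ ⊗ ā_p`,
the sum over `λ` and `1 ≤ i ≤ p + 1`, for `β` in `C_q(A, A)` and `α` in `C_p(A, A)`. The summation
index of the code is `i - 1`. -/
noncomputable def bullet (e e' : ι → A) {p q N : ℕ} (h : p + (q + 2) = N) :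
    Chain k A q →ₗ[k] Chain k A p →ₗ[k] Chain k A N :=
  ∑ l, ∑ i : Fin (p + 1), (-1 : k) ^ (q * (i + 1 : ℕ)) •
    (LinearMap.lTensorHom A ∘ₗ (insertBlock h i).flip ∘ₗ
      insertOne rfl (Fin.last (q + 1)) (e' l) ∘ₗ
      TensorProduct.lift (insertOne rfl 0 ∘ₗ LinearMap.mulLeft k (e l)))

theorem bullet_tmul (e e' : ι → A) {p q N : ℕ} (h : p + (q + 2) = N) (a₀ b₀ : A)
    (a : Fin p → Bar k A) (b : Fin q → Bar k A) :
    bullet e e' h (b₀ ⊗ₜ[k] PiTensorProduct.tprod k b) (a₀ ⊗ₜ[k] PiTensorProduct.tprod k a) =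
      ∑ l, ∑ i : Fin (p + 1), (-1 : k) ^ (q * (i + 1 : ℕ)) •
        (a₀ ⊗ₜ[k] insertBlock h i (PiTensorProduct.tprod k a)
          (PiTensorProduct.tprod k (Fin.snoc (α := fun _ => Bar k A)
            (Fin.cons (α := fun _ => Bar k A) (bar k A (e l * b₀)) b) (bar k A (e' l))))) := by
  simp only [bullet, LinearMap.sum_apply, LinearMap.smul_apply, LinearMap.comp_apply,
    TensorProduct.lift.tmul, LinearMap.mulLeft_apply, insertOne_tprod, LinearMap.flip_apply,
    LinearMap.coe_lTensorHom, LinearMap.lTensor_tmul, Fin.cast_eq_self, Fin.insertNth_zero',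
    Fin.insertNth_last']

/-- The bracket `{α, β} = α • β - (-1)^{p q} β • α` of `α` in `C_p(A, A)` and `β` in
`C_q(A, A)`. -/
noncomputable def bracketChainChain (e e' : ι → A) {p q N : ℕ} (h : p + q + 2 = N) :
    Chain k A p →ₗ[k] Chain k A q →ₗ[k] Chain k A N :=
  bullet (k := k) (A := A) e e' (show q + (p + 2) = N by omega) +
    (-(-1 : k) ^ (p * q)) • (bullet (k := k) (A := A) e e' (show p + (q + 2) = N by omega)).flip

theorem bracketChainChain_apply (e e' : ι → A) {p q N : ℕ} (h : p + q + 2 = N)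
    (α : Chain k A p) (β : Chain k A q) :
    bracketChainChain e e' h α β =
      bullet e e' (show q + (p + 2) = N by omega) α β -
        (-1 : k) ^ (p * q) • bullet e e' (show p + (q + 2) = N by omega) β α := by
  simp [bracketChainChain, sub_eq_add_neg]

/-- The composition `g ∘ f`, the sum over `1 ≤ i ≤ p + 1` of
`(-1)^{i-1} g (ā_1 ⊗ ⋯ ⊗ ā_{i-1} ⊗ f̄ ⊗ ā_i ⊗ ⋯ ⊗ ā_p)`, for `g` in `C^{p+1}(A, A)` and `f` in
`C^0(A, A)`. The summation index of the code is `i - 1`. -/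
noncomputable def circ {p : ℕ} (g : Cochain k A (p + 1)) (f : Cochain k A 0) : Cochain k A p :=
  ∑ i : Fin (p + 1), (-1 : k) ^ (i : ℕ) • (g ∘ₗ insertOne rfl i (cochainZeroEquiv f))

/-- The Gerstenhaber bracket `[f, g] = f ∘ g - (-1)^{(m-1)(n-1)} g ∘ f` for `f` in `C^0(A, A)`
and `g` in `C^{p+1}(A, A)`, where `m = 0`, `n = p + 1` and `f ∘ g = 0`. -/
noncomputable def gerstenhaberCochainZero {p : ℕ} (f : Cochain k A 0) (g : Cochain k A (p + 1)) :
    Cochain k A p :=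
  -((-1 : k) ^ p • circ g f)

/-- The Gerstenhaber bracket `[g, f] = g ∘ f - (-1)^{(m-1)(n-1)} f ∘ g` for `g` in
`C^{p+1}(A, A)` and `f` in `C^0(A, A)`. -/
noncomputable def gerstenhaberZeroCochain {p : ℕ} (g : Cochain k A (p + 1)) (f : Cochain k A 0) :
    Cochain k A p :=
  circ g f

variable (k A) in
/-- A symmetrizing form on `A`: an associative, symmetric bilinear form such that
`A → Hom(A, k)`, `a ↦ ⟨a, -⟩` is an isomorphism. A symmetric algebra is a finite-dimensional algebra
with such a form. -/
structure SymmetrizingForm where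
  form : LinearMap.BilinForm k A
  assoc : ∀ a b c : A, form a (b * c) = form (a * b) c
  symm : ∀ a b : A, form a b = form b a
  bijective : Function.Bijective form

/-- The pairing `⟨f, a_0 ⊗ ā_1 ⊗ ⋯ ⊗ ā_p⟩ = ⟨a_0, f (ā_1 ⊗ ⋯ ⊗ ā_p)⟩` of `C^p(A, A)` and
`C_p(A, A)` induced by a bilinear form on `A`. -/
noncomputable def pairing (φ : LinearMap.BilinForm k A) {p : ℕ} (f : Cochain k A p) :
    Chain k A p →ₗ[k] k :=
  TensorProduct.lift (φ.compl₂ f)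

/-- The bracket `{α, f}` of `α` in `C_p(A, A)` and `f` in `C^0(A, A)`, the sum over
`1 ≤ i ≤ p + 1` of `(-1)^{p+i-1} a_0 ⊗ ā_1 ⊗ ⋯ ⊗ ā_{i-1} ⊗ f̄ ⊗ ā_i ⊗ ⋯ ⊗ ā_p`. By
`pairing_bracketChainCochain` and `eq_of_forall_pairing_eq` it is the unique chain with
`⟨{α, f}, g⟩ = -⟨α, [f, g]⟩` for all `g` in `C^{p+1}(A, A)`. -/
noncomputable def bracketChainCochain {p : ℕ} :
    Chain k A p →ₗ[k] Cochain k A 0 →ₗ[k] Chain k A (p + 1) :=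
  (∑ i : Fin (p + 1), (-1 : k) ^ (p + i : ℕ) •
    (LinearMap.lTensorHom A ∘ₗ insertOne rfl i ∘ₗ cochainZeroEquiv.toLinearMap)).flip

/-- The bracket `{f, α}` of `f` in `C^0(A, A)` and `α` in `C_p(A, A)`, the sum over
`1 ≤ i ≤ p + 1` of `(-1)^i a_0 ⊗ ā_1 ⊗ ⋯ ⊗ ā_{i-1} ⊗ f̄ ⊗ ā_i ⊗ ⋯ ⊗ ā_p`. By
`pairing_bracketCochainChain` and `eq_of_forall_pairing_eq` it is the unique chain with
`⟨{f, α}, g⟩ = -⟨α, [g, f]⟩` for all `g` in `C^{p+1}(A, A)`. The number `N = p + 1` is kept apart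
from `p + 1` to avoid casts. -/
noncomputable def bracketCochainChain {p N : ℕ} (h : p + 1 = N) :
    Cochain k A 0 →ₗ[k] Chain k A p →ₗ[k] Chain k A N :=
  ∑ i : Fin (p + 1), (-1 : k) ^ (i + 1 : ℕ) •
    (LinearMap.lTensorHom A ∘ₗ insertOne h i ∘ₗ cochainZeroEquiv.toLinearMap)

theorem pairing_bracketChainCochain (φ : LinearMap.BilinForm k A) {p : ℕ} (α : Chain k A p)
    (f : Cochain k A 0) (g : Cochain k A (p + 1)) :
    pairing φ g (bracketChainCochain α f) = -pairing φ (gerstenhaberCochainZero f g) α := by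
  induction α using TensorProduct.induction_on with
  | zero => simp
  | add x y hx hy => simp only [map_add, LinearMap.add_apply, hx, hy, neg_add]
  | tmul a₀ t =>
    simp [pairing, bracketChainCochain, gerstenhaberCochainZero, circ, pow_add, mul_assoc,
      Finset.mul_sum]

theorem pairing_bracketCochainChain (φ : LinearMap.BilinForm k A) {p : ℕ} (α : Chain k A p)
    (f : Cochain k A 0) (g : Cochain k A (p + 1)) :
    pairing φ g (bracketCochainChain rfl f α) = -pairing φ (gerstenhaberZeroCochain g f) α := by
  induction α using TensorProduct.induction_on with
  | zero => simp
  | add x y hx hy => simp only [map_add, hx, hy, neg_add]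
  | tmul a₀ t =>
    simp [pairing, bracketCochainChain, gerstenhaberZeroCochain, circ, pow_succ]

theorem eq_of_forall_pairing_eq (φ : SymmetrizingForm k A) {p : ℕ} (α β : Chain k A p)
    (h : ∀ g : Cochain k A p, pairing φ.form g α = pairing φ.form g β) : α = β := by
  classical
  have hfree : Module.Free k (BarPow k A p) := Module.Free.of_basis
    (Basis.piTensorProduct fun _ : Fin p => Module.Basis.ofVectorSpace k (Bar k A))
  let B := Module.Basis.ofVectorSpace k A
  apply (TensorProduct.equivFinsuppOfBasisLeft (N := BarPow k A p) B).injective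
  ext i
  rw [TensorProduct.equivFinsuppOfBasisLeft_apply, TensorProduct.equivFinsuppOfBasisLeft_apply,
    ← sub_eq_zero, ← Module.forall_dual_apply_eq_zero_iff k]
  intro χ
  obtain ⟨c, hc⟩ := φ.bijective.2 (B.coord i)
  have key : ∀ γ : Chain k A p,
      pairing φ.form (LinearMap.toSpanSingleton k A c ∘ₗ χ) γ =
        χ (TensorProduct.lid k _ ((B.coord i).rTensor _ γ)) := fun γ => by
    induction γ using TensorProduct.induction_on with
    | zero => simp
    | add x y hx hy => simp only [map_add, hx, hy]
    | tmul a₀ t =>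
      simp only [pairing, TensorProduct.lift.tmul, LinearMap.compl₂_apply, LinearMap.comp_apply,
        LinearMap.toSpanSingleton_apply, map_smul, LinearMap.rTensor_tmul, TensorProduct.lid_tmul,
        ← hc, φ.symm c a₀, smul_eq_mul, mul_comm]
  rw [map_sub, sub_eq_zero, ← key, ← key, h]

end Form

end Chains

section Complex

variable (k : Type*) [Field k] (A : Type*) [Ring A] [Algebra k A]

/-- The component of degree `-n` of the complex `𝒟^*(A, A)` of a symmetric algebra,
`⋯ → C_1(A, A) → C_0(A, A) → C^0(A, A) → C^1(A, A) → ⋯`, in which `C^m(A, A)` has degree `m` and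
`C_p(A, A)` has degree `-p-1`. -/
def D : ℕ → Type _
  | 0 => Cochain k A 0
  | p + 1 => Chain k A p

noncomputable instance (n : ℕ) : AddCommGroup (D k A n) :=
  match n with
  | 0 => inferInstanceAs (AddCommGroup (Cochain k A 0))
  | p + 1 => inferInstanceAs (AddCommGroup (Chain k A p))

noncomputable instance (n : ℕ) : Module k (D k A n) :=
  match n with
  | 0 => inferInstanceAs (Module k (Cochain k A 0))
  | p + 1 => inferInstanceAs (Module k (Chain k A p))

variable {k A} {ι : Type*} [Fintype ι]

/-- The differential `𝒟^{-n-1}(A, A) → 𝒟^{-n}(A, A)`: the map `τ` for `n = 0`, and the Hochschild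
differential `b` for `n > 0`. -/
noncomputable def differential (e e' : ι → A) : (n : ℕ) → D k A (n + 1) →ₗ[k] D k A n
  | 0 => traceMap (k := k) e e'
  | p + 1 => hochschildB (k := k) (A := A) p

/-- The cocycles of degree `-n`. -/
noncomputable def cocycles (e e' : ι → A) : (n : ℕ) → Submodule k (D k A n)
  | 0 => LinearMap.ker (hochschildDeltaZero (k := k) (A := A))
  | n + 1 => LinearMap.ker (differential (k := k) e e' n)

variable (k) in
/-- The cohomology `H^{-n}(𝒟^*(A, A))`. -/
abbrev TH (e e' : ι → A) (n : ℕ) : Type _ :=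
  cocycles (k := k) e e' n ⧸
    (LinearMap.range (differential (k := k) e e' n)).submoduleOf (cocycles (k := k) e e' n)

variable (k) in
/-- The non-positive part `H^{≤ 0}(𝒟^*(A, A))`. -/
abbrev THNonpos (e e' : ι → A) : Type _ := DirectSum ℕ (TH k e e')

/-- The cohomology class of a cocycle. -/
noncomputable def cohomClass (e e' : ι → A) (n : ℕ) (x : D k A n) (hx : x ∈ cocycles e e' n) :
    THNonpos k e e' :=
  DirectSum.lof k ℕ (TH k e e') n (Submodule.Quotient.mk ⟨x, hx⟩)

variable (k) in
/-- The grading of `H^{≤ 0}(𝒟^*(A, A))` by the integers. -/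
noncomputable def thGrading (e e' : ι → A) (d : ℤ) : Submodule k (THNonpos k e e') :=
  if d ≤ 0 then LinearMap.range (DirectSum.lof k ℕ (TH k e e') (-d).toNat) else ⊥

/-- The unit `1` of `A` as an element of `𝒟^0(A, A) = C^0(A, A)`. -/
noncomputable def unitCochain : D k A 0 := (cochainZeroEquiv (k := k) (A := A)).symm 1

theorem unit_mem_cocycles (e e' : ι → A) : unitCochain ∈ cocycles (k := k) e e' 0 := by
  refine LinearMap.mem_ker.2 (PiTensorProduct.ext ?_)
  ext v
  obtain ⟨x, hx⟩ := bar_surjective k A (v 0)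
  have hv : v = fun _ => bar k A x := by
    funext i
    rw [Subsingleton.elim i 0]
    exact hx.symm
  subst hv
  exact (hochschildDeltaZero_apply _ x).trans (by simp [unitCochain])

variable (k) in
/-- The unit of `H^{≤ 0}(𝒟^*(A, A))`. -/
noncomputable def unitClass (e e' : ι → A) : THNonpos k e e' :=
  cohomClass e e' 0 unitCochain (unit_mem_cocycles e e')

/-- The `⋆`-product on the non-positive part of `𝒟^*(A, A)`. -/
noncomputable def starProduct (e e' : ι → A) :
    (m n : ℕ) → D k A m →ₗ[k] D k A n →ₗ[k] D k A (m + n)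
  | 0, 0 => starCochainCochain (k := k) (A := A)
  | 0, q + 1 => starCochainChain (k := k) (A := A) (p := q) (N := 0 + q) (by omega)
  | _ + 1, 0 => starChainCochain (k := k) (A := A)
  | p + 1, q + 1 => starChainChain (k := k) e e' (p := p) (q := q) rfl

/-- The bracket `{·, ·}` on the non-positive part of `𝒟^*(A, A)`. The bracket of two elements of
`C^0(A, A)` is their Gerstenhaber bracket, which is zero. -/
noncomputable def lieBracket (e e' : ι → A) :
    (m n : ℕ) → D k A m →ₗ[k] D k A n →ₗ[k] D k A (m + n + 1)
  | 0, 0 => 0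
  | 0, q + 1 => bracketCochainChain (k := k) (A := A) (p := q) (N := 0 + (q + 1)) (by omega)
  | _ + 1, 0 => bracketChainCochain (k := k) (A := A)
  | p + 1, q + 1 =>
    bracketChainChain (k := k) e e' (p := p) (q := q) (N := p + 1 + (q + 1)) (by omega)

/-- Connes' operator on the non-positive part of `𝒟^*(A, A)`, extended by zero to `C^0(A, A)`. -/
noncomputable def connes : (n : ℕ) → D k A n →ₗ[k] D k A (n + 1)
  | 0 => 0
  | p + 1 => connesB (k := k) (A := A) p

end Complex

end TateHochschild

section BV

variable {k : Type*} [CommRing k] {V : Type*} [AddCommGroup V] [Module k V]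

/-- `V = ⨁ 𝒱 n` is a graded commutative associative algebra with unit. -/
structure IsGradedCommAlgebra (𝒱 : ℤ → Submodule k V) (mul : V →ₗ[k] V →ₗ[k] V) (one : V) :
    Prop where
  isInternal : DirectSum.IsInternal 𝒱
  one_mem : one ∈ 𝒱 0
  mul_mem : ∀ (m n : ℤ), ∀ a ∈ 𝒱 m, ∀ b ∈ 𝒱 n, mul a b ∈ 𝒱 (m + n)
  one_mul : ∀ a, mul one a = a
  mul_one : ∀ a, mul a one = a
  mul_assoc : ∀ a b c, mul (mul a b) c = mul a (mul b c)
  mul_comm : ∀ (m n : ℤ), ∀ a ∈ 𝒱 m, ∀ b ∈ 𝒱 n, mul a b = (m * n).negOnePow • mul b a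

/-- `V = ⨁ 𝒱 n` is a Gerstenhaber algebra: a graded commutative algebra with a bracket of degree
`-1` that is a graded Lie bracket for the degrees lowered by one, and a graded derivation of the
product in its second argument. -/
structure IsGerstenhaberAlgebra (𝒱 : ℤ → Submodule k V) (mul : V →ₗ[k] V →ₗ[k] V) (one : V)
    (br : V →ₗ[k] V →ₗ[k] V) : Prop extends IsGradedCommAlgebra 𝒱 mul one where
  br_mem : ∀ (m n : ℤ), ∀ a ∈ 𝒱 m, ∀ b ∈ 𝒱 n, br a b ∈ 𝒱 (m + n - 1)
  br_skew : ∀ (m n : ℤ), ∀ a ∈ 𝒱 m, ∀ b ∈ 𝒱 n,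
    br a b = -(((m - 1) * (n - 1)).negOnePow • br b a)
  jacobi : ∀ (m n : ℤ), ∀ a ∈ 𝒱 m, ∀ b ∈ 𝒱 n, ∀ c,
    br a (br b c) = br (br a b) c + ((m - 1) * (n - 1)).negOnePow • br b (br a c)
  leibniz : ∀ (m n : ℤ), ∀ a ∈ 𝒱 m, ∀ b ∈ 𝒱 n, ∀ c,
    br a (mul b c) = mul (br a b) c + ((m - 1) * n).negOnePow • mul b (br a c)

/-- `V = ⨁ 𝒱 n` is a Batalin-Vilkovisky algebra with BV operator `Δ`. -/
structure IsBVAlgebra (𝒱 : ℤ → Submodule k V) (mul : V →ₗ[k] V →ₗ[k] V) (one : V)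
    (Δ : V →ₗ[k] V) : Prop extends IsGradedCommAlgebra 𝒱 mul one where
  Δ_mem : ∀ m : ℤ, ∀ a ∈ 𝒱 m, Δ a ∈ 𝒱 (m - 1)
  Δ_one : Δ one = 0
  Δ_Δ : ∀ a, Δ (Δ a) = 0
  seven_term : ∀ (m n : ℤ), ∀ a ∈ 𝒱 m, ∀ b ∈ 𝒱 n, ∀ c,
    Δ (mul (mul a b) c) =
      mul (Δ (mul a b)) c + m.negOnePow • mul a (Δ (mul b c)) +
        (n * (m - 1)).negOnePow • mul b (Δ (mul a c)) -
        mul (mul (Δ a) b) c - m.negOnePow • mul (mul a (Δ b)) c -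
        (m + n).negOnePow • mul (mul a b) (Δ c)

end BV

set_option linter.unusedSimpArgs false

/-! Let T be the free product of A with k[ε]/(ε²), graded by the number of letters ε, with dε = 1.
Its words a_0 ε a_1 ε ⋯ ε a_{p+1} make up the augmented normalized bar resolution; ε · 1 · ε = 0 is
the normalization. Because A is symmetric, the trace w ↦ ∑ e_λ w e^λ turns the chain a_0 ⊗ ā_1 ⊗ ⋯ ⊗
ā_p, read as the word a_0 ε ⋯ a_p ε, into an element of degree p + 1 that commutes with A, and every
such element arises from exactly one chain. In degree 0 the cocycles of C^0(A, A) are the centre of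
A. Under this identification (`embed`) both τ and b become d (`embed_differential`), and on cocycles
⋆ becomes the product of T (`embed_starProduct`). Hence H^{≤0} is computed by the centralizer of A
in T, and associativity and the unit come for free.

All other structure comes from operators on T that are determined by their value on ε. The
derivation `ins` with ε ↦ ε α ε has graded commutator with d equal to the commutator with α, whence
graded commutativity. The bracket is the antisymmetrization of `ins` (`embed_lieBracket`). It
satisfies the Jacobi identity on T itself because `ins` of a bracket is the commutator of the two
`ins` (`ins_bracket`), and it satisfies the Leibniz rule up to the homotopy `insTwo`, which inserts
two elements at once (`bracket_mul_sub_mem`).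

Connes' operator cuts a word at a letter ε and exchanges the halves. The cutting is the derivation
`split` with ε ↦ ε ⊗ ε, whose commutator with d is the universal derivation over A (`split_d`).
Cutting a product αβ means cutting inside α with β placed between the exchanged halves, plus the
same with the roles interchanged. Each of these is homotopic to a product with Connes' operator plus
an insertion (`tr_swapMul_split`). The insertions add up to the bracket, which is the BV identity
(`bracket_sub_mem`).

On cohomology the bracket is defined as the failure of Connes' operator to be a derivation, and
`bracket_class` identifies it with the bracket of chains. The seven-term identity is the Leibniz
rule rewritten with this definition. -/

namespace TateHochschild

/-! ### The differential graded algebra T, its grading and its derivations -/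

section EpsAlg

variable (k : Type*) [Field k] (A : Type*) [Ring A] [Algebra k A]

/-- The relations defining the free product of `A` with `k[ε] / (ε²)`. -/
inductive EpsRel : TensorAlgebra k (A × k) → TensorAlgebra k (A × k) → Prop
  | one : EpsRel (TensorAlgebra.ι k ((1 : A), (0 : k))) 1
  | mul (a b : A) : EpsRel (TensorAlgebra.ι k (a * b, (0 : k)))
      (TensorAlgebra.ι k (a, (0 : k)) * TensorAlgebra.ι k (b, (0 : k)))
  | sq : EpsRel (TensorAlgebra.ι k ((0 : A), (1 : k)) * TensorAlgebra.ι k ((0 : A), (1 : k))) 0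

/-- The free product of `A` with `k[ε] / (ε²)`. With the differential `dε = 1` it is the normalized
bar resolution of `A`, augmented by `A`. -/
def EpsAlg : Type _ := RingQuot (EpsRel k A)

noncomputable instance : Ring (EpsAlg k A) := inferInstanceAs (Ring (RingQuot (EpsRel k A)))

noncomputable instance : Algebra k (EpsAlg k A) :=
  inferInstanceAs (Algebra k (RingQuot (EpsRel k A)))

namespace EpsAlg

/-- The projection from the tensor algebra. -/
noncomputable def mk : TensorAlgebra k (A × k) →ₐ[k] EpsAlg k A :=
  RingQuot.mkAlgHom k (EpsRel k A)

variable {k A}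

variable (k) in
/-- The embedding of `A`. -/
noncomputable def incl : A →ₐ[k] EpsAlg k A :=
  AlgHom.ofLinearMap
    ((mk k A).toLinearMap ∘ₗ TensorAlgebra.ι k ∘ₗ LinearMap.inl k A k)
    ((RingQuot.mkAlgHom_rel k EpsRel.one).trans (map_one _))
    (fun a b => (RingQuot.mkAlgHom_rel k (EpsRel.mul a b)).trans (map_mul _ _ _))

variable (k A) in
/-- The generator `ε`. -/
noncomputable def eps : EpsAlg k A := mk k A (TensorAlgebra.ι k ((0 : A), (1 : k)))

@[simp]
theorem eps_mul_eps : eps k A * eps k A = 0 := by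
  have h : mk k A _ = mk k A _ := RingQuot.mkAlgHom_rel k (EpsRel.sq (k := k) (A := A))
  rw [map_mul, map_zero] at h
  exact h

@[simp]
theorem eps_mul_eps_mul (x : EpsAlg k A) : eps k A * (eps k A * x) = 0 := by
  rw [← mul_assoc, eps_mul_eps, zero_mul]

theorem mk_ι (a : A) (c : k) : mk k A (TensorAlgebra.ι k (a, c)) = incl k a + c • eps k A := by
  have : (a, c) = LinearMap.inl k A k a + c • ((0 : A), (1 : k)) := by simp
  rw [this, map_add, map_add, map_smul, map_smul]
  rfl

theorem induction {P : EpsAlg k A → Prop} (incl : ∀ a, P (incl k a)) (eps : P (eps k A))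
    (smul : ∀ (c : k) x, P x → P (c • x))
    (mul : ∀ x y, P x → P y → P (x * y)) (add : ∀ x y, P x → P y → P (x + y)) (x) : P x := by
  obtain ⟨x, rfl⟩ := RingQuot.mkAlgHom_surjective k (EpsRel k A) x
  change P (mk k A x)
  induction x using TensorAlgebra.induction with
  | algebraMap r =>
    rw [AlgHom.commutes, ← AlgHom.commutes (EpsAlg.incl k)]
    exact incl _
  | ι x =>
    obtain ⟨a, c⟩ := x
    rw [mk_ι]
    exact add _ _ (incl a) (smul c _ eps)
  | mul x y hx hy => rw [map_mul]; exact mul _ _ hx hy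
  | add x y hx hy => rw [map_add]; exact add _ _ hx hy

/-- The universal property. -/
noncomputable def lift {B : Type*} [Semiring B] [Algebra k B] (f : A →ₐ[k] B) (x : B)
    (hx : x * x = 0) : EpsAlg k A →ₐ[k] B :=
  RingQuot.liftAlgHom k (s := EpsRel k A)
    ⟨TensorAlgebra.lift k (f.toLinearMap.coprod (LinearMap.toSpanSingleton k B x)), by
      rintro _ _ (_ | ⟨a, b⟩ | _) <;> simp [hx]⟩

theorem lift_mk {B : Type*} [Semiring B] [Algebra k B] (f : A →ₐ[k] B) (x : B) (hx : x * x = 0)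
    (y) : lift f x hx (mk k A y) =
      TensorAlgebra.lift k (f.toLinearMap.coprod (LinearMap.toSpanSingleton k B x)) y :=
  RingQuot.liftAlgHom_mkAlgHom_apply ..

@[simp]
theorem lift_incl {B : Type*} [Semiring B] [Algebra k B] (f : A →ₐ[k] B) (x : B) (hx : x * x = 0)
    (a : A) : lift f x hx (incl k a) = f a :=
  (lift_mk ..).trans (by simp)

@[simp]
theorem lift_eps {B : Type*} [Semiring B] [Algebra k B] (f : A →ₐ[k] B) (x : B) (hx : x * x = 0) :
    lift f x hx (eps k A) = x :=
  (lift_mk ..).trans (by simp)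

theorem algHom_ext {B : Type*} [Semiring B] [Algebra k B] {f g : EpsAlg k A →ₐ[k] B}
    (h1 : ∀ a, f (incl k a) = g (incl k a)) (h2 : f (eps k A) = g (eps k A)) (x) : f x = g x := by
  induction x using induction with
  | incl a => exact h1 a
  | eps => exact h2
  | smul c x hx => rw [map_smul, map_smul, hx]
  | mul x y hx hy => rw [map_mul, map_mul, hx, hy]
  | add x y hx hy => rw [map_add, map_add, hx, hy]

/-- The endomorphism `ε ↦ c ε`. -/
noncomputable def scale (c : k) : EpsAlg k A →ₐ[k] EpsAlg k A :=
  lift (incl k) (c • eps k A) (by simp)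

@[simp]
theorem scale_incl (c : k) (a : A) : scale c (incl k a) = incl k a := lift_incl ..

@[simp]
theorem scale_eps (c : k) : scale c (eps k A) = c • eps k A := lift_eps ..

theorem scale_scale (c c' : k) (x : EpsAlg k A) : scale c (scale c' x) = scale (c * c') x :=
  algHom_ext (f := (scale c).comp (scale c')) (by simp) (by simp [smul_smul, mul_comm]) x

@[simp]
theorem scale_one (x : EpsAlg k A) : scale 1 x = x :=
  algHom_ext (g := AlgHom.id k _) (by simp) (by simp) x

/-- Homogeneous elements for the grading with `A` in degree `0` and `ε` in degree `1`. -/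
inductive IsHom : ℕ → EpsAlg k A → Prop
  | incl (a : A) : IsHom 0 (incl k a)
  | eps : IsHom 1 (eps k A)
  | zero (n : ℕ) : IsHom n 0
  | smul {n : ℕ} (c : k) {x : EpsAlg k A} (hx : IsHom n x) : IsHom n (c • x)
  | add {n : ℕ} {x y : EpsAlg k A} (hx : IsHom n x) (hy : IsHom n y) : IsHom n (x + y)
  | mul {m n : ℕ} {x y : EpsAlg k A} (hx : IsHom m x) (hy : IsHom n y) : IsHom (m + n) (x * y)

theorem IsHom.scale {n : ℕ} {x : EpsAlg k A} (hx : IsHom n x) (c : k) :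
    scale c x = c ^ n • x := by
  induction hx with
  | incl a => simp
  | eps => simp
  | zero n => simp
  | smul r hx ih => rw [map_smul, ih, smul_comm]
  | add hx hy h1 h2 => rw [map_add, h1, h2, smul_add]
  | mul hx hy h1 h2 => rw [map_mul, h1, h2, smul_mul_smul_comm, pow_add]

theorem IsHom.neg {n : ℕ} {x : EpsAlg k A} (hx : IsHom n x) : IsHom n (-x) := by
  rw [← neg_one_smul k]; exact hx.smul _

theorem IsHom.sub {n : ℕ} {x y : EpsAlg k A} (hx : IsHom n x) (hy : IsHom n y) :
    IsHom n (x - y) := by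
  rw [sub_eq_add_neg]; exact hx.add hy.neg

theorem IsHom.sum {n : ℕ} {κ : Type*} {s : Finset κ} {x : κ → EpsAlg k A}
    (hx : ∀ i ∈ s, IsHom n (x i)) : IsHom n (∑ i ∈ s, x i) :=
  Finset.sum_induction _ (IsHom n) (fun _ _ => IsHom.add) (IsHom.zero n) hx

variable (k A) in
/-- The projection to degree `0`. -/
noncomputable def projZero : EpsAlg k A →ₐ[k] A := lift (AlgHom.id k A) 0 (by simp)

@[simp]
theorem projZero_incl (a : A) : projZero k A (incl k a) = a := lift_incl ..

@[simp]
theorem projZero_eps : projZero k A (eps k A) = 0 := lift_eps ..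

variable (k A) in
/-- The coaction `x ↦ ∑ x_n X^n`, where `x_n` is the component of `x` of degree `n`. -/
noncomputable def coact : EpsAlg k A →ₐ[k] Polynomial (EpsAlg k A) :=
  lift ((Polynomial.CAlgHom (R := k)).comp (incl k))
    (Polynomial.monomial 1 (eps k A)) (by simp [Polynomial.monomial_mul_monomial])

theorem IsHom.coact {n : ℕ} {x : EpsAlg k A} (hx : IsHom n x) :
    coact k A x = Polynomial.monomial n x := by
  induction hx with
  | incl a => exact lift_incl ..
  | eps => exact lift_eps ..
  | zero n => simp
  | smul r hx ih => rw [map_smul, ih, Polynomial.smul_monomial]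
  | add hx hy h1 h2 => rw [map_add, h1, h2, map_add]
  | mul hx hy h1 h2 => rw [map_mul, h1, h2, Polynomial.monomial_mul_monomial]

variable (k A) in
/-- The component of degree `n`. -/
noncomputable def proj (n : ℕ) : EpsAlg k A →ₗ[k] EpsAlg k A :=
  (Polynomial.lcoeff (EpsAlg k A) n).restrictScalars k ∘ₗ (coact k A).toLinearMap

theorem proj_apply (n : ℕ) (x : EpsAlg k A) : proj k A n x = (coact k A x).coeff n := rfl

theorem IsHom.proj {n : ℕ} {x : EpsAlg k A} (hx : IsHom n x) (m : ℕ) :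
    proj k A m x = if n = m then x else 0 := by
  rw [proj_apply, hx.coact, Polynomial.coeff_monomial]

theorem isHom_proj (n : ℕ) (x : EpsAlg k A) : IsHom n (proj k A n x) := by
  induction x using induction generalizing n with
  | incl a =>
    rw [(IsHom.incl a).proj]
    split_ifs with h
    · subst h; exact .incl a
    · exact .zero n
  | eps =>
    rw [IsHom.eps.proj]
    split_ifs with h
    · subst h; exact .eps
    · exact .zero n
  | smul c x hx => rw [map_smul]; exact (hx n).smul c
  | add x y hx hy => rw [map_add]; exact (hx n).add (hy n)
  | mul x y hx hy =>
    rw [proj_apply, map_mul, Polynomial.coeff_mul]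
    refine IsHom.sum fun p hp => ?_
    rw [← Finset.HasAntidiagonal.mem_antidiagonal.1 hp]
    exact (hx _).mul (hy _)

theorem exists_sum_proj (x : EpsAlg k A) :
    ∃ N, x = ∑ n ∈ Finset.range N, proj k A n x := by
  -- Setting X = 1 in the coaction adds up the components. Evaluation is multiplicative here
  -- although T is not commutative, because 1 commutes with all coefficients.
  have key : (coact k A x).eval 1 = x := by
    induction x using induction with
    | incl a => simp [(IsHom.incl (k := k) a).coact]
    | eps => simp [(IsHom.eps (k := k) (A := A)).coact]
    | smul c x hx => rw [map_smul, Polynomial.eval_smul, hx]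
    | mul x y hx hy =>
      rw [map_mul, Polynomial.eval,
        Polynomial.eval₂_mul_noncomm _ _ fun _ => Commute.one_right _]
      exact congrArg₂ _ hx hy
    | add x y hx hy => rw [map_add, Polynomial.eval_add, hx, hy]
  refine ⟨(coact k A x).natDegree + 1, ?_⟩
  conv_lhs => rw [← key, Polynomial.eval_eq_sum_range]
  simp [proj_apply]

/-- Degree 0 of T is exactly the copy of A, split off by `projZero`. -/
theorem isHom_zero_iff {x : EpsAlg k A} : IsHom 0 x ↔ incl k (projZero k A x) = x := by
  refine ⟨fun h => ?_, fun h => h ▸ .incl _⟩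
  have : ∀ n (x : EpsAlg k A), IsHom n x → n = 0 → incl k (projZero k A x) = x := by
    intro n x hx
    induction hx with
    | incl a => simp
    | eps => simp
    | zero n => simp
    | smul r hx ih => intro h; rw [map_smul, map_smul, ih h]
    | add hx hy h1 h2 => intro h; rw [map_add, map_add, h1 h, h2 h]
    | mul hx hy h1 h2 => intro h; rw [map_mul, map_mul, h1 (by omega), h2 (by omega)]
  exact this 0 x h rfl

theorem IsHom.projZero_eq_zero {n : ℕ} {x : EpsAlg k A} (h : IsHom n x) (hn : n ≠ 0) :
    EpsAlg.projZero k A x = 0 := by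
  induction h with
  | incl a => exact absurd rfl hn
  | eps => simp
  | zero n => simp
  | smul r hx ih => rw [map_smul, ih hn, smul_zero]
  | add hx hy h1 h2 => rw [map_add, h1 hn, h2 hn, add_zero]
  | @mul m n x y hx hy h1 h2 =>
    rw [map_mul]
    by_cases hm : m = 0
    · rw [h2 (by omega), mul_zero]
    · rw [h1 hm, zero_mul]

/-! ### Derivations of T from triangular representations -/

section Derivation

variable {N : Type*} [AddCommGroup N] [Module k N] (L : EpsAlg k A →ₐ[k] Module.End k N)
  (R : EpsAlg k A →ₗ[k] Module.End k N) (n : N)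

/-- The triangular representation on `T × N` that defines a derivation `T → N`. -/
noncomputable def derRep (hR : ∀ x, R (eps k A * x) n + L (eps k A) (R x n) = 0) :
    EpsAlg k A →ₐ[k] Module.End k (EpsAlg k A × N) :=
  lift ((LinearMap.prodMapAlgHom k (EpsAlg k A) N).comp
      ((Algebra.lmul k (EpsAlg k A)).prod L |>.comp (incl k)))
    (LinearMap.prod (LinearMap.mulLeft k (eps k A) ∘ₗ LinearMap.fst k _ _)
      (R.flip n ∘ₗ LinearMap.fst k _ _ + L (eps k A) ∘ₗ LinearMap.snd k _ _)) (by
    -- The matrix assigned to ε must have square zero. Its diagonal does since ε² = 0, and its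
    -- corner does by `hR`, which is the condition D(ε²) = 0 written out.
    refine LinearMap.ext fun ⟨w, z⟩ => ?_
    have h : L (eps k A) (L (eps k A) z) = 0 := by
      rw [← Module.End.mul_apply, ← map_mul]; simp
    simp [h, hR])

/-- The derivation `D : T → N` into the bimodule `N` that vanishes on `A` and takes `ε` to `n`. -/
noncomputable def der (hR : ∀ x, R (eps k A * x) n + L (eps k A) (R x n) = 0) :
    EpsAlg k A →ₗ[k] N :=
  LinearMap.snd k _ _ ∘ₗ (derRep L R n hR).toLinearMap.flip (1, 0)

variable {L R n} {hR : ∀ x, R (eps k A * x) n + L (eps k A) (R x n) = 0}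

theorem der_apply (x : EpsAlg k A) : der L R n hR x = (derRep L R n hR x (1, 0)).2 := rfl

theorem der_incl (a : A) : der L R n hR (incl k a) = 0 := by
  simp [der_apply, derRep]

theorem der_eps (h1 : R 1 = 1) : der L R n hR (eps k A) = n := by
  simp [der_apply, derRep, h1]

theorem der_mul (h1 : R 1 = 1) (hRm : ∀ x y, R (x * y) = R y * R x)
    (hLR : ∀ x y z, L x (R y z) = R y (L x z)) (x y : EpsAlg k A) :
    der L R n hR (x * y) = R y (der L R n hR x) + L x (der L R n hR y) := by
  -- The whole matrix of u: the derivation is its corner entry, so multiplicativity of the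
  -- representation is the Leibniz rule.
  have key : ∀ u w z, derRep L R n hR u (w, z) = (u * w, R w (der L R n hR u) + L u z) := by
    intro u
    induction u using induction with
    | incl a => intro w z; rw [der_incl]; simp [derRep]
    | eps => intro w z; rw [der_eps h1]; simp [derRep]
    | smul c x hx => intro w z; simp [hx]
    | mul x y hx hy =>
      intro w z
      rw [der_apply (x * y), map_mul, Module.End.mul_apply, Module.End.mul_apply, hy, hx, hy, hx]
      simp [hRm, hLR, h1, mul_assoc, add_assoc]
    | add x y hx hy =>
      intro w z
      simp only [map_add, LinearMap.add_apply, hx, hy, Prod.mk_add_mk, add_mul]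
      congr 1
      abel
  rw [der_apply, map_mul, Module.End.mul_apply, key y, key x]
  simp [h1]

end Derivation

/-- The linear map `D : T → T` that vanishes on `A`, takes `ε` to `n` and satisfies
`D (x y) = D x y + s(x) D y`, where `s` is the automorphism `ε ↦ c ε`. -/
noncomputable def sder (c : k) (n : EpsAlg k A) (h : n * eps k A + c • (eps k A * n) = 0) :
    EpsAlg k A →ₗ[k] EpsAlg k A :=
  der ((Algebra.lmul k (EpsAlg k A)).comp (scale c)) (LinearMap.mul k (EpsAlg k A)).flip n
    (fun x => by
      have : n * (eps k A * x) + c • (eps k A * (n * x)) =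
        (n * eps k A + c • (eps k A * n)) * x := by simp [add_mul, mul_assoc]
      simpa [h] using this)

section sder

variable {c : k} {n : EpsAlg k A} {h : n * eps k A + c • (eps k A * n) = 0}

@[simp]
theorem sder_incl (a : A) : sder c n h (incl k a) = 0 := der_incl a

@[simp]
theorem sder_eps : sder c n h (eps k A) = n := der_eps (by ext; simp)

@[simp]
theorem sder_one : sder c n h 1 = 0 := by
  rw [← map_one (incl k), sder_incl]

theorem sder_mul (x y : EpsAlg k A) :
    sder c n h (x * y) = sder c n h x * y + scale c x * sder c n h y :=
  der_mul (by ext; simp) (fun x y => by ext z; simp [mul_assoc])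
    (fun x y z => by simp [mul_assoc]) x y

theorem sder_mul_incl (x : EpsAlg k A) (a : A) :
    sder c n h (x * incl k a) = sder c n h x * incl k a := by simp [sder_mul]

theorem sder_incl_mul (x : EpsAlg k A) (a : A) :
    sder c n h (incl k a * x) = incl k a * sder c n h x := by simp [sder_mul]

end sder

variable (k A) in
/-- The differential: `da = 0` for `a` in `A`, `dε = 1`. -/
noncomputable def d : EpsAlg k A →ₗ[k] EpsAlg k A := sder (-1) 1 (by simp)

@[simp] theorem d_incl (a : A) : d k A (incl k a) = 0 := sder_incl a
@[simp] theorem d_one : d k A 1 = 0 := sder_one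
@[simp] theorem d_eps : d k A (eps k A) = 1 := sder_eps
theorem d_mul (x y : EpsAlg k A) : d k A (x * y) = d k A x * y + scale (-1) x * d k A y :=
  sder_mul x y
theorem d_mul_incl (x : EpsAlg k A) (a : A) : d k A (x * incl k a) = d k A x * incl k a :=
  sder_mul_incl x a
theorem d_incl_mul (x : EpsAlg k A) (a : A) : d k A (incl k a * x) = incl k a * d k A x :=
  sder_incl_mul x a

/-- The derivation `ε ↦ ε α ε`. -/
noncomputable def ins (c : k) (α : EpsAlg k A) : EpsAlg k A →ₗ[k] EpsAlg k A :=
  sder c (eps k A * α * eps k A) (by simp [mul_assoc])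

@[simp] theorem ins_incl (c : k) (α : EpsAlg k A) (a : A) : ins c α (incl k a) = 0 := sder_incl a
@[simp] theorem ins_one (c : k) (α : EpsAlg k A) : ins c α 1 = 0 := sder_one
@[simp] theorem ins_eps (c : k) (α : EpsAlg k A) :
    ins c α (eps k A) = eps k A * α * eps k A := sder_eps
theorem ins_mul (c : k) (α x y : EpsAlg k A) :
    ins c α (x * y) = ins c α x * y + scale c x * ins c α y := sder_mul x y
theorem ins_mul_incl (c : k) (α x : EpsAlg k A) (a : A) :
    ins c α (x * incl k a) = ins c α x * incl k a := sder_mul_incl x a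
theorem ins_incl_mul (c : k) (α x : EpsAlg k A) (a : A) :
    ins c α (incl k a * x) = incl k a * ins c α x := sder_incl_mul x a

theorem IsHom.ins {c : k} {m n : ℕ} {α x : EpsAlg k A} (hα : IsHom m α) (hx : IsHom n x) :
    IsHom (m + n + 1) (ins c α x) := by
  induction hx with
  | incl a => rw [ins_incl]; exact .zero _
  | eps =>
    rw [ins_eps]
    convert (IsHom.eps.mul hα).mul .eps using 1
    omega
  | zero n => rw [map_zero]; exact .zero _
  | smul r hx ih => rw [map_smul]; exact ih.smul r
  | add hx hy h1 h2 => rw [map_add]; exact h1.add h2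
  | @mul i j x y hx hy h1 h2 =>
    rw [ins_mul, hx.scale, smul_mul_assoc]
    refine IsHom.add ?_ (IsHom.smul _ ?_)
    · convert h1.mul hy using 1; omega
    · convert hx.mul h2 using 1; omega

/-- The first clause covers n = 0, where the truncated n - 1 alone would only place the differential
in degree 0. -/
theorem IsHom.d {n : ℕ} {x : EpsAlg k A} (hx : IsHom n x) :
    (n = 0 → d k A x = 0) ∧ IsHom (n - 1) (d k A x) := by
  induction hx with
  | incl a => simp [IsHom.zero]
  | eps => simpa using IsHom.incl (k := k) (1 : A)
  | zero n => simp [IsHom.zero]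
  | smul r hx ih =>
    rw [map_smul]
    exact ⟨fun h => by rw [ih.1 h, smul_zero], ih.2.smul r⟩
  | add hx hy h1 h2 =>
    rw [map_add]
    exact ⟨fun h => by rw [h1.1 h, h2.1 h, add_zero], h1.2.add h2.2⟩
  | @mul i j x y hx hy h1 h2 =>
    rw [d_mul, hx.scale, smul_mul_assoc]
    refine ⟨fun h => by rw [h1.1 (by omega), h2.1 (by omega)]; simp, IsHom.add ?_ (IsHom.smul _ ?_)⟩
    · rcases Nat.eq_zero_or_pos i with h | h
      · rw [h1.1 h, zero_mul]; exact .zero _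
      · convert h1.2.mul hy using 1; omega
    · rcases Nat.eq_zero_or_pos j with h | h
      · rw [h2.1 h, mul_zero]; exact .zero _
      · convert hx.mul h2.2 using 1; omega

/-- The factor c records that d lowers the degree by one. Valid for inhomogeneous elements, it can
be used inside inductions over generators of T. -/
theorem d_scale (c : k) (x : EpsAlg k A) : d k A (scale c x) = c • scale c (d k A x) := by
  induction x using induction with
  | incl a => simp
  | eps => simp
  | smul r x hx => simp only [map_smul, hx, smul_comm c r]
  | mul x y hx hy =>
    simp only [map_mul, d_mul, hx, hy, map_add, smul_add, smul_mul_assoc, mul_smul_comm,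
      scale_scale, mul_comm c]
  | add x y hx hy => simp only [map_add, hx, hy, smul_add]

theorem scale_ins {m : ℕ} {α : EpsAlg k A} (hα : IsHom m α) (c b : k) (x : EpsAlg k A) :
    scale c (ins b α x) = c ^ (m + 1) • ins b α (scale c x) := by
  induction x using induction with
  | incl a => simp
  | eps => simp [hα.scale, smul_smul, pow_succ, mul_assoc, mul_comm]
  | smul r x hx => simp only [map_smul, hx, smul_comm (c ^ (m + 1)) r]
  | mul x y hx hy =>
    simp only [map_mul, ins_mul, hx, hy, map_add, smul_add, smul_mul_assoc, mul_smul_comm,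
      scale_scale, mul_comm c]
  | add x y hx hy => simp only [map_add, hx, hy, smul_add]

end EpsAlg

end EpsAlg

end TateHochschild

namespace TateHochschild

/-! ### Insertion operators as homotopies on the centralizer of A -/

section Homotopy

variable {k : Type*} [Field k] {A : Type*} [Ring A] [Algebra k A]

namespace EpsAlg

variable (k A) in
/-- The centralizer of `A`. -/
noncomputable def cent : Subalgebra k (EpsAlg k A) :=
  Subalgebra.centralizer k (Set.range (incl k : A → EpsAlg k A))

theorem mem_cent {x : EpsAlg k A} : x ∈ cent k A ↔ ∀ a, incl k a * x = x * incl k a := by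
  simp [cent, Subalgebra.mem_centralizer_iff]

theorem ins_mem_cent (c : k) (α : EpsAlg k A) {x : EpsAlg k A} (hx : x ∈ cent k A) :
    ins c α x ∈ cent k A :=
  mem_cent.2 fun a => by rw [← ins_incl_mul, ← ins_mul_incl, mem_cent.1 hx]

theorem proj_mem_cent (n : ℕ) {x : EpsAlg k A} (hx : x ∈ cent k A) :
    proj k A n x ∈ cent k A :=
  mem_cent.2 fun a => by
    have h := congrArg (proj k A n) (mem_cent.1 hx a)
    simpa [proj_apply, (IsHom.incl (k := k) a).coact, Polynomial.coeff_C_mul,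
      Polynomial.coeff_mul_C] using h

/-- Homogeneous cocycles of the complex of elements that commute with `A`. -/
structure IsCocycle (n : ℕ) (x : EpsAlg k A) : Prop where
  isHom : IsHom n x
  cent : x ∈ cent k A
  d : d k A x = 0

theorem IsCocycle.mul {m n : ℕ} {x y : EpsAlg k A} (hx : IsCocycle m x) (hy : IsCocycle n y) :
    IsCocycle (m + n) (x * y) :=
  ⟨hx.isHom.mul hy.isHom, mul_mem hx.cent hy.cent, by simp [d_mul, hx.d, hy.d]⟩

/-- `[d, ins α] = [α, ·]`. -/
theorem d_ins {m : ℕ} {α : EpsAlg k A} (hα : IsCocycle m α) {c : k} (hc : c = (-1) ^ (m + 1))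
    (x : EpsAlg k A) :
    d k A (ins c α x) = c • ins c α (d k A x) + α * x - scale (-c) x * α := by
  have hcc : c * c = 1 := by rw [hc, ← mul_pow]; simp
  have hα' : scale (-1) α = -c • α := by rw [hα.isHom.scale, hc, pow_succ]; simp
  induction x using induction with
  | incl a => simp [mem_cent.1 hα.cent]
  -- Removing one of the two outer letters of ε α ε leaves α ε + c • ε α.
  | eps => simp [d_mul, hα.d, hα']
  | smul r x hx => simp only [map_smul, hx, smul_mul_assoc, mul_smul_comm]; module
  | add x y hx hy => simp only [map_add, hx, hy, add_mul, mul_add]; module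
  | mul x y hx hy =>
    simp only [ins_mul, d_mul, map_add, map_mul, hx, hy, d_scale, scale_scale,
      scale_ins hα.isHom, ← hc, add_mul, mul_add, sub_mul, mul_sub, smul_mul_assoc, mul_smul_comm,
      mul_assoc, neg_mul, one_mul, mul_neg, mul_one]
    module

/-- Graded commutativity up to homotopy. -/
theorem IsCocycle.d_ins {m n : ℕ} {α β : EpsAlg k A} (hα : IsCocycle m α) (hβ : IsCocycle n β)
    {c : k} (hc : c = (-1) ^ (m + 1)) :
    EpsAlg.d k A (ins c α β) = α * β - (-1 : k) ^ (m * n) • (β * α) := by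
  rw [EpsAlg.d_ins hα hc, hβ.d, hβ.isHom.scale, hc, pow_succ]
  simp [pow_mul]

/-- The graded Lie bracket of homogeneous elements of degrees `m` and `n`. -/
noncomputable def bracket (m n : ℕ) (α β : EpsAlg k A) : EpsAlg k A :=
  (-1 : k) ^ (m + 1) • ins ((-1) ^ (m + 1)) α β -
    (-1 : k) ^ (m * (n + 1)) • ins ((-1) ^ (n + 1)) β α

theorem neg_one_pow_eq {a b : ℕ} (h : Even (a + b)) : (-1 : k) ^ a = (-1) ^ b := by
  rcases Nat.even_or_odd b with hb | hb
  · rw [hb.neg_one_pow, ((Nat.even_add.1 h).2 hb).neg_one_pow]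
  · rw [hb.neg_one_pow, (Nat.not_even_iff_odd.1
      (fun ha => Nat.not_even_iff_odd.2 hb ((Nat.even_add.1 h).1 ha))).neg_one_pow]

theorem neg_one_pow_eq_neg {a b : ℕ} (h : Odd (a + b)) : (-1 : k) ^ a = -(-1) ^ b := by
  rw [← mul_neg_one ((-1 : k) ^ b), ← pow_succ]
  exact neg_one_pow_eq (by rw [← add_assoc]; exact h.add_one)

/-- Both insertions have the graded commutator of α and β as differential, up to sign, and the signs
in `bracket` make the two contributions cancel. -/
theorem IsCocycle.bracket {m n : ℕ} {α β : EpsAlg k A} (hα : IsCocycle m α)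
    (hβ : IsCocycle n β) : IsCocycle (m + n + 1) (bracket m n α β) where
  isHom := by
    refine ((hα.isHom.ins hβ.isHom).smul _).sub (IsHom.smul _ ?_)
    rw [add_comm m]
    exact hβ.isHom.ins hα.isHom
  cent := sub_mem ((EpsAlg.cent k A).smul_mem (ins_mem_cent _ _ hβ.cent) _)
    ((EpsAlg.cent k A).smul_mem (ins_mem_cent _ _ hα.cent) _)
  d := by
    rw [EpsAlg.bracket, map_sub, map_smul, map_smul, hα.d_ins hβ rfl, hβ.d_ins hα rfl, smul_sub,
      smul_sub, smul_smul, smul_smul, ← pow_add, ← pow_add,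
      neg_one_pow_eq_neg (a := m + 1) (b := m * (n + 1) + n * m) (by
        rw [show m + 1 + (m * (n + 1) + n * m) = 2 * (m + m * n) + 1 by ring]; simp),
      neg_one_pow_eq_neg (a := m + 1 + m * n) (b := m * (n + 1)) (by
        rw [show m + 1 + m * n + m * (n + 1) = 2 * (m + m * n) + 1 by ring]; simp)]
    module

/-- Both sides are derivations with the same twist that vanish on A, so only the value on ε matters.
There the terms ε α ε β ε and ε β ε α ε cancel in the commutator, which leaves the insertions of α
into β and of β into α. This is the source of the Jacobi identity. -/
theorem ins_bracket {m n : ℕ} {α β : EpsAlg k A} (hα : IsHom m α) (hβ : IsHom n β)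
    (x : EpsAlg k A) :
    ins ((-1) ^ (m + n)) (bracket m n α β) x =
      ins ((-1) ^ (m + 1)) α (ins ((-1) ^ (n + 1)) β x) -
        (-1 : k) ^ ((m + 1) * (n + 1)) •
          ins ((-1) ^ (n + 1)) β (ins ((-1) ^ (m + 1)) α x) := by
  induction x using induction with
  | incl a => simp
  | eps =>
    simp only [ins_eps, ins_mul, bracket, map_mul, scale_eps, hα.scale, hβ.scale]
    rcases neg_one_pow_eq_or k m with hm | hm <;> rcases neg_one_pow_eq_or k n with hn | hn <;>
    simp only [hm, hn, pow_succ, pow_add, pow_mul, mul_add, add_mul, mul_one, one_mul, one_pow,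
      mul_neg, neg_mul, neg_neg, one_smul, neg_smul, mul_assoc, sub_mul, mul_sub] <;>
    abel
  | smul r x hx => simp only [map_smul, hx]; module
  | add x y hx hy => simp only [map_add, hx, hy]; module
  | mul x y hx hy =>
    rw [ins_mul, hx, hy]
    simp only [ins_mul, map_add, scale_ins hα, scale_ins hβ, scale_scale]
    rcases neg_one_pow_eq_or k m with hm | hm <;> rcases neg_one_pow_eq_or k n with hn | hn <;>
    simp only [hm, hn, pow_succ, pow_add, pow_mul, mul_add, add_mul, mul_one, one_mul, one_pow,
      mul_neg, neg_mul, neg_neg, one_smul, neg_smul, sub_mul, mul_sub] <;>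
    abel

/-! ### The second-order operator that inserts two elements -/

section insTwo

/-- The left action of `T` on `T × T` through triangular matrices with the entries of `ins b β`
off the diagonal. -/
noncomputable def insTwoLeft (b c : k) (β : EpsAlg k A) :
    EpsAlg k A →ₐ[k] Module.End k (EpsAlg k A × EpsAlg k A) :=
  AlgHom.ofLinearMap
    (LinearMap.mk₂ k (fun u z => (scale c u * z.1,
      ins b β (scale c u) * z.1 + scale (b * c) u * z.2))
      (by intros; simp [add_mul]; abel) (by intros; simp)
      (by intros; simp [mul_add]; abel) (by intros; simp))
    (by ext <;> simp)
    (fun x y => LinearMap.ext fun z => by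
      simp [ins_mul, mul_add, add_mul, mul_assoc, scale_scale, add_assoc])

theorem insTwoLeft_apply (b c : k) (β u : EpsAlg k A) (z : EpsAlg k A × EpsAlg k A) :
    insTwoLeft b c β u z =
      (scale c u * z.1, ins b β (scale c u) * z.1 + scale (b * c) u * z.2) := rfl

variable (k A) in
/-- The right action of `T` on `T × T`. -/
noncomputable def prodRight : EpsAlg k A →ₗ[k] Module.End k (EpsAlg k A × EpsAlg k A) :=
  LinearMap.mk₂ k (fun u z => (z.1 * u, z.2 * u)) (by intros; simp [mul_add])
    (by intros; simp) (by intros; simp [add_mul]) (by intros; simp)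

theorem prodRight_apply (u : EpsAlg k A) (z : EpsAlg k A × EpsAlg k A) :
    prodRight k A u z = (z.1 * u, z.2 * u) := rfl

theorem prodRight_one : prodRight k A 1 = 1 := LinearMap.ext fun z => by simp [prodRight_apply]

/-- The derivation into `T × T` with components `ins c γ` and `insTwo b c β γ`. -/
noncomputable def insTwoDer (b c : k) (β γ : EpsAlg k A) :
    EpsAlg k A →ₗ[k] EpsAlg k A × EpsAlg k A :=
  der (insTwoLeft b c β) (prodRight k A)
    (eps k A * γ * eps k A, eps k A * β * eps k A * γ * eps k A)
    (fun x => by simp [mul_assoc, insTwoLeft_apply, prodRight_apply])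

variable {b c : k} {β γ : EpsAlg k A}

theorem insTwoDer_mul (x y : EpsAlg k A) :
    insTwoDer b c β γ (x * y) =
      prodRight k A y (insTwoDer b c β γ x) + insTwoLeft b c β x (insTwoDer b c β γ y) :=
  der_mul prodRight_one
    (fun x y => LinearMap.ext fun _ => by simp [mul_assoc, prodRight_apply])
    (fun x y z => by simp [mul_assoc, add_mul, prodRight_apply, insTwoLeft_apply]) x y

theorem insTwoDer_fst (x : EpsAlg k A) : (insTwoDer b c β γ x).1 = ins c γ x := by
  induction x using induction with
  | incl a => simp [insTwoDer, der_incl]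
  | eps => simp [insTwoDer, der_eps prodRight_one]
  | smul r x hx => simp [hx]
  | add x y hx hy => simp [hx, hy]
  | mul x y hx hy =>
    rw [insTwoDer_mul, ins_mul, ← hx, ← hy]
    rfl

variable (b c β γ) in
/-- The linear map `E` with `E (x y) = E x y + ins β (s x) ins γ y + s' x E y`, which inserts `β`
and `γ` in this order, where `s` and `s'` are the automorphisms `ε ↦ c ε` and `ε ↦ b c ε`. -/
noncomputable def insTwo : EpsAlg k A →ₗ[k] EpsAlg k A :=
  LinearMap.snd k _ _ ∘ₗ insTwoDer b c β γ

@[simp]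
theorem insTwo_incl (a : A) : insTwo b c β γ (incl k a) = 0 := by
  simp [insTwo, insTwoDer, der_incl]

@[simp]
theorem insTwo_one : insTwo b c β γ 1 = 0 := by rw [← map_one (incl k), insTwo_incl]

@[simp]
theorem insTwo_eps : insTwo b c β γ (eps k A) = eps k A * β * eps k A * γ * eps k A := by
  simp [insTwo, insTwoDer, der_eps prodRight_one]

theorem insTwo_mul (x y : EpsAlg k A) :
    insTwo b c β γ (x * y) =
      insTwo b c β γ x * y + ins b β (scale c x) * ins c γ y +
        scale (b * c) x * insTwo b c β γ y := by
  rw [insTwo, LinearMap.comp_apply, insTwoDer_mul, ← insTwoDer_fst (b := b) (c := c) (β := β) y]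
  simp [prodRight_apply, insTwoLeft_apply, add_assoc]

theorem insTwo_mem_cent {x : EpsAlg k A} (hx : x ∈ cent k A) : insTwo b c β γ x ∈ cent k A :=
  mem_cent.2 fun a => by
    have := congrArg (insTwo b c β γ) (mem_cent.1 hx a)
    simpa [insTwo_mul] using this

theorem scale_insTwo {n l : ℕ} (hβ : IsHom n β) (hγ : IsHom l γ) (a : k) (x : EpsAlg k A) :
    scale a (insTwo b c β γ x) = (a ^ (n + 1) * a ^ (l + 1)) • insTwo b c β γ (scale a x) := by
  induction x using induction with
  | incl a => simp
  | eps =>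
    simp only [insTwo_eps, map_mul, scale_eps, hβ.scale, hγ.scale, smul_mul_assoc, mul_smul_comm,
      smul_smul, map_smul]
    congr 1
    ring
  | smul r x hx => simp only [map_smul, hx]; module
  | add x y hx hy => simp only [map_add, hx, hy]; module
  | mul x y hx hy =>
    simp only [insTwo_mul, map_add, map_mul, hx, hy, scale_ins hβ, scale_ins hγ, scale_scale,
      mul_comm a, smul_mul_assoc, mul_smul_comm]
    module

/-- The differential can remove any of the three letters of ε β ε γ ε. The first leaves β times an
insertion of γ, the middle one an insertion of the product βγ, the last an insertion of β times γ.
At a cocycle x this says that inserting βγ into x obeys a product rule up to homotopy. -/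
theorem d_insTwo {n l : ℕ} (hβ : IsCocycle n β) (hγ : IsCocycle l γ) (hb : b = (-1) ^ (n + 1))
    (hc : c = (-1) ^ (l + 1)) (x : EpsAlg k A) :
    d k A (insTwo b c β γ x) = (b * c) • insTwo b c β γ (d k A x) + β * ins c γ x
      + b • ins (-(b * c)) (β * γ) x - b • (ins b β (scale (-c) x) * γ) := by
  have hb' : scale (-1) β = -b • β := by rw [hβ.isHom.scale, hb, pow_succ]; simp
  have hc' : scale (-1) γ = -c • γ := by rw [hγ.isHom.scale, hc, pow_succ]; simp
  have hb2 : b * b = 1 := by rw [hb, ← mul_pow]; simp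
  have hc2 : c * c = 1 := by rw [hc, ← mul_pow]; simp
  induction x using induction with
  | incl a => simp
  | eps =>
    simp [d_mul, hβ.d, hγ.d, hb', hc', mul_assoc, mul_add]
    module
  | smul r x hx => simp only [map_smul, hx, smul_mul_assoc, mul_smul_comm]; module
  | add x y hx hy => simp only [map_add, hx, hy, add_mul, mul_add]; module
  | mul x y hx hy =>
    simp only [insTwo_mul, ins_mul, d_mul, map_add, map_mul, hx, hy, d_scale, scale_scale,
      d_ins hβ hb, d_ins hγ hc, scale_ins hβ.isHom, ← hb, map_smul,
      scale_insTwo hβ.isHom hγ.isHom, ← hc]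
    -- Only the two signs b and c remain; the terms are matched for each of their values.
    rcases neg_one_pow_eq_or k (n + 1) with hm | hm <;>
    rcases neg_one_pow_eq_or k (l + 1) with hn | hn <;>
    rw [hm] at hb <;> rw [hn] at hc <;> subst hb hc <;>
    simp only [mul_add, add_mul, mul_one, one_mul, scale_one, neg_mul_neg, mul_assoc,
      mul_neg, neg_mul, neg_neg, one_smul, neg_smul, sub_mul, mul_sub] <;>
    abel

end insTwo

end EpsAlg

end Homotopy

end TateHochschild

namespace TateHochschild

/-! ### Cutting words at a letter ε and exchanging the halves -/

section Split

variable {k : Type*} [Field k] {A : Type*} [Ring A] [Algebra k A]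

namespace EpsAlg

variable (k A) in
/-- The left action of `T` on `T ⊗ T`, twisted by the parity. -/
noncomputable def tensorLeft : EpsAlg k A →ₐ[k] Module.End k (EpsAlg k A ⊗[k] EpsAlg k A) :=
  (Module.End.rTensorAlgHom k (EpsAlg k A) (EpsAlg k A)).comp
    ((Algebra.lmul k (EpsAlg k A)).comp (scale (-1)))

theorem tensorLeft_apply (x : EpsAlg k A) (z : EpsAlg k A ⊗[k] EpsAlg k A) :
    tensorLeft k A x z = (LinearMap.mulLeft k (scale (-1) x)).rTensor _ z := rfl

variable (k A) in
/-- The right action of `T` on `T ⊗ T`. -/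
noncomputable def tensorRight : EpsAlg k A →ₗ[k] Module.End k (EpsAlg k A ⊗[k] EpsAlg k A) :=
  LinearMap.lTensorHom (EpsAlg k A) ∘ₗ (LinearMap.mul k (EpsAlg k A)).flip

theorem tensorRight_apply (x : EpsAlg k A) (z : EpsAlg k A ⊗[k] EpsAlg k A) :
    tensorRight k A x z = (LinearMap.mulRight k x).lTensor _ z := rfl

theorem tensorRight_one : tensorRight k A 1 = 1 := by ext; simp [tensorRight_apply]

/-- The derivation `T → T ⊗ T`, `ε ↦ ε ⊗ ε`. It takes a word to the sum over its letters `ε` of the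
pairs of words into which it can be cut at this letter. -/
noncomputable def split : EpsAlg k A →ₗ[k] EpsAlg k A ⊗[k] EpsAlg k A :=
  der (tensorLeft k A) (tensorRight k A) (eps k A ⊗ₜ eps k A)
    (fun x => by simp [tensorLeft_apply, tensorRight_apply])

@[simp]
theorem split_incl (a : A) : split (incl k a) = 0 := der_incl a

@[simp]
theorem split_one : split (1 : EpsAlg k A) = 0 := by rw [← map_one (incl k), split_incl]

@[simp]
theorem split_eps : split (eps k A) = eps k A ⊗ₜ eps k A :=
  der_eps tensorRight_one

theorem split_mul (x y : EpsAlg k A) :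
    split (x * y) = (LinearMap.mulRight k y).lTensor _ (split x) +
      (LinearMap.mulLeft k (scale (-1) x)).rTensor _ (split y) :=
  der_mul tensorRight_one (fun x y => by ext; simp [mul_assoc, tensorRight_apply])
    (fun x y z => by
      induction z using TensorProduct.induction_on with
      | zero => simp
      | tmul a b => simp [tensorLeft_apply, tensorRight_apply]
      | add a b ha hb => simp only [map_add, ha, hb]) x y

theorem scale_split (c : k) (x : EpsAlg k A) :
    TensorProduct.map (scale c).toLinearMap (scale c).toLinearMap (split x) =
      c • split (scale c x) := by
  induction x using induction with
  | incl a => simp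
  | eps => simp [← TensorProduct.smul_tmul', ← TensorProduct.smul_tmul]
  | smul r x hx => simp only [map_smul, hx]; module
  | add x y hx hy => simp only [map_add, hx, hy]; module
  | mul x y hx hy =>
    have h1 : ∀ z : EpsAlg k A ⊗[k] EpsAlg k A, TensorProduct.map (scale c).toLinearMap (scale c).toLinearMap
        ((LinearMap.mulRight k y).lTensor _ z) = (LinearMap.mulRight k (scale c y)).lTensor _
          (TensorProduct.map (scale c).toLinearMap (scale c).toLinearMap z) := fun z => by
      induction z using TensorProduct.induction_on with
      | zero => simp
      | tmul a b => simp
      | add a b ha hb => simp only [map_add, ha, hb]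
    have h2 : ∀ z : EpsAlg k A ⊗[k] EpsAlg k A, TensorProduct.map (scale c).toLinearMap (scale c).toLinearMap
        ((LinearMap.mulLeft k (scale (-1) x)).rTensor _ z) =
          (LinearMap.mulLeft k (scale (-1) (scale c x))).rTensor _
            (TensorProduct.map (scale c).toLinearMap (scale c).toLinearMap z) := fun z => by
      induction z using TensorProduct.induction_on with
      | zero => simp
      | tmul a b => simp [scale_scale, mul_comm c]
      | add a b ha hb => simp only [map_add, ha, hb]
    rw [split_mul, map_add, h1, h2, hx, hy, map_mul, split_mul]
    simp

variable (k A) in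
/-- The differential of `T ⊗ T`. -/
noncomputable def dTensor :
    EpsAlg k A ⊗[k] EpsAlg k A →ₗ[k] EpsAlg k A ⊗[k] EpsAlg k A :=
  (d k A).rTensor _ + TensorProduct.map (scale (-1)).toLinearMap (d k A)

@[simp]
theorem dTensor_tmul (x y : EpsAlg k A) :
    dTensor k A (x ⊗ₜ y) = d k A x ⊗ₜ y + scale (-1) x ⊗ₜ d k A y := by
  simp [dTensor]

theorem dTensor_mulRight (z : EpsAlg k A ⊗[k] EpsAlg k A) (y : EpsAlg k A) :
    dTensor k A ((LinearMap.mulRight k y).lTensor _ z) =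
      (LinearMap.mulRight k y).lTensor _ (dTensor k A z) +
        (LinearMap.mulRight k (d k A y)).lTensor _
          (TensorProduct.map (scale (-1)).toLinearMap (scale (-1)).toLinearMap z) := by
  induction z using TensorProduct.induction_on with
  | zero => simp
  | tmul a b => simp [d_mul, TensorProduct.tmul_add, add_assoc]
  | add a b ha hb => simp only [map_add, ha, hb]; abel

theorem dTensor_mulLeft (z : EpsAlg k A ⊗[k] EpsAlg k A) (x : EpsAlg k A) :
    dTensor k A ((LinearMap.mulLeft k x).rTensor _ z) =
      (LinearMap.mulLeft k (d k A x)).rTensor _ z +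
        (LinearMap.mulLeft k (scale (-1) x)).rTensor _ (dTensor k A z) := by
  induction z using TensorProduct.induction_on with
  | zero => simp
  | tmul a b => simp [d_mul, TensorProduct.add_tmul, add_assoc]
  | add a b ha hb => simp only [map_add, ha, hb]; abel

/-- The commutator of `split` with the differential is the universal derivation
`w ↦ 1 ⊗ w - w ⊗ 1` with values in the tensor product over `A`. -/
theorem split_d {Y : Type*} [AddCommGroup Y] [Module k Y]
    (ν : EpsAlg k A ⊗[k] EpsAlg k A →ₗ[k] Y)
    (hν : ∀ x y a, ν ((x * incl k a) ⊗ₜ y) = ν (x ⊗ₜ (incl k a * y))) (w : EpsAlg k A) :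
    ν (dTensor k A (split w) + split (d k A w)) = ν (1 ⊗ₜ w - w ⊗ₜ 1) := by
  -- All balanced ν are treated at once: for a product x y the map ν is composed with multiplication
  -- by y on the right factor, respectively by x on the left factor, and both compositions are
  -- balanced again.
  induction w using induction generalizing ν with
  | incl a =>
    have := hν 1 1 a
    simp only [one_mul, mul_one] at this
    simp [this]
  | eps => simp [sub_eq_add_neg, TensorProduct.neg_tmul]
  | smul r x hx =>
    rw [TensorProduct.tmul_smul, ← TensorProduct.smul_tmul', ← smul_sub, map_smul, map_smul,
      map_smul, map_smul, ← smul_add, map_smul, map_smul, hx ν hν]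
  | add x y hx hy =>
    have h1 := hx ν hν
    have h2 := hy ν hν
    simp only [map_add, map_sub, TensorProduct.tmul_add, TensorProduct.add_tmul] at h1 h2 ⊢
    linear_combination (norm := module) h1 + h2
  | mul x y hx hy =>
    have h1 := hx (ν ∘ₗ (LinearMap.mulRight k y).lTensor _) (fun u v a => by
      simpa [mul_assoc] using hν u (v * y) a)
    have h2 := hy (ν ∘ₗ (LinearMap.mulLeft k x).rTensor _) (fun u v a => by
      simpa [mul_assoc] using hν (x * u) v a)
    have h3 : dTensor k A (split (x * y)) + split (d k A (x * y)) =
        (LinearMap.mulRight k y).lTensor _ (dTensor k A (split x) + split (d k A x)) +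
        (LinearMap.mulLeft k x).rTensor _ (dTensor k A (split y) + split (d k A y)) := by
      simp only [split_mul, map_add, dTensor_mulRight, dTensor_mulLeft, d_mul, scale_split,
        scale_scale, d_scale]
      have h4 : ∀ u : EpsAlg k A, LinearMap.mulLeft k (-u) = -LinearMap.mulLeft k u :=
        fun u => by ext; simp
      simp [h4, LinearMap.rTensor_neg]
      abel
    simp only [LinearMap.comp_apply] at h1 h2
    rw [h3, map_add, h1, h2]
    simp

/-- The linear map `x ⊗ y ↦ y α s(x)`, where `s` is the automorphism `ε ↦ c ε`. -/
noncomputable def swapMul (c : k) (α : EpsAlg k A) :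
    EpsAlg k A ⊗[k] EpsAlg k A →ₗ[k] EpsAlg k A :=
  TensorProduct.lift (LinearMap.mk₂ k (fun x y => y * α * scale c x)
    (by intros; simp [mul_add]) (by intros; simp) (by intros; simp [add_mul]) (by intros; simp))

@[simp]
theorem swapMul_tmul (c : k) (α x y : EpsAlg k A) :
    swapMul c α (x ⊗ₜ y) = y * α * scale c x := by simp [swapMul]

/-- Moving x past y α costs the Koszul sign with exponent |x|(|y| + m). When |x| + |y| has the
parity of N, this is the parity of |x|(m + N + 1), so the sign is produced by rescaling ε in x
alone. On the right-hand side the total degree is one less, hence the other exponent. -/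
theorem d_swapMul {m N : ℕ} {α : EpsAlg k A} (hα : IsCocycle m α)
    {z : EpsAlg k A ⊗[k] EpsAlg k A}
    (hz : TensorProduct.map (scale (-1)).toLinearMap (scale (-1)).toLinearMap z =
      (-1 : k) ^ N • z) :
    d k A (swapMul ((-1) ^ (m + N + 1)) α z) =
      swapMul ((-1) ^ (m + N)) α (dTensor k A z) := by
  -- For an arbitrary twist s there are two error terms; they cancel once the parity of z is fixed
  -- and s is chosen accordingly.
  have key : ∀ (s : k) (z : EpsAlg k A ⊗[k] EpsAlg k A),
      d k A (swapMul s α z) = swapMul (-s) α (dTensor k A z) -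
        (s * (-1) ^ m) • (swapMul (-s) α ((d k A).rTensor _
          (TensorProduct.map (scale (-1)).toLinearMap (scale (-1)).toLinearMap z))) -
        swapMul (-s) α ((d k A).rTensor _ z) := fun s z => by
    induction z using TensorProduct.induction_on with
    | zero => simp
    | tmul a b =>
      simp only [swapMul_tmul, d_mul, hα.d, hα.isHom.scale, dTensor_tmul, d_scale, map_add,
        scale_scale, LinearMap.rTensor_tmul, TensorProduct.map_tmul, AlgHom.toLinearMap_apply,
        map_mul, map_smul, map_neg]
      simp [mul_assoc, smul_smul]
      abel
    | add a b ha hb => simp only [map_add, ha, hb]; module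
  rw [key, hz]
  have h1 : (-1 : k) ^ (m + N) * (-1) ^ m * (-1) ^ N = 1 := by
    rw [← pow_add, ← pow_add]
    exact Even.neg_one_pow ⟨m + N, by ring⟩
  have h2 : (-1 : k) ^ (m + N + 1) = -(-1) ^ (m + N) := by rw [pow_succ, mul_neg_one]
  rw [h2]
  simp [smul_smul, h1]

/-- Cutting raises the degree by 1 and inserting by m + 1, so the parity is that of n + m. This is
the hypothesis of `d_swapMul` for the homotopy in `tr_swapMul_split`. -/
theorem scale_ins_split {m n : ℕ} {α w : EpsAlg k A} (hα : IsHom m α) (hw : IsHom n w) (c : k) :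
    TensorProduct.map (scale (-1)).toLinearMap (scale (-1)).toLinearMap
      ((ins c α).rTensor _ (split w)) = (-1 : k) ^ (n + m) • (ins c α).rTensor _ (split w) := by
  have h : ∀ z : EpsAlg k A ⊗[k] EpsAlg k A, TensorProduct.map (scale (-1)).toLinearMap (scale (-1)).toLinearMap
      ((ins c α).rTensor _ z) = (-1 : k) ^ (m + 1) • (ins c α).rTensor _
        (TensorProduct.map (scale (-1)).toLinearMap (scale (-1)).toLinearMap z) := fun z => by
    induction z using TensorProduct.induction_on with
    | zero => simp
    | tmul a b => simp [scale_ins hα, TensorProduct.smul_tmul']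
    | add a b ha hb => simp only [map_add, ha, hb, smul_add]
  rw [h, scale_split, hw.scale, map_smul, map_smul, map_smul, smul_smul, smul_smul]
  congr 1
  ring

theorem dTensor_ins {m : ℕ} {α : EpsAlg k A} (hα : IsCocycle m α) {c : k}
    (hc : c = (-1) ^ (m + 1)) (z : EpsAlg k A ⊗[k] EpsAlg k A) :
    dTensor k A ((ins c α).rTensor _ z) = c • (ins c α).rTensor _ (dTensor k A z) +
      (LinearMap.mulLeft k α - LinearMap.mulRight k α ∘ₗ (scale (-c)).toLinearMap).rTensor _ z := by
  induction z using TensorProduct.induction_on with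
  | zero => simp
  | tmul a b =>
    simp [d_ins hα hc, scale_ins hα.isHom, ← hc, TensorProduct.add_tmul, TensorProduct.sub_tmul,
      TensorProduct.smul_tmul']
    abel
  | add a b ha hb => simp only [map_add, ha, hb]; module

end EpsAlg

end Split

/-! ### Dual bases and the Casimir element -/

section Trace

variable {k : Type*} [Field k] {A : Type*} [Ring A] [Algebra k A]

/-- `e` and `e'` are dual bases for the symmetrizing form `φ`. -/
structure IsDualBasis (φ : SymmetrizingForm k A) {ι : Type*} [Fintype ι] (e e' : ι → A) :
    Prop where
  sum_left : ∀ x, ∑ l, φ.form x (e' l) • e l = x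
  sum_right : ∀ x, ∑ l, φ.form x (e l) • e' l = x

theorem isDualBasis_of_basis (φ : SymmetrizingForm k A) {ι : Type*} [Fintype ι] [DecidableEq ι]
    (e : Module.Basis ι k A) (e' : ι → A)
    (he : ∀ i j, φ.form (e i) (e' j) = if i = j then 1 else 0) : IsDualBasis φ e e' where
  sum_left x := by
    conv_rhs => rw [← e.sum_repr x]
    refine Finset.sum_congr rfl fun i _ => ?_
    have h : φ.form.flip (e' i) = e.coord i :=
      e.ext fun j => by simp [he, Finsupp.single_apply]
    rw [← e.coord_apply, ← h]
    rfl
  sum_right x := by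
    refine φ.bijective.1 (e.ext fun j => ?_)
    simp [φ.symm (e' _), he]

namespace IsDualBasis

variable {φ : SymmetrizingForm k A} {ι : Type*} [Fintype ι] {e e' : ι → A}
  (H : IsDualBasis φ e e') {M : Type*} [AddCommGroup M] [Module k M] (β : A →ₗ[k] A →ₗ[k] M)

include H

/-- The Casimir element ∑ e_λ ⊗ e^λ is symmetric because the form is; the bilinear β stands for an
arbitrary map out of A ⊗ A. -/
theorem sum_swap : ∑ l, β (e' l) (e l) = ∑ l, β (e l) (e' l) := by
  calc ∑ l, β (e' l) (e l) = ∑ l, ∑ m, φ.form (e' l) (e' m) • β (e m) (e l) := by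
        refine Finset.sum_congr rfl fun l _ => ?_
        conv_lhs => rw [← H.sum_left (e' l)]
        simp
    _ = ∑ m, β (e m) (∑ l, φ.form (e' m) (e' l) • e l) := by
        rw [Finset.sum_comm]
        simp [φ.symm (e' _) (e' _)]
    _ = ∑ l, β (e l) (e' l) := by simp only [H.sum_left]

/-- Expand a e_λ in the basis and move a through the form. This outer invariance of the Casimir
element makes traces commute with A. -/
theorem sum_mul_left (a : A) : ∑ l, β (a * e l) (e' l) = ∑ l, β (e l) (e' l * a) := by
  calc ∑ l, β (a * e l) (e' l) = ∑ l, ∑ m, φ.form (a * e l) (e' m) • β (e m) (e' l) := by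
        refine Finset.sum_congr rfl fun l _ => ?_
        conv_lhs => rw [← H.sum_left (a * e l)]
        simp
    _ = ∑ m, β (e m) (∑ l, φ.form (e' m * a) (e l) • e' l) := by
        rw [Finset.sum_comm]
        simp [φ.symm _ (e' _), φ.assoc]
    _ = ∑ l, β (e l) (e' l * a) := by simp only [H.sum_right]

/-- The inner invariance of the Casimir element, which makes the trace vanish on commutators with A.
-/
theorem sum_mul_right (a : A) : ∑ l, β (e l * a) (e' l) = ∑ l, β (e l) (a * e' l) := by
  calc ∑ l, β (e l * a) (e' l) = ∑ l, ∑ m, φ.form (e l * a) (e' m) • β (e m) (e' l) := by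
        refine Finset.sum_congr rfl fun l _ => ?_
        conv_lhs => rw [← H.sum_left (e l * a)]
        simp
    _ = ∑ m, β (e m) (∑ l, φ.form (a * e' m) (e l) • e' l) := by
        rw [Finset.sum_comm]
        simp [φ.symm _ (e _), φ.assoc]
    _ = ∑ l, β (e l) (a * e' l) := by simp only [H.sum_right]

end IsDualBasis
end Trace
end TateHochschild

namespace TateHochschild

/-! ### The trace onto the centralizer, and its homotopies with cutting -/

section TraceHomotopy

variable {k : Type*} [Field k] {A : Type*} [Ring A] [Algebra k A]
  {ι : Type*} [Fintype ι] (e e' : ι → A)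

namespace EpsAlg

/-- The trace `w ↦ ∑ e_λ w e^λ`. -/
noncomputable def tr : EpsAlg k A →ₗ[k] EpsAlg k A :=
  ∑ l, LinearMap.mulLeft k (incl k (e l)) ∘ₗ LinearMap.mulRight k (incl k (e' l))

theorem tr_apply (w : EpsAlg k A) : tr e e' w = ∑ l, incl k (e l) * w * incl k (e' l) := by
  simp [tr, mul_assoc]

variable {e e'}

theorem tr_mul_cent (w : EpsAlg k A) {z : EpsAlg k A} (hz : z ∈ cent k A) :
    tr e e' (w * z) = tr e e' w * z := by
  simp only [tr_apply, Finset.sum_mul]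
  refine Finset.sum_congr rfl fun l _ => ?_
  rw [mul_assoc, mul_assoc, ← mem_cent.1 hz]
  simp only [mul_assoc]

theorem tr_cent_mul (w : EpsAlg k A) {z : EpsAlg k A} (hz : z ∈ cent k A) :
    tr e e' (z * w) = z * tr e e' w := by
  simp only [tr_apply, Finset.mul_sum]
  refine Finset.sum_congr rfl fun l _ => ?_
  rw [← mul_assoc, mem_cent.1 hz]
  simp only [mul_assoc]

theorem map_tr {F : EpsAlg k A →ₗ[k] EpsAlg k A} (h1 : ∀ a w, F (incl k a * w) = incl k a * F w)
    (h2 : ∀ a w, F (w * incl k a) = F w * incl k a) (w : EpsAlg k A) :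
    F (tr e e' w) = tr e e' (F w) := by
  simp only [tr_apply, map_sum, h1, h2]

theorem d_tr (w : EpsAlg k A) : d k A (tr e e' w) = tr e e' (d k A w) :=
  map_tr (fun a w => d_incl_mul w a) (fun a w => d_mul_incl w a) w

theorem ins_tr (c : k) (α w : EpsAlg k A) : ins c α (tr e e' w) = tr e e' (ins c α w) :=
  map_tr (fun a w => ins_incl_mul c α w a) (fun a w => ins_mul_incl c α w a) w

theorem IsHom.tr {n : ℕ} {w : EpsAlg k A} (hw : IsHom n w) : IsHom n (tr e e' w) := by
  rw [tr_apply]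
  refine IsHom.sum fun l _ => ?_
  simpa using ((IsHom.incl (e l)).mul hw).mul (.incl (e' l))

end EpsAlg

open EpsAlg

namespace IsDualBasis

variable {e e'} {φ : SymmetrizingForm k A} (H : IsDualBasis φ e e')

include H

theorem tr_swap (w : EpsAlg k A) : ∑ l, incl k (e' l) * w * incl k (e l) = tr e e' w := by
  rw [tr_apply]
  exact H.sum_swap (LinearMap.mk₂ k (fun a b => incl k a * w * incl k b)
    (by intros; simp [add_mul]) (by intros; simp) (by intros; simp [mul_add]) (by intros; simp))

theorem tr_mem_cent (w : EpsAlg k A) : tr e e' w ∈ cent k A := mem_cent.2 fun a => by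
  have h := H.sum_mul_left (LinearMap.mk₂ k (fun a b => incl k a * w * incl k b)
    (by intros; simp [add_mul]) (by intros; simp) (by intros; simp [mul_add]) (by intros; simp)) a
  simpa [tr_apply, Finset.mul_sum, Finset.sum_mul, mul_assoc] using h

theorem tr_comm (w : EpsAlg k A) (a : A) : tr e e' (w * incl k a) = tr e e' (incl k a * w) := by
  have h := H.sum_mul_right (LinearMap.mk₂ k (fun a b => incl k a * w * incl k b)
    (by intros; simp [add_mul]) (by intros; simp) (by intros; simp [mul_add]) (by intros; simp)) a
  simpa [tr_apply, mul_assoc] using h.symm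

/-- Cutting `w` at a letter `ε` and inserting `α` between the two halves, in the reversed order, is
homotopic to the sum of the product of `α` with the same operation for `α = 1` and of the insertion
of `α` into `w`. -/
theorem tr_swapMul_split {m n : ℕ} {α w : EpsAlg k A} (hα : IsCocycle m α) (hw : IsHom n w)
    {c : k} (hc : c = (-1) ^ (m + 1)) :
    tr e e' (swapMul ((-1) ^ (n + m)) α (split w)) =
      tr e e' (swapMul ((-1) ^ n) 1 (split w)) * α +
        (-1 : k) ^ (m * (n + 1)) • (c • tr e e' (ins c α w) +
          c • tr e e' (swapMul ((-1) ^ (n + m)) 1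
            ((ins c α).rTensor (EpsAlg k A) (split (d k A w)))) +
          d k A (tr e e' (swapMul ((-1) ^ (n + m + 1)) 1
            ((ins c α).rTensor (EpsAlg k A) (split w))))) := by
  have hone : IsCocycle (k := k) (A := A) 0 1 :=
    ⟨by simpa using IsHom.incl (k := k) (1 : A), one_mem _, d_one⟩
  have h1 := d_swapMul hone (scale_ins_split hα.isHom hw c)
  rw [zero_add] at h1
  -- Of the universal derivation 1 ⊗ w - w ⊗ 1 only the second term survives, because `ins` kills 1;
  -- it contributes the insertion of α into w.
  have h2 := split_d (tr e e' ∘ₗ swapMul ((-1) ^ (n + m)) 1 ∘ₗ (ins c α).rTensor (EpsAlg k A))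
    (fun x y a => by
      simp only [LinearMap.comp_apply, LinearMap.rTensor_tmul, ins_mul_incl, swapMul_tmul, map_mul,
        scale_incl, mul_one]
      rw [← mul_assoc, H.tr_comm, mul_assoc]) w
  simp only [LinearMap.comp_apply, map_add, map_sub, LinearMap.rTensor_tmul, ins_one,
    TensorProduct.zero_tmul, map_zero, zero_sub, swapMul_tmul, one_mul,
    (hα.isHom.ins hw).scale] at h2
  -- The commutator part of `dTensor_ins`. Multiplying the first half by α on the left puts α
  -- between the exchanged halves; multiplying it on the right puts α at the end, where it leaves
  -- the trace as an element commuting with A.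
  have h3 : tr e e' (swapMul ((-1) ^ (n + m)) 1
      ((LinearMap.mulLeft k α - LinearMap.mulRight k α ∘ₗ (scale (-c)).toLinearMap).rTensor _
        (split w))) = (-1 : k) ^ (m * (n + 1)) •
      (tr e e' (swapMul ((-1) ^ (n + m)) α (split w)) -
        tr e e' (swapMul ((-1) ^ n) 1 (split w)) * α) := by
    rw [← tr_mul_cent _ hα.cent, ← map_sub, ← map_smul]
    congr 1
    generalize split w = z
    have hs : ((-1 : k) ^ (n + m)) ^ m = (-1) ^ (m * (n + 1)) := by
      rw [← pow_mul]
      exact neg_one_pow_eq (by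
        rw [show (n + m) * m + m * (n + 1) = 2 * (m * n) + m * (m + 1) by ring]
        exact (even_two_mul _).add (Nat.even_mul_succ_self m))
    have hs' : (-1 : k) ^ (n + m) * -c = (-1) ^ n := by
      rw [hc, pow_succ, mul_neg_one, neg_neg, ← pow_add]
      exact neg_one_pow_eq ⟨n + m, by ring⟩
    induction z using TensorProduct.induction_on with
    | zero => simp
    | tmul x y =>
      simp [TensorProduct.sub_tmul, hα.isHom.scale, scale_scale, hs, hs', mul_assoc, smul_sub]
    | add a b ha hb => simp only [map_add, ha, hb, add_mul]; module
  rw [d_tr, h1, dTensor_ins hα hc, map_add, map_add, map_smul, map_smul, h3]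
  have h4 : ((-1 : k) ^ (n + m)) ^ (m + n + 1) = 1 := by
    rw [← pow_mul, add_comm m n]
    exact (Nat.even_mul_succ_self _).neg_one_pow
  have h5 : (-1 : k) ^ (m * (n + 1)) * (-1) ^ (m * (n + 1)) = 1 := by rw [← mul_pow]; simp
  rw [h4, one_smul] at h2
  have h6 : tr e e' (swapMul ((-1) ^ (n + m)) 1
      ((ins c α).rTensor (EpsAlg k A) (dTensor k A (split w)))) =
      -tr e e' (ins c α w) -
        tr e e' (swapMul ((-1) ^ (n + m)) 1
          ((ins c α).rTensor (EpsAlg k A) (split (d k A w)))) :=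
    eq_sub_of_add_eq h2
  rw [h6, smul_add, smul_add, smul_add,
    smul_smul ((-1 : k) ^ (m * (n + 1))) ((-1) ^ (m * (n + 1))), h5]
  module

/-- The operator `split` on a product, cut open. -/
theorem tr_swapMul_split_mul {m n : ℕ} {α : EpsAlg k A} (hα : IsHom m α) (v w : EpsAlg k A)
    (hv : split α = split (tr e e' v)) :
    tr e e' (swapMul ((-1) ^ (m + n)) 1 (split (α * w))) =
      tr e e' (swapMul ((-1) ^ (m + n)) (tr e e' w) (split v)) +
        (-1 : k) ^ (m * n) • tr e e' (swapMul ((-1) ^ (n + m)) α (split w)) := by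
  have hs : (-1 : k) ^ m * ((-1 : k) ^ (m + n)) ^ m = (-1) ^ (m * n) := by
    rw [← pow_mul, ← pow_add]
    exact neg_one_pow_eq (by
      rw [show m + (m + n) * m + m * n = 2 * (m * n) + m * (m + 1) by ring]
      exact (even_two_mul _).add (Nat.even_mul_succ_self m))
  have h1 : ∀ z : EpsAlg k A ⊗[k] EpsAlg k A, tr e e' (swapMul ((-1) ^ (m + n)) 1
      ((LinearMap.mulLeft k (scale (-1) α)).rTensor _ z)) =
      (-1 : k) ^ (m * n) • tr e e' (swapMul ((-1) ^ (n + m)) α z) := fun z => by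
    induction z using TensorProduct.induction_on with
    | zero => simp
    | tmul x y => simp [hα.scale, hs, smul_smul, mul_assoc, add_comm n m]
    | add a b ha hb => simp only [map_add, ha, hb, smul_add]
  -- For a cut inside v in e_λ v e^λ w, the exchange of the halves brings e^λ w e_λ together, and
  -- these sum to the trace of w.
  have h2 : ∀ z : EpsAlg k A ⊗[k] EpsAlg k A, ∑ l, tr e e' (swapMul ((-1) ^ (m + n)) 1
      ((LinearMap.mulRight k w).lTensor _ ((LinearMap.mulRight k (incl k (e' l))).lTensor _
        ((LinearMap.mulLeft k (incl k (e l))).rTensor _ z)))) =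
      tr e e' (swapMul ((-1) ^ (m + n)) (tr e e' w) z) := fun z => by
    induction z using TensorProduct.induction_on with
    | zero => simp
    | tmul x y =>
      simp [← map_sum, ← H.tr_swap, Finset.mul_sum, Finset.sum_mul, mul_assoc]
      exact Finset.sum_comm
    | add a b ha hb => simp only [map_add, Finset.sum_add_distrib, ha, hb]
  have h3 : split α = ∑ l, (LinearMap.mulRight k (incl k (e' l))).lTensor _
      ((LinearMap.mulLeft k (incl k (e l))).rTensor _ (split v)) := by
    rw [hv, tr_apply, map_sum]
    simp [split_mul]
  rw [split_mul, map_add, map_add, h1, ← h2, h3]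
  simp only [map_sum]

end IsDualBasis

end TraceHomotopy

end TateHochschild

namespace TateHochschild

/-! ### Chains as words in T -/

section Words

variable {k : Type*} [Field k] {A : Type*} [Ring A] [Algebra k A]

open EpsAlg

theorem chain_hom_ext {p : ℕ} {M : Type*} [AddCommMonoid M] [Module k M]
    {f g : Chain k A p →ₗ[k] M}
    (h : ∀ a : Fin (p + 1) → A, f (pureChain p a) = g (pureChain p a)) : f = g := by
  refine TensorProduct.ext' fun a₀ t => ?_
  have : f ∘ₗ TensorProduct.mk k A _ a₀ = g ∘ₗ TensorProduct.mk k A _ a₀ := by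
    refine PiTensorProduct.ext (MultilinearMap.ext fun v => ?_)
    have hv : v = fun i => bar k A (barLift k (v i)) := funext fun i => (bar_barLift _).symm
    rw [hv]
    simpa [pureChain_apply] using h (Fin.cons a₀ fun i => barLift k (v i))
  exact LinearMap.congr_fun this t

variable (k) in
/-- The product of the elements `a ε` for `a` in a list. -/
noncomputable def word (l : List A) : EpsAlg k A := (l.map fun a => incl k a * eps k A).prod

@[simp]
theorem word_nil : word k ([] : List A) = 1 := rfl

@[simp]
theorem word_cons (a : A) (l : List A) : word k (a :: l) = incl k a * eps k A * word k l := by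
  simp [word]

@[simp]
theorem word_append (l l' : List A) : word k (l ++ l') = word k l * word k l' := by
  simp [word]

theorem isHom_word (l : List A) : IsHom l.length (word k l) := by
  induction l with
  | nil => simpa using IsHom.incl (k := k) (1 : A)
  | cons a l ih =>
    rw [word_cons, List.length_cons, add_comm]
    exact (by simpa using (IsHom.incl (k := k) a).mul .eps : IsHom 1 _).mul ih

/-- A scalar between two letters ε produces ε² = 0. The leading ε provides the left neighbour of the
first entry. This lets words descend to normalized tensors. -/
theorem eps_mul_word_eq_zero (l : List A) (h : ∃ a ∈ l, bar k A a = 0) :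
    eps k A * word k l = 0 := by
  induction l with
  | nil => simp at h
  | cons a l ih =>
    rw [word_cons]
    rcases (List.exists_mem_cons_iff _ _ _).1 h with h | h
    · obtain ⟨c, rfl⟩ := (bar_eq_zero_iff k A _).1 h
      simp
    · rw [mul_assoc, ih h, mul_zero, mul_zero]

/-- The word `ε a_1 ε ⋯ ε a_p ε` of a tensor `ā_1 ⊗ ⋯ ⊗ ā_p`. -/
noncomputable def barWord (p : ℕ) : BarPow k A p →ₗ[k] EpsAlg k A :=
  PiTensorProduct.lift (descend
    ((LinearMap.mulLeft k (eps k A)).compMultilinearMap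
      ((MultilinearMap.mkPiAlgebraFin k p (EpsAlg k A)).compLinearMap
        fun _ => LinearMap.mulRight k (eps k A) ∘ₗ (incl k).toLinearMap))
    (fun a i h => by
      have := eps_mul_word_eq_zero (k := k) (List.ofFn a) ⟨a i, by simp, h⟩
      simpa [word, List.map_ofFn, Function.comp_def] using this))

theorem barWord_tprod {p : ℕ} (a : Fin p → A) :
    barWord p (PiTensorProduct.tprod k fun i => bar k A (a i)) =
      eps k A * word k (List.ofFn a) := by
  rw [barWord, PiTensorProduct.lift.tprod, descend_bar]
  simp [word, List.map_ofFn, Function.comp_def]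

/-- The word `a_0 ε a_1 ε ⋯ ε a_p ε` of a chain `a_0 ⊗ ā_1 ⊗ ⋯ ⊗ ā_p`. -/
noncomputable def chainWord (p : ℕ) : Chain k A p →ₗ[k] EpsAlg k A :=
  TensorProduct.lift ((LinearMap.mul k (EpsAlg k A)).compl₁₂ (incl k).toLinearMap (barWord p))

@[simp]
theorem chainWord_tmul {p : ℕ} (a : A) (t : BarPow k A p) :
    chainWord p (a ⊗ₜ[k] t) = incl k a * barWord p t := by simp [chainWord]

theorem chainWord_pureChain {p : ℕ} (a : Fin (p + 1) → A) :
    chainWord p (pureChain p a) = word k (List.ofFn a) := by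
  rw [pureChain_apply, chainWord_tmul, barWord_tprod, List.ofFn_succ, word_cons, mul_assoc]

theorem isHom_chainWord {p : ℕ} (x : Chain k A p) : IsHom (p + 1) (chainWord p x) := by
  induction x using TensorProduct.induction_on with
  | zero => rw [map_zero]; exact .zero _
  | add x y hx hy => rw [map_add]; exact hx.add hy
  | tmul a t =>
    rw [chainWord_tmul]
    induction t using PiTensorProduct.induction_on with
    | smul_tprod r v =>
      have hv : v = fun i => bar k A (barLift k (v i)) := funext fun i => (bar_barLift _).symm
      rw [map_smul, mul_smul_comm, hv, barWord_tprod]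
      have := (IsHom.incl a).mul (IsHom.eps.mul
        (isHom_word (k := k) (List.ofFn fun i => barLift k (v i))))
      rw [List.length_ofFn, zero_add, add_comm] at this
      exact this.smul r
    | add x y hx hy => rw [map_add, mul_add]; exact hx.add hy

/-- Removing an inner ε merges its two neighbours. Removing the last one leaves a_n at the right
end; under the trace it moves to the front and becomes the cyclic face of b. -/
theorem d_word {n : ℕ} (a : Fin (n + 1) → A) :
    d k A (word k (List.ofFn a)) =
      ∑ j : Fin n, (-1 : k) ^ (j : ℕ) • word k (List.ofFn
        (Fin.contractNth j.castSucc (· * ·) a)) +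
      (-1 : k) ^ n • (word k (List.ofFn fun i : Fin n => a i.castSucc) *
        incl k (a (Fin.last n))) := by
  induction n with
  | zero => simp [d_mul]
  | succ n ih =>
    have h1 : d k A (word k (List.ofFn a)) = incl k (a 0) *
        (word k (List.ofFn fun i => a i.succ) -
          eps k A * d k A (word k (List.ofFn fun i => a i.succ))) := by
      rw [List.ofFn_succ, word_cons, mul_assoc, d_incl_mul, d_mul]
      simp [sub_eq_add_neg]
    have h2 : Fin.contractNth (0 : Fin (n + 1)).castSucc (· * ·) a =
        Fin.cons (a 0 * a 1) (fun i => a i.succ.succ) := by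
      funext i
      refine Fin.cases ?_ (fun i => ?_) i
      · simp [Fin.contractNth]
      · rw [Fin.contractNth_apply_of_gt _ _ _ _ (by simp), Fin.cons_succ]
    have h3 : ∀ j : Fin n, Fin.contractNth j.succ.castSucc (· * ·) a =
        Fin.cons (a 0) (Fin.contractNth j.castSucc (· * ·) (fun i => a i.succ)) := fun j => by
      funext i
      refine Fin.cases ?_ (fun i => ?_) i
      · simp [Fin.contractNth]
      · simp [Fin.contractNth]
    rw [h1, ih, Fin.sum_univ_succ, h2]
    simp only [h3, List.ofFn_succ (n := n), Fin.cons_zero, Fin.cons_succ, word_cons, mul_add,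
      mul_sub, Finset.mul_sum, mul_smul_comm]
    simp [pow_succ, mul_assoc, sub_eq_add_neg, Finset.sum_neg_distrib, add_assoc]
    exact add_comm _ _

/-! ### Reading chains off words through a representation of T -/

section ChainRep

variable (k A) in
/-- The left action of `A` on the chains. -/
noncomputable def chainLeft : A →ₐ[k] Module.End k (DirectSum ℕ fun p => Chain k A p) :=
  AlgHom.ofLinearMap
    { toFun := fun a => DirectSum.lmap fun _ => (LinearMap.mulLeft k a).rTensor _
      map_add' := fun a b => by
        refine DirectSum.linearMap_ext k fun p => TensorProduct.ext' fun x y => ?_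
        simp [add_mul, TensorProduct.add_tmul]
      map_smul' := fun c a => by
        refine DirectSum.linearMap_ext k fun p => TensorProduct.ext' fun x y => ?_
        simp [← TensorProduct.smul_tmul'] }
    (by
      refine DirectSum.linearMap_ext k fun p => TensorProduct.ext' fun x y => ?_
      simp)
    (fun a b => by
      refine DirectSum.linearMap_ext k fun p => TensorProduct.ext' fun x y => ?_
      simp [mul_assoc])

theorem chainLeft_lof (a : A) {p : ℕ} (x : Chain k A p) :
    chainLeft k A a (DirectSum.lof k ℕ _ p x) =
      DirectSum.lof k ℕ (fun p => Chain k A p) p ((LinearMap.mulLeft k a).rTensor _ x) := by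
  simp [chainLeft]

variable (k A) in
/-- The map `a_0 ⊗ ā_1 ⊗ ⋯ ⊗ ā_p ↦ 1 ⊗ ā_0 ⊗ ⋯ ⊗ ā_p`. -/
noncomputable def chainShift : Module.End k (DirectSum ℕ fun p => Chain k A p) :=
  DirectSum.toModule k ℕ _ fun p => DirectSum.lof k ℕ (fun p => Chain k A p) (p + 1) ∘ₗ
    TensorProduct.mk k A (BarPow k A (p + 1)) 1 ∘ₗ TensorProduct.lift (insertOne rfl 0)

theorem chainShift_lof {p : ℕ} (x : Chain k A p) :
    chainShift k A (DirectSum.lof k ℕ _ p x) = DirectSum.lof k ℕ (fun p => Chain k A p) (p + 1)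
      (1 ⊗ₜ[k] TensorProduct.lift (insertOne rfl 0) x) := by
  simp [chainShift]

theorem chainShift_one {p : ℕ} (t : BarPow k A p) :
    chainShift k A (DirectSum.lof k ℕ (fun p => Chain k A p) p (1 ⊗ₜ[k] t)) = 0 := by
  rw [chainShift_lof, TensorProduct.lift.tmul]
  have : insertOne (k := k) (A := A) (rfl : p + 1 = p + 1) 0 1 = 0 := by
    rw [insertOne, LinearMap.comp_apply, LinearMap.comp_apply, bar_one, map_zero, map_zero]
  rw [this]
  simp

theorem chainShift_chainShift (x : DirectSum ℕ fun p => Chain k A p) :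
    chainShift k A (chainShift k A x) = 0 := by
  have : chainShift k A ∘ₗ chainShift k A = 0 := DirectSum.linearMap_ext k fun p =>
    LinearMap.ext fun x => by
      rw [LinearMap.comp_apply, LinearMap.comp_apply, chainShift_lof, chainShift_one]
      simp
  exact LinearMap.congr_fun this x

variable (k A) in
/-- The chain `1` of degree `0`. -/
noncomputable def chainUnit : DirectSum ℕ fun p => Chain k A p :=
  DirectSum.lof k ℕ (fun p => Chain k A p) 0 (1 ⊗ₜ[k] PiTensorProduct.tprod k isEmptyElim)

variable (f : A →ₗ[k] k)

/-- The representation of `T` on `A × ⨁ C_p(A, A)` with `ε b = f b • 1` for `b` in `A` and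
`ε (a_0 ⊗ ā_1 ⊗ ⋯ ⊗ ā_p) = 1 ⊗ ā_0 ⊗ ⋯ ⊗ ā_p`. -/
noncomputable def chainRep :
    EpsAlg k A →ₐ[k] Module.End k (A × DirectSum ℕ fun p => Chain k A p) :=
  EpsAlg.lift (B := Module.End k (A × DirectSum ℕ fun p => Chain k A p))
    ((LinearMap.prodMapAlgHom k A _).comp ((Algebra.lmul k A).prod (chainLeft k A)))
    (LinearMap.inr k A _ ∘ₗ ((f.smulRight (chainUnit k A)).coprod (chainShift k A))) (by
      refine LinearMap.ext fun ⟨b, c⟩ => ?_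
      simp [chainShift_chainShift, chainUnit, chainShift_one])

theorem chainRep_incl (a b : A) (c : DirectSum ℕ fun p => Chain k A p) :
    chainRep f (incl k a) (b, c) = (a * b, chainLeft k A a c) := by
  simp [chainRep]

theorem chainRep_eps (b : A) (c : DirectSum ℕ fun p => Chain k A p) :
    chainRep f (eps k A) (b, c) = (0, f b • chainUnit k A + chainShift k A c) := by
  simp [chainRep]

theorem chainRep_fst (x : EpsAlg k A) (z : A × DirectSum ℕ fun p => Chain k A p) :
    (chainRep f x z).1 = projZero k A x * z.1 := by
  induction x using EpsAlg.induction generalizing z with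
  | incl a => obtain ⟨b, c⟩ := z; simp [chainRep_incl]
  | eps => obtain ⟨b, c⟩ := z; simp [chainRep_eps]
  | smul c x hx => simp [hx]
  | mul x y hx hy => simp [hx, hy, mul_assoc]
  | add x y hx hy => simp [hx, hy, add_mul]

/-- The map `T → ⨁ C_p(A, A)` that takes `x_0 ε x_1 ε ⋯ ε x_{p+1}` to
`f x_{p+1} • x_0 ⊗ x̄_1 ⊗ ⋯ ⊗ x̄_p`. -/
noncomputable def toChains : EpsAlg k A →ₗ[k] DirectSum ℕ fun p => Chain k A p :=
  LinearMap.snd k _ _ ∘ₗ (chainRep f).toLinearMap.flip (1, 0)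

theorem toChains_apply (x : EpsAlg k A) : toChains f x = (chainRep f x (1, 0)).2 := rfl

theorem toChains_incl_mul (a : A) (x : EpsAlg k A) :
    toChains f (incl k a * x) = chainLeft k A a (toChains f x) := by
  rw [toChains_apply, map_mul, Module.End.mul_apply, ← Prod.mk.eta (p := chainRep f x (1, 0)),
    chainRep_incl, toChains_apply]

theorem toChains_eps_mul (x : EpsAlg k A) :
    toChains f (eps k A * x) =
      f (projZero k A x) • chainUnit k A + chainShift k A (toChains f x) := by
  rw [toChains_apply, map_mul, Module.End.mul_apply, ← Prod.mk.eta (p := chainRep f x (1, 0)),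
    chainRep_eps, toChains_apply, chainRep_fst, mul_one]

theorem toChains_incl (a : A) : toChains f (incl k a) = 0 := by
  rw [toChains_apply, chainRep_incl, map_zero]

theorem toChains_word_mul_incl {p : ℕ} (a : Fin (p + 1) → A) (b : A) :
    toChains f (word k (List.ofFn a) * incl k b) =
      f b • DirectSum.lof k ℕ (fun p => Chain k A p) p (pureChain p a) := by
  induction p with
  | zero =>
    have : (fun i : Fin 0 => bar k A (a i.succ)) = isEmptyElim := Subsingleton.elim _ _
    simp [mul_assoc, toChains_incl_mul, toChains_eps_mul, toChains_incl, chainUnit, chainLeft_lof,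
      pureChain_apply, this]
  | succ p ih =>
    rw [List.ofFn_succ, word_cons, mul_assoc, mul_assoc, toChains_incl_mul, toChains_eps_mul,
      ih]
    rw [((isHom_word _).mul (IsHom.incl b)).projZero_eq_zero (by simp)]
    rw [map_zero, zero_smul, zero_add, map_smul, map_smul, chainShift_lof, chainLeft_lof,
      pureChain_apply, TensorProduct.lift.tmul, insertOne_tprod, pureChain_apply,
      LinearMap.rTensor_tmul, LinearMap.mulLeft_apply, mul_one]
    congr 4
    funext i
    refine Fin.cases ?_ (fun i => ?_) i <;> simp

theorem toChains_chainWord_mul_incl {p : ℕ} (x : Chain k A p) (b : A) :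
    toChains f (chainWord p x * incl k b) =
      f b • DirectSum.lof k ℕ (fun p => Chain k A p) p x := by
  have : toChains f ∘ₗ LinearMap.mulRight k (incl k b) ∘ₗ chainWord p =
      f b • DirectSum.lof k ℕ (fun p => Chain k A p) p := chain_hom_ext fun a => by
    rw [LinearMap.comp_apply, LinearMap.comp_apply, chainWord_pureChain,
      LinearMap.mulRight_apply, toChains_word_mul_incl, LinearMap.smul_apply]
  exact LinearMap.congr_fun this x

variable (k A) in
/-- The sum of the maps `chainWord`. -/
noncomputable def chainsWord : (DirectSum ℕ fun p => Chain k A p) →ₗ[k] EpsAlg k A :=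
  DirectSum.toModule k ℕ _ chainWord

@[simp]
theorem chainsWord_lof {p : ℕ} (x : Chain k A p) :
    chainsWord k A (DirectSum.lof k ℕ _ p x) = chainWord p x := by simp [chainsWord]

theorem chainsWord_chainLeft (a : A) (x : DirectSum ℕ fun p => Chain k A p) :
    chainsWord k A (chainLeft k A a x) = incl k a * chainsWord k A x := by
  have : chainsWord k A ∘ₗ chainLeft k A a = LinearMap.mulLeft k (incl k a) ∘ₗ chainsWord k A :=
    DirectSum.linearMap_ext k fun p => TensorProduct.ext' fun x y => by
      simp [chainLeft_lof, mul_assoc]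
  exact LinearMap.congr_fun this x

theorem chainsWord_chainShift (x : DirectSum ℕ fun p => Chain k A p) :
    chainsWord k A (chainShift k A x) = eps k A * chainsWord k A x := by
  have : chainsWord k A ∘ₗ chainShift k A = LinearMap.mulLeft k (eps k A) ∘ₗ chainsWord k A :=
    DirectSum.linearMap_ext k fun p => chain_hom_ext fun a => by
      simp only [LinearMap.comp_apply, chainShift_lof, chainsWord_lof, chainWord_pureChain,
        LinearMap.mulLeft_apply, chainWord_tmul, map_one, one_mul]
      rw [pureChain_apply, TensorProduct.lift.tmul, insertOne_tprod, ← barWord_tprod]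
      congr 2
      funext i
      refine Fin.cases ?_ (fun i => ?_) i <;> simp
  exact LinearMap.congr_fun this x

theorem chainsWord_chainUnit : chainsWord k A (chainUnit k A) = eps k A := by
  have : (isEmptyElim : Fin 0 → Bar k A) = fun i => bar k A (isEmptyElim i) :=
    Subsingleton.elim _ _
  rw [chainUnit, chainsWord_lof, chainWord_tmul, this, barWord_tprod]
  simp

/-- The map `x_0 ε x_1 ε ⋯ x_p ε x_{p+1} ↦ f x_{p+1} • x_0 ε x_1 ε ⋯ x_p ε`. -/
noncomputable def cutLast : EpsAlg k A →ₗ[k] EpsAlg k A := chainsWord k A ∘ₗ toChains f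

theorem cutLast_incl_mul (a : A) (x : EpsAlg k A) :
    cutLast f (incl k a * x) = incl k a * cutLast f x := by
  simp [cutLast, toChains_incl_mul, chainsWord_chainLeft]

theorem cutLast_eps_mul (x : EpsAlg k A) :
    cutLast f (eps k A * x) = f (projZero k A x) • eps k A + eps k A * cutLast f x := by
  simp [cutLast, toChains_eps_mul, chainsWord_chainShift, chainsWord_chainUnit]

theorem cutLast_incl (a : A) : cutLast f (incl k a) = 0 := by simp [cutLast, toChains_incl]

/-- If y has positive degree, the last ε of x y lies in y and x is merely carried along. The degree
0 component of y only changes the last coefficient of x. -/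
theorem cutLast_mul (x y : EpsAlg k A) :
    cutLast f (x * y) = x * cutLast f y + cutLast f (x * incl k (projZero k A y)) := by
  induction x using EpsAlg.induction generalizing y with
  | incl a => rw [cutLast_incl_mul, ← map_mul, cutLast_incl, add_zero]
  | eps => simp [cutLast_eps_mul, cutLast_incl, add_comm]
  | smul c x hx => simp only [smul_mul_assoc, map_smul, hx y, smul_add]
  | mul u v hu hv =>
    rw [mul_assoc, hu, hv, mul_assoc u v (incl k _), hu (v * incl k _)]
    simp only [map_mul, projZero_incl, mul_add, mul_assoc, add_assoc]
  | add u v hu hv => simp only [add_mul, map_add, hu y, hv y]; abel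

theorem EpsAlg.IsHom.cutLast {n : ℕ} {x : EpsAlg k A} (hx : IsHom n x) :
    IsHom n (TateHochschild.cutLast f x) := by
  -- The trailing coefficient makes the induction close: by `cutLast_mul` a product involves its
  -- left factor through right multiples by A.
  suffices h : ∀ a, IsHom n (TateHochschild.cutLast f (x * EpsAlg.incl k a)) by
    simpa using h 1
  induction hx with
  | incl a => intro b; rw [← map_mul, cutLast_incl]; exact .zero _
  | eps => intro b; simpa [cutLast_eps_mul, cutLast_incl] using IsHom.eps.smul _
  | zero n => intro b; simpa using IsHom.zero _
  | smul c hx ih => intro b; rw [smul_mul_assoc, map_smul]; exact (ih b).smul c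
  | add hx hy h1 h2 => intro b; rw [add_mul, map_add]; exact (h1 b).add (h2 b)
  | @mul m n x y hx hy h1 h2 =>
    intro b
    rw [mul_assoc, cutLast_mul]
    refine (hx.mul (h2 b)).add ?_
    by_cases hn : n = 0
    · subst hn; exact h1 _
    · rw [map_mul (projZero k A), hy.projZero_eq_zero hn]
      simpa using IsHom.zero _

end ChainRep

end Words

end TateHochschild

namespace TateHochschild

/-! ### Comparison of the complex with the centralizer of A in T -/

section Comparison

variable {k : Type*} [Field k] {A : Type*} [Ring A] [Algebra k A]
  {ι : Type*} [Fintype ι] {e e' : ι → A} {φ : SymmetrizingForm k A}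

open EpsAlg

namespace IsDualBasis

variable (H : IsDualBasis φ e e')

include H

/-- With f = ⟨-, 1⟩, the expansion ∑ ⟨x e_λ, 1⟩ e^λ = x restores the coefficient that was cut off.
The degree 0 part contains no ε and is lost. -/
theorem sum_cutLast (w : EpsAlg k A) :
    ∑ l, cutLast (φ.form.flip 1) (w * incl k (e l)) * incl k (e' l) =
      w - incl k (projZero k A w) := by
  induction w using EpsAlg.induction with
  | incl a => simp [cutLast_incl_mul, cutLast_incl]
  | eps =>
    have h := H.sum_left 1
    have h' : ∑ l, (φ.form (e l) 1) • e' l = 1 := by simpa [φ.symm 1] using H.sum_right 1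
    simp [cutLast_eps_mul, cutLast_incl, ← mul_smul_comm, ← map_smul, ← Finset.mul_sum, ← map_sum,
      h']
  | smul c x hx =>
    simp only [smul_mul_assoc, map_smul, ← Finset.smul_sum, hx, smul_sub]
  | add x y hx hy =>
    simp only [add_mul, map_add, Finset.sum_add_distrib, hx, hy]
    abel
  | mul x y hx hy =>
    have h := H.sum_mul_left (LinearMap.mk₂ k (fun a b =>
      cutLast (φ.form.flip 1) (x * incl k a) * incl k b)
      (by intros; simp [mul_add, add_mul]) (by intros; simp) (by intros; simp [mul_add])
      (by intros; simp)) (projZero k A y)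
    simp only [LinearMap.mk₂_apply, map_mul (incl k)] at h
    have h2 : ∀ l, cutLast (φ.form.flip 1) (x * y * incl k (e l)) =
        cutLast (φ.form.flip 1) (x * incl k (projZero k A y * e l)) +
          x * cutLast (φ.form.flip 1) (y * incl k (e l)) := fun l => by
      rw [mul_assoc, cutLast_mul, map_mul (projZero k A), projZero_incl, add_comm]
    simp only [h2, add_mul, Finset.sum_add_distrib, map_mul (incl k), h]
    simp only [mul_assoc, ← Finset.mul_sum, hy]
    simp only [← mul_assoc, ← Finset.sum_mul, hx]
    simp only [mul_sub, sub_mul, map_mul (projZero k A), map_mul (incl k)]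
    abel

/-- When z commutes with A, the e_λ in `sum_cutLast` moves to the left and the sum becomes a trace.
So the trace reaches every element of positive degree in the centralizer. -/
theorem eq_incl_add_tr {z : EpsAlg k A} (hz : z ∈ cent k A) :
    z = incl k (projZero k A z) + tr e e' (cutLast (φ.form.flip 1) z) := by
  have h := H.sum_cutLast z
  simp only [← mem_cent.1 hz, cutLast_incl_mul] at h
  rw [tr_apply, h]
  abel

/-- On T, `cutLast` inverts the trace only modulo A and commutators with A. That suffices for maps
that kill these, such as the trace of `rotations`. -/
theorem map_cutLast_tr {Y : Type*} [AddCommGroup Y] [Module k Y] (F : EpsAlg k A →ₗ[k] Y)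
    (h1 : ∀ a w, F (w * incl k a) = F (incl k a * w)) (h2 : ∀ a, F (incl k a) = 0)
    (w : EpsAlg k A) : F (cutLast (φ.form.flip 1) (tr e e' w)) = F w := by
  have h := congrArg F (H.sum_cutLast w)
  rw [map_sub, h2, sub_zero] at h
  rw [← h, ← H.tr_swap]
  simp only [map_sum, mul_assoc, cutLast_incl_mul, h1]

/-- The same restoration of coefficients on chains gives an honest left inverse of the trace, hence
injectivity of `embed`. -/
theorem toChains_tr {p : ℕ} (x : Chain k A p) :
    toChains (φ.form.flip 1) (tr e e' (chainWord p x)) =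
      DirectSum.lof k ℕ (fun p => Chain k A p) p x := by
  simp only [tr_apply, map_sum, mul_assoc, toChains_incl_mul, toChains_chainWord_mul_incl,
    map_smul, chainLeft_lof]
  simp only [← map_smul, ← map_sum]
  congr 1
  have h : ∑ l, (φ.form.flip 1 (e' l)) • LinearMap.mulLeft k (e l) =
      (LinearMap.id : A →ₗ[k] A) := by
    ext a
    have h := congrArg (· * a) (H.sum_left 1)
    simpa [Finset.sum_mul, φ.symm _ 1] using h
  have h' := congrArg (fun g : A →ₗ[k] A => g.rTensor (BarPow k A p) x) h
  simpa [← LinearMap.coe_rTensorHom, map_sum, -LinearMap.flip_apply] using h'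

end IsDualBasis

/-- The embedding of the non-positive part of `𝒟^*(A, A)` into `T`. On chains it is the isomorphism
onto the elements of positive degree that commute with `A`. -/
noncomputable def embed (e e' : ι → A) : (n : ℕ) → D k A n →ₗ[k] EpsAlg k A
  | 0 => (incl k).toLinearMap ∘ₗ (cochainZeroEquiv (k := k) (A := A)).toLinearMap
  | p + 1 => tr e e' ∘ₗ chainWord (k := k) (A := A) p

theorem embed_zero (x : Cochain k A 0) :
    embed e e' 0 (show D k A 0 from x) = incl k (cochainZeroEquiv x) := rfl

theorem isHom_embed {n : ℕ} (x : D k A n) : IsHom n (embed e e' n x) := by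
  cases n with
  | zero => exact .incl _
  | succ p => exact (isHom_chainWord (k := k) (A := A) x).tr

theorem chainWord_hochschildB (H : IsDualBasis φ e e') {p : ℕ} (x : Chain k A (p + 1)) :
    tr e e' (d k A (chainWord (p + 1) x)) = tr e e' (chainWord p (hochschildB p x)) := by
  have : tr e e' ∘ₗ d k A ∘ₗ chainWord (p + 1) =
      tr e e' ∘ₗ chainWord p ∘ₗ hochschildB (k := k) (A := A) p := chain_hom_ext fun a => by
    simp only [LinearMap.comp_apply, chainWord_pureChain, d_word, hochschildB_pureChain, map_add,
      map_sum, map_smul]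
    congr 2
    rw [H.tr_comm, List.ofFn_succ, List.ofFn_succ]
    simp [mul_assoc]
  exact LinearMap.congr_fun this x

/-- In the lowest degree, τ(x) = ∑ e_λ x e^λ is the differential of ∑ e_λ x ε e^λ. In higher degrees
`d_word` gives the faces of b, the cyclic one through `tr_comm`. -/
theorem embed_differential (H : IsDualBasis φ e e') {n : ℕ} (x : D k A (n + 1)) :
    embed e e' n (differential e e' n x) = d k A (embed e e' (n + 1) x) := by
  cases n with
  | zero =>
    have : (incl k).toLinearMap ∘ₗ cochainZeroEquiv.toLinearMap ∘ₗ traceMap (k := k) e e' =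
        d k A ∘ₗ tr e e' ∘ₗ chainWord (k := k) 0 :=
      chain_hom_ext fun a => by
        simp only [LinearMap.comp_apply, LinearEquiv.coe_coe, traceMap_pureChain,
          chainWord_pureChain, d_tr, d_word, AlgHom.toLinearMap_apply]
        simp [tr_apply]
    exact LinearMap.congr_fun this x
  | succ p => exact ((d_tr _).trans (chainWord_hochschildB H x)).symm

theorem embed_injective (H : IsDualBasis φ e e') (n : ℕ) :
    Function.Injective (embed (k := k) e e' n) := by
  cases n with
  | zero =>
    intro x y h
    have := congrArg (projZero k A) h
    change projZero k A (incl k (cochainZeroEquiv (k := k) (A := A) x)) =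
      projZero k A (incl k (cochainZeroEquiv (k := k) (A := A) y)) at this
    rw [projZero_incl, projZero_incl] at this
    exact cochainZeroEquiv.injective this
  | succ p =>
    intro x y h
    have := congrArg (toChains (φ.form.flip 1)) h
    exact DirectSum.of_injective (β := fun p => Chain k A p) p
      ((H.toChains_tr x).symm.trans (this.trans (H.toChains_tr y)))

theorem hochschildDeltaZero_eq_zero_iff (x : Cochain k A 0) :
    hochschildDeltaZero x = 0 ↔ ∀ a, cochainZeroEquiv x * a = a * cochainZeroEquiv x := by
  refine ⟨fun h a => ?_, fun h => ?_⟩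
  · rw [← sub_eq_zero, ← hochschildDeltaZero_apply, h]
    rfl
  · refine PiTensorProduct.ext (MultilinearMap.ext fun v => ?_)
    have hv : v = fun _ => bar k A (barLift k (v 0)) := by
      funext i
      rw [bar_barLift, Subsingleton.elim i 0]
    rw [hv]
    refine (hochschildDeltaZero_apply _ _).trans ?_
    rw [h, sub_self]
    rfl

theorem isCocycle_incl_iff (a : A) : IsCocycle 0 (incl k a) ↔ ∀ b, a * b = b * a := by
  refine ⟨fun h b => ?_, fun h => ⟨.incl _, mem_cent.2 fun b => ?_, d_incl _⟩⟩
  · have := congrArg (projZero k A) (mem_cent.1 h.cent b)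
    rw [← map_mul, ← map_mul, projZero_incl, projZero_incl] at this
    exact this.symm
  · rw [← map_mul, ← map_mul, h]

/-- The two conditions of a cocycle in T share the work: in degree 0 the differential vanishes
anyway and commuting with A is δ⁰ = 0; in positive degree traces commute with A anyway and only the
differential counts. -/
theorem mem_cocycles_iff (H : IsDualBasis φ e e') {n : ℕ} (x : D k A n) :
    x ∈ cocycles e e' n ↔ IsCocycle n (embed e e' n x) := by
  cases n with
  | zero =>
    exact (LinearMap.mem_ker.trans (hochschildDeltaZero_eq_zero_iff _)).trans
      (isCocycle_incl_iff _).symm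
  | succ p =>
    have h1 : x ∈ cocycles e e' (p + 1) ↔ differential e e' p x = 0 := LinearMap.mem_ker
    rw [h1, ← (embed_injective H p).eq_iff, embed_differential H, map_zero]
    exact ⟨fun h => ⟨isHom_embed x, H.tr_mem_cent _, h⟩, fun h => h.d⟩

theorem exists_embed_eq (H : IsDualBasis φ e e') {n : ℕ} {z : EpsAlg k A} (hz : IsHom n z)
    (hc : n ≠ 0 → z ∈ cent k A) : ∃ x, embed e e' n x = z := by
  cases n with
  | zero =>
    refine ⟨(cochainZeroEquiv (k := k) (A := A)).symm (projZero k A z), ?_⟩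
    rw [embed_zero]
    simpa using isHom_zero_iff.1 hz
  | succ p =>
    refine ⟨(toChains (φ.form.flip 1) z) p, ?_⟩
    -- Nothing says that `toChains` of z is concentrated in degree p, so its expansion is compared
    -- in degree p + 1 of T.
    have h1 := congrArg (proj k A (p + 1)) (H.eq_incl_add_tr (hc (by simp)))
    rw [hz.projZero_eq_zero (by simp), map_zero, zero_add, hz.proj, if_pos rfl] at h1
    have h2 : proj k A (p + 1) ∘ₗ tr e e' ∘ₗ chainsWord k A =
        tr e e' ∘ₗ chainWord p ∘ₗ DirectSum.component k ℕ (fun p => Chain k A p) p :=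
      DirectSum.linearMap_ext k fun q => LinearMap.ext fun x => by
        simp only [LinearMap.comp_apply, chainsWord_lof, (isHom_chainWord x).tr.proj]
        split_ifs with h
        · obtain rfl : q = p := by omega
          rw [DirectSum.component.lof_self]
        · rw [DirectSum.component.of, dif_neg (by omega), map_zero, map_zero]
    exact (LinearMap.congr_fun h2 _).symm.trans h1.symm

end Comparison

end TateHochschild

namespace TateHochschild

/-! ### The bracket and the star product in T -/

section Operations

variable {k : Type*} [Field k] {A : Type*} [Ring A] [Algebra k A]
  {ι : Type*} [Fintype ι] {e e' : ι → A} {φ : SymmetrizingForm k A}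

open EpsAlg

theorem chain_hom_ext₂ {p q : ℕ} {M : Type*} [AddCommMonoid M] [Module k M]
    {f g : Chain k A p →ₗ[k] Chain k A q →ₗ[k] M}
    (h : ∀ a b, f (pureChain p a) (pureChain q b) = g (pureChain p a) (pureChain q b)) : f = g :=
  chain_hom_ext fun a => chain_hom_ext fun b => h a b

theorem barWord_insertBlock {p r N : ℕ} (h : p + r = N) (i : Fin (p + 1)) (a : Fin p → A)
    (w : Fin r → A) :
    barWord N (insertBlock h i (PiTensorProduct.tprod k fun j => bar k A (a j))
      (PiTensorProduct.tprod k fun j => bar k A (w j))) =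
      eps k A * word k ((List.ofFn a).take i) * word k (List.ofFn w) *
        word k ((List.ofFn a).drop i) := by
  subst h
  rw [insertBlock_tprod, mul_assoc, mul_assoc, ← word_append, ← word_append]
  have h1 : (fun j : Fin (p + r) =>
        if h1 : (j : ℕ) < i then bar k A (a ⟨j, by omega⟩)
        else if h2 : (j : ℕ) < i + r then bar k A (w ⟨j - i, by omega⟩)
        else bar k A (a ⟨j - r, by omega⟩)) = fun j : Fin (p + r) => bar k A (
        if h1 : (j : ℕ) < i then a ⟨j, by omega⟩
        else if h2 : (j : ℕ) < i + r then w ⟨j - i, by omega⟩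
        else a ⟨j - r, by omega⟩) := by
    funext j
    split_ifs <;> rfl
  rw [h1, barWord_tprod]
  congr 2
  refine List.ext_getElem ?_ fun j h1 h2 => ?_
  · simp; omega
  · have := i.2
    simp only [List.length_ofFn] at h1
    simp only [List.getElem_ofFn, List.getElem_append, List.length_take, List.length_ofFn,
      List.getElem_take, List.getElem_drop]
    simp only [min_eq_left (show (i : ℕ) ≤ p by omega)]
    split_ifs <;> first | rfl | omega | (congr 1; ext; simp; omega)

theorem barWord_insertOne {p N : ℕ} (h : p + 1 = N) (i : Fin (p + 1)) (a : Fin p → A) (x : A) :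
    barWord N (insertOne h i x (PiTensorProduct.tprod k fun j => bar k A (a j))) =
      eps k A * word k ((List.ofFn a).take i) * (incl k x * eps k A) *
        word k ((List.ofFn a).drop i) := by
  have := barWord_insertBlock (k := k) h i a (fun _ => x)
  simp only [List.ofFn_succ, List.ofFn_zero, word_cons, word_nil, mul_one] at this
  rw [← this]
  simp [insertOne, PiTensorProduct.subsingletonEquiv_symm_apply']

/-- Each ε is replaced in turn by ε α ε, with a factor c for every ε to its left. -/
theorem ins_word (c : k) (α : EpsAlg k A) (a : A) (l : List A) :
    ins c α (word k (a :: l)) = ∑ i ∈ Finset.range (l.length + 1), c ^ i •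
      (incl k a * (eps k A * word k (l.take i) * (α * eps k A) * word k (l.drop i))) := by
  induction l generalizing a with
  | nil => simp [ins_incl_mul, mul_assoc]
  | cons b l ih =>
    rw [word_cons, mul_assoc, ins_incl_mul, ins_mul, ih, List.length_cons,
      Finset.sum_range_succ' _ (l.length + 1)]
    simp only [ins_eps, scale_eps, List.take_succ_cons, List.drop_succ_cons, word_cons, pow_succ',
      List.take_zero, List.drop_zero, pow_zero, one_smul, word_nil, mul_one, mul_add,
      Finset.mul_sum, mul_smul_comm, smul_mul_assoc, mul_smul]
    rw [add_comm]
    simp only [mul_assoc, smul_comm c]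

theorem ins_chainWord (c : k) (α : EpsAlg k A) {p : ℕ} (a : Fin (p + 1) → A) :
    ins c α (chainWord p (pureChain p a)) = ∑ i : Fin (p + 1), c ^ (i : ℕ) •
      (incl k (a 0) * (eps k A * word k ((List.ofFn fun j : Fin p => a j.succ).take i) *
        (α * eps k A) * word k ((List.ofFn fun j : Fin p => a j.succ).drop i))) := by
  rw [chainWord_pureChain, List.ofFn_succ, ins_word, List.length_ofFn, Finset.sum_range]

/-- The block e_λ b_0, b_1, …, b_q, e^λ placed between letters ε is the trace of the word of β, so
one ε of α is replaced by ε tr(β) ε. The factor outside appears because the exponents q i start at i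
= 1. -/
theorem chainWord_bullet {p q N : ℕ} (h : p + (q + 2) = N) (β : Chain k A q) (α : Chain k A p) :
    chainWord N (bullet e e' h β α) =
      (-1 : k) ^ q • ins ((-1) ^ q) (tr e e' (chainWord q β)) (chainWord p α) := by
  have : chainWord N ∘ₗ bullet e e' h β =
      (-1 : k) ^ q • ins ((-1) ^ q) (tr e e' (chainWord q β)) ∘ₗ chainWord p :=
    chain_hom_ext fun a => by
    simp only [LinearMap.comp_apply, LinearMap.smul_apply, ins_chainWord]
    have : chainWord N ∘ₗ (bullet e e' h).flip (pureChain p a) = (-1 : k) ^ q •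
        ∑ i : Fin (p + 1), ((-1 : k) ^ q) ^ (i : ℕ) • LinearMap.mulLeft k (incl k (a 0) *
          (eps k A * word k ((List.ofFn fun j : Fin p => a j.succ).take i))) ∘ₗ
        LinearMap.mulRight k (eps k A * word k ((List.ofFn fun j : Fin p => a j.succ).drop i)) ∘ₗ
        tr e e' ∘ₗ chainWord q := chain_hom_ext fun b => by
      simp only [LinearMap.comp_apply, LinearMap.flip_apply, LinearMap.smul_apply,
        LinearMap.sum_apply, LinearMap.mulLeft_apply, LinearMap.mulRight_apply]
      simp only [pureChain_apply, bullet_tmul, map_sum, map_smul, chainWord_tmul]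
      rw [Finset.sum_comm, Finset.smul_sum]
      refine Finset.sum_congr rfl fun i _ => ?_
      rw [← Finset.smul_sum, smul_smul, ← pow_mul, ← pow_add, mul_add, mul_one, add_comm]
      congr 1
      have h1 : ∀ l, (Fin.snoc (α := fun _ => Bar k A) (Fin.cons (α := fun _ => Bar k A)
          (bar k A (e l * b 0)) fun j : Fin q => bar k A (b j.succ)) (bar k A (e' l))) =
          fun j => bar k A (Fin.snoc (α := fun _ => A) (Fin.cons (α := fun _ => A)
            (e l * b 0) fun j : Fin q => b j.succ) (e' l) j) := fun l => by
        funext j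
        refine Fin.lastCases ?_ (fun j => ?_) j
        · simp
        · rw [Fin.snoc_castSucc, Fin.snoc_castSucc]
          refine Fin.cases ?_ (fun j => ?_) j <;> simp
      simp only [h1, barWord_insertBlock]
      have h2 : ∀ l, List.ofFn (Fin.snoc (α := fun _ => A) (Fin.cons (α := fun _ => A)
            (e l * b 0) fun j : Fin q => b j.succ) (e' l)) =
          e l * b 0 :: (List.ofFn fun j : Fin q => b j.succ) ++ [e' l] := fun l => by
        rw [List.ofFn_succ']
        simp
      simp only [h2, word_append, word_cons, word_nil, mul_one, tr_apply, barWord_tprod, map_mul,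
        Finset.mul_sum, Finset.sum_mul, mul_assoc]
    simpa [LinearMap.sum_apply, mul_assoc] using LinearMap.congr_fun this β
  exact LinearMap.congr_fun this α

theorem chainWord_sum_insertOne {p N : ℕ} (h : p + 1 = N) (x : A) (α : Chain k A p) :
    chainWord N (∑ i : Fin (p + 1), (-1 : k) ^ (i : ℕ) • (insertOne h i x).lTensor A α) =
      ins (-1) (incl k x) (chainWord p α) := by
  have : chainWord N ∘ₗ (∑ i : Fin (p + 1), (-1 : k) ^ (i : ℕ) • (insertOne h i x).lTensor A) =
      ins (-1) (incl k x) ∘ₗ chainWord p := chain_hom_ext fun a => by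
    simp only [LinearMap.comp_apply, ins_chainWord]
    simp [pureChain_apply, barWord_insertOne]
  simpa [LinearMap.sum_apply] using LinearMap.congr_fun this α

theorem chainWord_bracketCochainChain {q N : ℕ} (h : q + 1 = N) (f : Cochain k A 0)
    (β : Chain k A q) : chainWord N (bracketCochainChain h f β) =
      -ins (-1) (incl k (cochainZeroEquiv f)) (chainWord q β) := by
  rw [← chainWord_sum_insertOne h]
  simp [bracketCochainChain, pow_succ, LinearMap.sum_apply]

theorem chainWord_bracketChainCochain {p : ℕ} (α : Chain k A p) (f : Cochain k A 0) :
    chainWord (p + 1) (bracketChainCochain α f) =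
      (-1 : k) ^ p • ins (-1) (incl k (cochainZeroEquiv f)) (chainWord p α) := by
  rw [← chainWord_sum_insertOne rfl, ← map_smul, Finset.smul_sum]
  simp [bracketChainCochain, pow_add, smul_smul]

theorem chainWord_bracketChainChain {p q N : ℕ} (h : p + q + 2 = N) (α : Chain k A p)
    (β : Chain k A q) : chainWord N (bracketChainChain e e' h α β) =
      (-1 : k) ^ p • ins ((-1) ^ p) (tr e e' (chainWord p α)) (chainWord q β) -
        (-1 : k) ^ (p * q) • (-1 : k) ^ q •
          ins ((-1) ^ q) (tr e e' (chainWord q β)) (chainWord p α) := by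
  rw [bracketChainChain_apply, map_sub, map_smul, chainWord_bullet, chainWord_bullet]

theorem embed_lieBracket (m n : ℕ) (x : D k A m) (y : D k A n) :
    embed e e' (m + n + 1) (lieBracket e e' m n x y) =
      bracket m n (embed e e' m x) (embed e e' n y) := by
  cases m with
  | zero =>
    cases n with
    | zero =>
      refine (map_zero (embed e e' 1)).trans ?_
      change _ = bracket 0 0 (incl k _) (incl k _)
      simp [bracket]
    | succ q =>
      refine (congrArg (tr e e') (chainWord_bracketCochainChain _ _ _)).trans ?_
      change _ = bracket 0 (q + 1) (incl k _) (tr e e' (chainWord q y))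
      simp [bracket, ins_tr]
      rfl
  | succ p =>
    cases n with
    | zero =>
      refine (congrArg (tr e e') (chainWord_bracketChainCochain _ _)).trans ?_
      change _ = bracket (p + 1) 0 (tr e e' (chainWord p x)) (incl k _)
      simp [bracket, ins_tr, pow_succ]
      rfl
    | succ q =>
      refine (congrArg (tr e e') (chainWord_bracketChainChain (by omega) _ _)).trans ?_
      change _ = bracket (p + 1) (q + 1) (tr e e' (chainWord p x)) (tr e e' (chainWord q y))
      have h2 : (-1 : k) ^ ((p + 1) * (q + 1 + 1)) = (-1) ^ (p * q) * (-1) ^ q := by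
        rw [← pow_add]
        exact neg_one_pow_eq (by ring_nf; simp [Nat.even_add, Nat.even_mul])
      simp only [bracket, h2, map_sub, map_smul, ins_tr, smul_smul]
      simp [pow_succ]

theorem chainWord_starChainCochain {p : ℕ} (α : Chain k A p) (f : Cochain k A 0) :
    chainWord p (starChainCochain α f) = incl k (cochainZeroEquiv f) * chainWord p α := by
  have : chainWord p ∘ₗ starChainCochain.flip f =
      LinearMap.mulLeft k (incl k (cochainZeroEquiv f)) ∘ₗ chainWord p := chain_hom_ext fun a => by
    simp [pureChain_apply, starChainCochain_tmul, mul_assoc]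
  exact LinearMap.congr_fun this α

theorem chainWord_starCochainChain {p N : ℕ} (h : p + 0 = N) (f : Cochain k A 0)
    (hf : ∀ a, cochainZeroEquiv f * a = a * cochainZeroEquiv f) (α : Chain k A p) :
    chainWord N (starCochainChain h f α) = incl k (cochainZeroEquiv f) * chainWord p α := by
  subst h
  have : chainWord p ∘ₗ starCochainChain (p := p) rfl f =
      LinearMap.mulLeft k (incl k (cochainZeroEquiv f)) ∘ₗ chainWord p := chain_hom_ext fun a => by
    simp [pureChain_apply, starCochainChain_tmul, ← hf, mul_assoc]
  exact LinearMap.congr_fun this α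

/-- The word of α ⋆ β begins with b_0 (e_λ a_0 ε ⋯ a_p ε e^λ) ε b_1 ⋯, where the parenthesis is the
trace of α. It commutes with A, so it passes b_0 and leaves the outer trace. -/
theorem tr_chainWord_starChainChain (H : IsDualBasis φ e e') {p q N : ℕ} (h : p + 1 + q = N)
    (α : Chain k A p) (β : Chain k A q) :
    tr e e' (chainWord N (starChainChain e e' h α β)) =
      tr e e' (chainWord p α) * tr e e' (chainWord q β) := by
  have : (starChainChain e e' h).compr₂ (tr e e' ∘ₗ chainWord N) =
      (LinearMap.mul k (EpsAlg k A)).compl₁₂ (tr e e' ∘ₗ chainWord p) (tr e e' ∘ₗ chainWord q) :=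
    chain_hom_ext₂ fun a b => by
    subst h
    have h1 : ∀ l, (fun j => Fin.append (Fin.snoc (α := fun _ => Bar k A)
        (fun j : Fin p => bar k A (a j.succ)) (bar k A (e' l))) (fun j : Fin q => bar k A (b j.succ))
          (Fin.cast rfl j)) = fun j => bar k A (Fin.append (Fin.snoc (α := fun _ => A)
        (fun j : Fin p => a j.succ) (e' l)) (fun j : Fin q => b j.succ) j) := fun l => by
      funext j
      refine Fin.addCases (fun j => ?_) (fun j => ?_) j
      · refine Fin.lastCases ?_ (fun j => ?_) j <;> simp
      · simp
    have h2 : ∀ l, List.ofFn (Fin.append (Fin.snoc (α := fun _ => A)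
        (fun j : Fin p => a j.succ) (e' l)) (fun j : Fin q => b j.succ)) =
        (List.ofFn fun j : Fin p => a j.succ) ++ e' l :: List.ofFn fun j : Fin q => b j.succ :=
      fun l => by
        rw [List.ofFn_fin_append, List.ofFn_succ']
        simp
    have hc := mem_cent.1 (H.tr_mem_cent (chainWord p (pureChain p a)))
    simp only [LinearMap.compr₂_apply, LinearMap.compl₁₂_apply, LinearMap.comp_apply,
      LinearMap.mul_apply']
    rw [← tr_cent_mul _ (H.tr_mem_cent _)]
    simp only [pureChain_apply, starChainChain_tmul, map_sum, chainWord_tmul] at hc ⊢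
    rw [← mul_assoc, ← hc]
    simp only [h1, h2, barWord_tprod, word_append, word_cons, tr_apply _ _ (incl k (a 0) * _),
      Finset.mul_sum, Finset.sum_mul, map_mul, map_sum, mul_assoc]
  exact LinearMap.congr_fun₂ this α β

/-- Products with f in C^0(A, A) agree with those of T only for central f, which is why cocycles are
required; between chains the identity is unconditional. -/
theorem embed_starProduct (H : IsDualBasis φ e e') (m n : ℕ) (x : D k A m) (y : D k A n)
    (hx : IsCocycle m (embed e e' m x)) (hy : IsCocycle n (embed e e' n y)) :
    embed e e' (m + n) (starProduct e e' m n x y) = embed e e' m x * embed e e' n y := by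
  cases m with
  | zero =>
    cases n with
    | zero =>
      refine (congrArg (incl k) (starCochainCochain_apply (k := k) (A := A) x y)).trans ?_
      rw [map_mul]
      exact (mem_cent.1 hy.cent _).symm
    | succ q =>
      refine (congrArg (tr e e') (chainWord_starCochainChain _ _
        ((isCocycle_incl_iff _).1 hx) _)).trans ?_
      exact tr_cent_mul _ hx.cent
  | succ p =>
    cases n with
    | zero =>
      refine (congrArg (tr e e') (chainWord_starChainCochain _ _)).trans ?_
      exact (tr_cent_mul _ hy.cent).trans (mem_cent.1 (H.tr_mem_cent _) _)
    | succ q => exact tr_chainWord_starChainChain H _ _ _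

end Operations

end TateHochschild

namespace TateHochschild

/-! ### Connes' operator as a sum of rotations -/

section Connes

variable {k : Type*} [Field k] {A : Type*} [Ring A] [Algebra k A]
  {ι : Type*} [Fintype ι] {e e' : ι → A} {φ : SymmetrizingForm k A}

open EpsAlg

theorem split_word (l : List A) : split (word k l) = ∑ i ∈ Finset.range l.length,
    (-1 : k) ^ i • (word k (l.take (i + 1)) ⊗ₜ[k] (eps k A * word k (l.drop (i + 1)))) := by
  induction l with
  | nil => simp
  | cons a l ih =>
    rw [word_cons, split_mul, ih, List.length_cons, Finset.sum_range_succ', add_comm]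
    congr 1
    · simp [map_sum, pow_succ, TensorProduct.neg_tmul, smul_neg, mul_assoc]
    · simp [split_mul]

namespace EpsAlg

/-- Cutting a word at a letter `ε` and exchanging the two halves, summed over the letters `ε`. -/
noncomputable def rotations (n : ℕ) : EpsAlg k A →ₗ[k] EpsAlg k A :=
  swapMul ((-1) ^ n) 1 ∘ₗ split

theorem rotations_apply (n : ℕ) (w : EpsAlg k A) :
    rotations n w = swapMul ((-1) ^ n) 1 (split w) := rfl

@[simp]
theorem rotations_incl (n : ℕ) (a : A) : rotations n (incl k a) = 0 := by simp [rotations_apply]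

/-- Once the halves are exchanged, a coefficient from either end of w sits at the junction. Hence
`map_cutLast_tr` applies to the trace of `rotations`. -/
theorem rotations_mul_incl (n : ℕ) (w : EpsAlg k A) (a : A) :
    rotations n (w * incl k a) = rotations n (incl k a * w) := by
  simp only [rotations_apply, split_mul, split_incl, map_zero, add_zero, zero_add, scale_incl]
  generalize split w = z
  induction z using TensorProduct.induction_on with
  | zero => simp
  | tmul x y => simp [mul_assoc]
  | add x y hx hy => simp only [map_add, hx, hy]

end EpsAlg

theorem rotations_word (n : ℕ) (l : List A) : rotations n (word k l) =
    ∑ i ∈ Finset.range l.length, (-1 : k) ^ (i + n * (i + 1)) •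
      (eps k A * word k (l.rotate (i + 1))) := by
  rw [rotations_apply, split_word, map_sum]
  refine Finset.sum_congr rfl fun i hi => ?_
  rw [Finset.mem_range] at hi
  have h := (isHom_word (k := k) (l.take (i + 1))).scale (c := (-1) ^ n)
  rw [List.length_take, min_eq_left hi] at h
  rw [map_smul, swapMul_tmul, h, List.rotate_eq_drop_append_take hi, word_append, pow_add _ i (n * (i + 1)),
    mul_smul, pow_mul _ n (i + 1)]
  simp only [mul_one, one_mul, mul_assoc, mul_smul_comm, Nat.succ_eq_add_one]

variable (e e' φ) in
/-- Connes' operator, for elements of degree `n` of `T`. -/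
noncomputable def bv (n : ℕ) : EpsAlg k A →ₗ[k] EpsAlg k A :=
  -(tr e e' ∘ₗ rotations n ∘ₗ cutLast (φ.form.flip 1))

theorem bv_apply (n : ℕ) (z : EpsAlg k A) :
    bv e e' φ n z = -tr e e' (rotations n (cutLast (φ.form.flip 1) z)) := rfl

theorem bv_incl (n : ℕ) (a : A) : bv e e' φ n (incl k a) = 0 := by
  simp [bv_apply, cutLast_incl]

theorem IsDualBasis.bv_tr (H : IsDualBasis φ e e') (n : ℕ) (w : EpsAlg k A) :
    bv e e' φ n (tr e e' w) = -tr e e' (rotations n w) := by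
  rw [bv_apply]
  exact congrArg _ (H.map_cutLast_tr (tr e e' ∘ₗ rotations n)
    (fun a w => by simp [rotations_mul_incl]) (fun a => by simp) w)

theorem chainWord_connesB {p : ℕ} (α : Chain k A p) :
    chainWord (p + 1) (connesB p α) = -rotations (p + 1) (chainWord p α) := by
  have : chainWord (p + 1) ∘ₗ connesB p = -(rotations (p + 1) ∘ₗ chainWord (k := k) (A := A) p) :=
    chain_hom_ext fun a => by
    have h1 : ∀ i : Fin (p + 1), List.ofFn (fun j => a (j + i)) = (List.ofFn a).rotate i :=
      fun i => List.ext_getElem (by simp) fun j h1 h2 => by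
        simp only [List.getElem_ofFn, List.getElem_rotate, List.length_ofFn]
        congr 1
    -- One sum runs over rotations by 0, …, p, the other by 1, …, p + 1. Rotation by p + 1 is the
    -- identity, with sign (-1)^{p(p+1)} = 1.
    have h2 := Finset.sum_range_succ (fun i => (-1 : k) ^ (p * i) •
      (eps k A * word k ((List.ofFn a).rotate i))) (p + 1)
    have h3 : (List.ofFn a).rotate (p + 1) = List.ofFn a := by
      simpa using List.rotate_length (List.ofFn a)
    rw [Finset.sum_range_succ', h3, Even.neg_one_pow (Nat.even_mul_succ_self p)] at h2
    simp only [mul_zero, pow_zero, List.rotate_zero, add_left_inj] at h2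
    simp only [LinearMap.comp_apply, LinearMap.neg_apply, chainWord_pureChain, rotations_word,
      connesB_pureChain, map_sum, map_smul, chainWord_tmul, barWord_tprod, h1, map_one, one_mul]
    rw [Fin.sum_univ_eq_sum_range (fun i => (-1 : k) ^ (p * i) •
      (eps k A * word k ((List.ofFn a).rotate i))), ← h2, List.length_ofFn, ← Finset.sum_neg_distrib]
    refine Finset.sum_congr rfl fun i _ => ?_
    rw [← neg_smul]
    congr 1
    exact neg_one_pow_eq_neg (by ring_nf; simp [Nat.odd_add, Nat.even_add, Nat.even_mul])
  exact LinearMap.congr_fun this α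

theorem embed_connes (H : IsDualBasis φ e e') (n : ℕ) (x : D k A n) :
    embed e e' (n + 1) (connes n x) = bv e e' φ n (embed e e' n x) := by
  cases n with
  | zero => exact (map_zero (embed e e' 1)).trans (bv_incl 0 _).symm
  | succ p =>
    refine (congrArg (tr e e') (chainWord_connesB _)).trans ?_
    rw [map_neg]
    exact (H.bv_tr _ _).symm

theorem connes_connes (n : ℕ) (x : D k A n) : connes (n + 1) (connes n x) = 0 := by
  cases n with
  | zero => exact map_zero (connes 1)
  | succ p =>
    have h : ∀ x : Chain k A p, connesB (p + 1) (connesB p x) = 0 := fun x => by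
      have : connesB (p + 1) ∘ₗ connesB (k := k) (A := A) p = 0 := chain_hom_ext fun a => by
        rw [LinearMap.comp_apply, connesB_pureChain, map_sum]
        refine Finset.sum_eq_zero fun i _ => ?_
        rw [map_smul]
        have := connesB_pureChain (k := k) (p + 1) (Fin.cons 1 fun j => a (j + i))
        rw [pureChain_apply] at this
        simp only [Fin.cons_zero, Fin.cons_succ] at this
        rw [this, Finset.sum_eq_zero, smul_zero]
        intro j _
        -- The coefficient 1 produced by the inner operator is rotated to position -j, where its
        -- class in Ā vanishes.
        rw [MultilinearMap.map_coord_zero _ (-j), TensorProduct.tmul_zero, smul_zero]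
        simp [bar_one]
      exact LinearMap.congr_fun this x
    exact h x

end Connes

end TateHochschild

namespace TateHochschild

/-! ### The identities up to boundaries -/

section Homotopies

variable {k : Type*} [Field k] {A : Type*} [Ring A] [Algebra k A]
  {ι : Type*} [Fintype ι] {e e' : ι → A} {φ : SymmetrizingForm k A}

open EpsAlg

variable (k A) in
/-- The boundaries of the subalgebra of elements of `T` that commute with `A`. -/
noncomputable def boundaries : Submodule k (EpsAlg k A) :=
  (Subalgebra.toSubmodule (cent k A)).map (d k A)

theorem d_mem_boundaries {u : EpsAlg k A} (hu : u ∈ cent k A) : d k A u ∈ boundaries k A :=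
  ⟨u, hu, rfl⟩

theorem mul_mem_boundaries {m : ℕ} {α β : EpsAlg k A} (hα : IsCocycle m α)
    (hβ : β ∈ boundaries k A) : α * β ∈ boundaries k A := by
  obtain ⟨u, hu, rfl⟩ := hβ
  refine ⟨(-1 : k) ^ m • (α * u), (cent k A).smul_mem (mul_mem (S := Subalgebra k (EpsAlg k A)) hα.cent hu) _, ?_⟩
  rw [map_smul, d_mul, hα.d, hα.isHom.scale, zero_mul, zero_add, smul_mul_assoc, smul_smul,
    ← mul_pow]
  simp

theorem mem_boundaries_mul {m : ℕ} {α β : EpsAlg k A} (hα : IsCocycle m α)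
    (hβ : β ∈ boundaries k A) : β * α ∈ boundaries k A := by
  obtain ⟨u, hu, rfl⟩ := hβ
  exact ⟨u * α, mul_mem (S := Subalgebra k (EpsAlg k A)) hu hα.cent, by rw [d_mul, hα.d, mul_zero, add_zero]⟩

theorem mul_comm_sub_mem {m n : ℕ} {α β : EpsAlg k A} (hα : IsCocycle m α)
    (hβ : IsCocycle n β) : α * β - (-1 : k) ^ (m * n) • (β * α) ∈ boundaries k A :=
  ⟨_, ins_mem_cent ((-1) ^ (m + 1)) α hβ.cent, hα.d_ins hβ rfl⟩

/-- The half of the bracket that inserts α is a derivation on the nose. The half that inserts βγ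
into α fails the product rule by the differential of `insTwo` at α. -/
theorem bracket_mul_sub_mem {m n l : ℕ} {α β γ : EpsAlg k A} (hα : IsCocycle m α)
    (hβ : IsCocycle n β) (hγ : IsCocycle l γ) :
    bracket m (n + l) α (β * γ) - (bracket m n α β * γ +
      (-1 : k) ^ ((m + 1) * n) • (β * bracket m l α γ)) ∈ boundaries k A := by
  have h := d_insTwo hβ hγ (b := (-1) ^ (n + 1)) (c := (-1) ^ (l + 1)) rfl rfl α
  refine ⟨-((-1 : k) ^ (m * (n + l + 1)) * (-1) ^ (n + 1)) •
    insTwo ((-1) ^ (n + 1)) ((-1) ^ (l + 1)) β γ α,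
    (cent k A).smul_mem (insTwo_mem_cent hα.cent) _, ?_⟩
  rw [map_smul, h, hα.d, hα.isHom.scale, bracket, bracket,
    bracket, ins_mul, hβ.isHom.scale]
  have h1 : -((-1 : k) ^ (n + 1) * (-1) ^ (l + 1)) = (-1) ^ (n + l + 1) := by ring
  have h2 : -(-1 : k) ^ (l + 1) = (-1) ^ l := by ring
  have h3 : ((-1 : k) ^ (m + 1)) ^ n = (-1) ^ (m * n) * (-1) ^ n := by ring
  rw [h1, h2, h3]
  clear h h1 h2 h3
  simp only [map_zero, smul_zero, zero_add, pow_add, mul_add, mul_one, pow_one, add_mul, one_mul,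
    map_smul, mul_comm l m, ← pow_mul, mul_sub, sub_mul, smul_mul_assoc, mul_smul_comm]
  -- After expansion of the exponents five signs remain; treating them as independent values ±1
  -- leaves linear identities.
  have hm := neg_one_pow_eq_or k m
  have hn := neg_one_pow_eq_or k n
  have hl := neg_one_pow_eq_or k l
  have hmn := neg_one_pow_eq_or k (m * n)
  have hml := neg_one_pow_eq_or k (m * l)
  generalize (-1 : k) ^ m = s₁, (-1 : k) ^ n = s₂, (-1 : k) ^ l = s₃, (-1 : k) ^ (m * n) = s₄,
    (-1 : k) ^ (m * l) = s₅ at *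
  rcases hm with rfl | rfl <;> rcases hn with rfl | rfl <;> rcases hl with rfl | rfl <;>
    rcases hmn with rfl | rfl <;> rcases hml with rfl | rfl <;>
    simp only [one_mul, mul_one, neg_mul, mul_neg, neg_neg] <;> module

/-- By `d_swapMul` and `split_d` the defect is the exchange applied to 1 ⊗ w - w ⊗ 1, that is, w
minus its full rotation. The sign of the latter is (-1)^{n(n+1)} = 1, so the defect is zero. -/
theorem tr_rotations_d (H : IsDualBasis φ e e') {n : ℕ} {w : EpsAlg k A} (hw : IsHom n w) :
    d k A (tr e e' (rotations n w)) = -tr e e' (rotations (n + 1) (d k A w)) := by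
  have hone : IsCocycle (k := k) (A := A) 0 1 :=
    ⟨by simpa using IsHom.incl (k := k) (1 : A), one_mem _, d_one⟩
  have h1 := d_swapMul hone (z := split w) (N := n + 1) (by
    rw [scale_split, hw.scale, map_smul, smul_smul, pow_succ'])
  have h2 := split_d (tr e e' ∘ₗ swapMul ((-1) ^ (n + 1)) 1) (fun x y a => by
      simp only [LinearMap.comp_apply, swapMul_tmul, map_mul, scale_incl, mul_one]
      rw [← mul_assoc, H.tr_comm, mul_assoc]) w
  have h3 : ((-1 : k) ^ (n + 1)) ^ n = 1 := by
    rw [← pow_mul, mul_comm]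
    exact (Nat.even_mul_succ_self _).neg_one_pow
  have h4 : (-1 : k) ^ (0 + (n + 1) + 1) = (-1) ^ n := by ring
  rw [h4, zero_add] at h1
  simp only [LinearMap.comp_apply, map_add, map_sub, swapMul_tmul, mul_one, one_mul, map_one,
    hw.scale, h3, one_smul, sub_self] at h2
  rw [d_tr, rotations_apply, rotations_apply, h1]
  exact eq_neg_of_add_eq_zero_left h2

theorem eq_tr_cutLast (H : IsDualBasis φ e e') {n : ℕ} (hn : n ≠ 0) {z : EpsAlg k A}
    (hz : IsHom n z) (hc : z ∈ cent k A) : z = tr e e' (cutLast (φ.form.flip 1) z) := by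
  conv_lhs => rw [H.eq_incl_add_tr hc, hz.projZero_eq_zero hn, map_zero, zero_add]

theorem bv_d (H : IsDualBasis φ e e') {n : ℕ} {z : EpsAlg k A} (hz : IsHom n z)
    (hc : z ∈ cent k A) : d k A (bv e e' φ n z) = -bv e e' φ (n + 1) (d k A z) := by
  rcases eq_or_ne n 0 with rfl | hn
  · rw [← isHom_zero_iff.1 hz, bv_incl, d_incl, map_zero, map_zero, neg_zero]
  · rw [eq_tr_cutLast H hn hz hc, H.bv_tr, map_neg, tr_rotations_d H (hz.cutLast _), d_tr,
      H.bv_tr]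

/-- Only the parity of the index enters. For u of degree n + 1, `bv_d` produces the index n + 2,
whereas the element d u has degree n. -/
theorem bv_add_two (n : ℕ) (z : EpsAlg k A) : bv e e' φ (n + 2) z = bv e e' φ n z := by
  simp [bv_apply, rotations_apply, pow_succ]

theorem EpsAlg.IsCocycle.bv (H : IsDualBasis φ e e') {n : ℕ} {z : EpsAlg k A} (hz : IsCocycle n z) :
    IsCocycle (n + 1) (bv e e' φ n z) := by
  obtain ⟨x, rfl⟩ := exists_embed_eq H hz.isHom fun _ => hz.cent
  refine ⟨?_, neg_mem (H.tr_mem_cent _), ?_⟩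
  · rw [← embed_connes H]
    exact isHom_embed _
  · rw [bv_d H hz.isHom hz.cent, hz.d, map_zero, neg_zero]

theorem bv_mem_boundaries (H : IsDualBasis φ e e') {n : ℕ} {u : EpsAlg k A} (hu : IsHom (n + 1) u)
    (hc : u ∈ cent k A) : bv e e' φ n (d k A u) ∈ boundaries k A := by
  rw [← bv_add_two, ← neg_neg (bv e e' φ (n + 2) (d k A u)), ← bv_d H hu hc]
  exact neg_mem (d_mem_boundaries (neg_mem (H.tr_mem_cent _)))

theorem ins_cutLast_of_cent (H : IsDualBasis φ e e') (c : k) (α : EpsAlg k A) {z : EpsAlg k A}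
    (hz : z ∈ cent k A) :
    ins c α (tr e e' (cutLast (φ.form.flip 1) z)) = ins c α z := by
  conv_rhs => rw [H.eq_incl_add_tr hz, map_add, ins_incl, zero_add]

/-- In `tr_swapMul_split` a term in d w remains, and only the trace of d w is known to vanish. That
term is a function of d w that kills A and commutators with A, so by `map_cutLast_tr` it depends on
the trace alone. -/
theorem tr_swapMul_split_sub_mem (H : IsDualBasis φ e e') {m n : ℕ} {α w : EpsAlg k A}
    (hα : IsCocycle m α) (hw : IsHom n w) (hd : d k A (tr e e' w) = 0) :
    tr e e' (swapMul ((-1) ^ (n + m)) α (split w)) -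
      (tr e e' (rotations n w) * α + ((-1 : k) ^ (m * (n + 1)) * (-1) ^ (m + 1)) •
        ins ((-1) ^ (m + 1)) α (tr e e' w)) ∈ boundaries k A := by
  have h := H.tr_swapMul_split hα hw rfl
  have h1 : tr e e' (swapMul ((-1) ^ (n + m)) 1
      ((ins ((-1) ^ (m + 1)) α).rTensor (EpsAlg k A) (split (d k A w)))) = 0 := by
    have := H.map_cutLast_tr (tr e e' ∘ₗ swapMul ((-1) ^ (n + m)) 1 ∘ₗ
      (ins ((-1) ^ (m + 1)) α).rTensor (EpsAlg k A) ∘ₗ split) (fun a w => by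
        simp only [LinearMap.comp_apply, split_mul, split_incl, map_zero, add_zero, zero_add,
          scale_incl]
        generalize split w = z
        induction z using TensorProduct.induction_on with
        | zero => simp
        | tmul x y => simp [mul_assoc, ins_incl_mul]
        | add x y hx hy => simp only [map_add, hx, hy]) (fun a => by simp) (d k A w)
    rw [← d_tr, hd, map_zero, map_zero] at this
    exact this.symm
  rw [h, h1, ins_tr, smul_zero, add_zero, smul_add, smul_smul, ← rotations_apply, ← add_assoc,
    add_sub_cancel_left]
  exact Submodule.smul_mem _ _ (d_mem_boundaries (H.tr_mem_cent _))

theorem split_tr_cutLast (H : IsDualBasis φ e e') {z : EpsAlg k A} (hz : z ∈ cent k A) :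
    split z = split (tr e e' (cutLast (φ.form.flip 1) z)) := by
  conv_lhs => rw [H.eq_incl_add_tr hz, map_add, split_incl, zero_add]

theorem bv_eq_rotations (n : ℕ) (z : EpsAlg k A) :
    tr e e' (rotations n (cutLast (φ.form.flip 1) z)) = - bv e e' φ n z := by
  rw [bv_apply, neg_neg]

/-- Write α and β as traces of v and w, up to degree 0. Connes' operator on αβ = tr(α w) cuts inside
v, with β between the exchanged halves, or inside w, with α between them. Modulo boundaries the two
parts are Connes' operator on α times β and on β times α, each with an insertion, up to sign. The
insertions form the bracket; commutativity up to homotopy restores the order of the second product.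
-/
theorem bracket_sub_mem (H : IsDualBasis φ e e') {m n : ℕ} {α β : EpsAlg k A}
    (hα : IsCocycle m α) (hβ : IsCocycle n β) :
    bracket m n α β - (-1 : k) ^ (m + 1) •
      (bv e e' φ (m + n) (α * β) - bv e e' φ m α * β -
        (-1 : k) ^ m • (α * bv e e' φ n β)) ∈ boundaries k A := by
  have hdα : d k A (tr e e' (cutLast (φ.form.flip 1) α)) = 0 := by
    have := hα.d
    rwa [H.eq_incl_add_tr hα.cent, map_add, d_incl, zero_add] at this
  rcases eq_or_ne n 0 with rfl | hn
  -- A β in degree 0 need not be a trace. It is central, α β is the trace of v g, and only the cuts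
  -- inside v occur.
  · obtain ⟨g, rfl⟩ : ∃ g, β = incl k g := ⟨_, (isHom_zero_iff.1 hβ.isHom).symm⟩
    rcases eq_or_ne m 0 with rfl | hm
    · obtain ⟨f, rfl⟩ : ∃ f, α = incl k f := ⟨_, (isHom_zero_iff.1 hα.isHom).symm⟩
      rw [← map_mul, bv_incl, bv_incl, bv_incl]
      simp [bracket]
    · have h := tr_swapMul_split_sub_mem H hβ (hα.isHom.cutLast _) hdα
      have h1 : swapMul ((-1) ^ (m + 0)) (incl k g) (split (cutLast (φ.form.flip 1) α)) =
          rotations m (cutLast (φ.form.flip 1) α * incl k g) := by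
        rw [rotations_apply, split_mul, split_incl, map_zero, add_zero, add_zero]
        generalize split (cutLast (φ.form.flip 1) α) = z
        induction z using TensorProduct.induction_on with
        | zero => simp
        | tmul x y => simp
        | add x y hx hy => simp only [map_add, hx, hy]
      rw [h1, ← neg_neg (tr e e' (rotations m (cutLast (φ.form.flip 1) α * incl k g))),
        ← H.bv_tr, tr_mul_cent _ hβ.cent, ins_cutLast_of_cent H _ _ hα.cent,
        ← eq_tr_cutLast H hm hα.isHom hα.cent, bv_eq_rotations] at h
      convert Submodule.smul_mem _ ((-1 : k) ^ (m + 1)) h using 1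
      rw [bv_incl]
      simp [bracket, pow_succ]
      module
  · have hdβ : d k A (tr e e' (cutLast (φ.form.flip 1) β)) = 0 := by
      rw [← eq_tr_cutLast H hn hβ.isHom hβ.cent, hβ.d]
    have h0 := H.bv_tr (m + n) (α * cutLast (φ.form.flip 1) β)
    rw [rotations_apply, H.tr_swapMul_split_mul hα.isHom _ _ (split_tr_cutLast H hα.cent),
      tr_cent_mul _ hα.cent, ← eq_tr_cutLast H hn hβ.isHom hβ.cent] at h0
    have h1 := tr_swapMul_split_sub_mem H hβ (hα.isHom.cutLast _) hdα
    have h2 := tr_swapMul_split_sub_mem H hα (hβ.isHom.cutLast _) hdβ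
    rw [ins_cutLast_of_cent H _ _ hα.cent, bv_eq_rotations] at h1
    rw [ins_cutLast_of_cent H _ _ hβ.cent, bv_eq_rotations] at h2
    -- Used to turn Connes' operator on β times α into α times Connes' operator on β.
    have h3 := mul_comm_sub_mem (hβ.bv H) hα
    rw [← neg_eq_iff_eq_neg] at h0
    rw [← neg_neg (bv e e' φ (m + n) (α * β)), h0, bracket]
    have h4 := Submodule.smul_mem _ ((-1 : k) ^ (m + 1)) (sub_mem (add_mem h1
      (Submodule.smul_mem _ ((-1 : k) ^ (m * n)) h2)) (Submodule.smul_mem _ ((-1 : k) ^ (m * n)) h3))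
    convert h4 using 1
    clear h0 h1 h2 h3 h4
    simp only [pow_add, mul_add, mul_one, pow_one, add_mul, one_mul, mul_comm n m]
    have hm := neg_one_pow_eq_or k m
    have hn := neg_one_pow_eq_or k n
    have hmn := neg_one_pow_eq_or k (m * n)
    generalize (-1 : k) ^ m = s₁, (-1 : k) ^ n = s₂, (-1 : k) ^ (m * n) = s₃ at *
    rcases hm with rfl | rfl <;> rcases hn with rfl | rfl <;> rcases hmn with rfl | rfl <;>
      simp only [one_mul, mul_one, neg_mul, mul_neg, neg_neg] <;> module

end Homotopies

end TateHochschild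

namespace TateHochschild

/-! ### Passage to cohomology classes -/

section Classes

variable {k : Type*} [Field k] {A : Type*} [Ring A] [Algebra k A]
  {ι : Type*} [Fintype ι] {e e' : ι → A} {φ : SymmetrizingForm k A}

open EpsAlg

theorem EpsAlg.IsCocycle.smul {n : ℕ} {x : EpsAlg k A} (hx : IsCocycle n x) (c : k) :
    IsCocycle n (c • x) :=
  ⟨hx.isHom.smul c, Subalgebra.smul_mem _ hx.cent c, by rw [map_smul, hx.d, smul_zero]⟩

theorem EpsAlg.IsCocycle.sub {n : ℕ} {x y : EpsAlg k A} (hx : IsCocycle n x)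
    (hy : IsCocycle n y) : IsCocycle n (x - y) :=
  ⟨hx.isHom.sub hy.isHom, sub_mem hx.cent hy.cent, by rw [map_sub, hx.d, hy.d, sub_zero]⟩

theorem EpsAlg.IsCocycle.add {n : ℕ} {x y : EpsAlg k A} (hx : IsCocycle n x)
    (hy : IsCocycle n y) : IsCocycle n (x + y) :=
  ⟨hx.isHom.add hy.isHom, add_mem hx.cent hy.cent, by rw [map_add, hx.d, hy.d, add_zero]⟩

theorem bracket_skew (m n : ℕ) (α β : EpsAlg k A) :
    bracket m n α β = -((-1 : k) ^ ((m + 1) * (n + 1)) • bracket n m β α) := by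
  simp only [bracket, pow_add, mul_add, mul_one, pow_one, add_mul, one_mul, mul_comm n m, smul_sub,
    smul_smul]
  have hm := neg_one_pow_eq_or k m
  have hn := neg_one_pow_eq_or k n
  have hmn := neg_one_pow_eq_or k (m * n)
  generalize (-1 : k) ^ m = s₁, (-1 : k) ^ n = s₂, (-1 : k) ^ (m * n) = s₃ at *
  rcases hm with rfl | rfl <;> rcases hn with rfl | rfl <;> rcases hmn with rfl | rfl <;>
    simp only [one_mul, mul_one, neg_mul, mul_neg, neg_neg] <;> module

/-- No homotopy is needed. `ins_bracket` for the three pairs turns everything into the six iterated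
insertions of two of the elements into the third, whose coefficients agree. -/
theorem bracket_bracket {m n l : ℕ} {α β γ : EpsAlg k A} (hα : IsHom m α) (hβ : IsHom n β)
    (hγ : IsHom l γ) :
    bracket m (n + l + 1) α (bracket n l β γ) = bracket (m + n + 1) l (bracket m n α β) γ +
      (-1 : k) ^ ((m + 1) * (n + 1)) • bracket n (m + l + 1) β (bracket m l α γ) := by
  have h1 := ins_bracket hα hβ γ
  have h2 := ins_bracket hα hγ β
  have h3 := ins_bracket hβ hγ α
  have e1 : (-1 : k) ^ (m + n) = (-1) ^ (m + n + 1 + 1) := by ring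
  have e2 : (-1 : k) ^ (m + l) = (-1) ^ (m + l + 1 + 1) := by ring
  have e3 : (-1 : k) ^ (n + l) = (-1) ^ (n + l + 1 + 1) := by ring
  rw [e1] at h1
  rw [e2] at h2
  rw [e3] at h3
  rw [bracket, h3, bracket.eq_1 (m + n + 1) l, h1, bracket.eq_1 n (m + l + 1), h2]
  simp only [bracket, map_sub, map_smul, smul_sub, smul_smul]
  generalize ins ((-1) ^ (m + 1)) α (ins ((-1) ^ (n + 1)) β γ) = X₁,
    ins ((-1) ^ (m + 1)) α (ins ((-1) ^ (l + 1)) γ β) = X₂,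
    ins ((-1) ^ (n + 1)) β (ins ((-1) ^ (m + 1)) α γ) = X₃,
    ins ((-1) ^ (n + 1)) β (ins ((-1) ^ (l + 1)) γ α) = X₄,
    ins ((-1) ^ (l + 1)) γ (ins ((-1) ^ (m + 1)) α β) = X₅,
    ins ((-1) ^ (l + 1)) γ (ins ((-1) ^ (n + 1)) β α) = X₆ at *
  simp only [pow_add, mul_add, mul_one, pow_one, add_mul, one_mul, mul_comm n m, mul_comm l m,
    mul_comm l n]
  have hm := neg_one_pow_eq_or k m
  have hn := neg_one_pow_eq_or k n
  have hl := neg_one_pow_eq_or k l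
  have hmn := neg_one_pow_eq_or k (m * n)
  have hml := neg_one_pow_eq_or k (m * l)
  have hnl := neg_one_pow_eq_or k (n * l)
  generalize (-1 : k) ^ m = s₁, (-1 : k) ^ n = s₂, (-1 : k) ^ l = s₃, (-1 : k) ^ (m * n) = s₄,
    (-1 : k) ^ (m * l) = s₅, (-1 : k) ^ (n * l) = s₆ at *
  have hm₂ : s₁ ^ 2 = 1 := by rcases hm with rfl | rfl <;> norm_num
  have hm₃ : s₁ ^ 3 = s₁ := by rw [pow_succ, hm₂, one_mul]
  have hn₂ : s₂ ^ 2 = 1 := by rcases hn with rfl | rfl <;> norm_num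
  have hn₃ : s₂ ^ 3 = s₂ := by rw [pow_succ, hn₂, one_mul]
  have hl₂ : s₃ ^ 2 = 1 := by rcases hl with rfl | rfl <;> norm_num
  have hl₃ : s₃ ^ 3 = s₃ := by rw [pow_succ, hl₂, one_mul]
  have hmn₂ : s₄ ^ 2 = 1 := by rcases hmn with rfl | rfl <;> norm_num
  have hmn₃ : s₄ ^ 3 = s₄ := by rw [pow_succ, hmn₂, one_mul]
  have hml₂ : s₅ ^ 2 = 1 := by rcases hml with rfl | rfl <;> norm_num
  have hml₃ : s₅ ^ 3 = s₅ := by rw [pow_succ, hml₂, one_mul]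
  have hnl₂ : s₆ ^ 2 = 1 := by rcases hnl with rfl | rfl <;> norm_num
  have hnl₃ : s₆ ^ 3 = s₆ := by rw [pow_succ, hnl₂, one_mul]
  match_scalars
  all_goals
    ring_nf
    try simp only [hm₂, hm₃, hn₂, hn₃, hl₂, hl₃, hmn₂, hmn₃, hml₂, hml₃, hnl₂, hnl₃, mul_one, one_mul]
    try ring

theorem embed_mem_cent (H : IsDualBasis φ e e') {n : ℕ} (x : D k A (n + 1)) :
    embed e e' (n + 1) x ∈ cent k A := H.tr_mem_cent _

theorem proj_d (n : ℕ) (x : EpsAlg k A) : proj k A n (d k A x) = d k A (proj k A (n + 1) x) := by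
  obtain ⟨N, hN⟩ := exists_sum_proj x
  have h : ∀ i, proj k A n (d k A (proj k A i x)) =
      d k A (proj k A (n + 1) (proj k A i x)) := fun i => by
    have hi := isHom_proj i x
    obtain ⟨h0, h1⟩ := hi.d
    rw [hi.proj]
    rcases i with _ | i
    · rw [h0 rfl, if_neg (by omega), map_zero, map_zero]
    · rw [h1.proj]
      by_cases hin : i = n
      · rw [if_pos (by omega), if_pos (by omega)]
      · rw [if_neg (by omega), if_neg (by omega), map_zero]
  rw [hN]
  simp only [map_sum, h]

/-- A primitive in the centralizer may be inhomogeneous; its component of degree n + 1 still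
commutes with A and is a primitive, since d is homogeneous. -/
theorem exists_embed_differential (H : IsDualBasis φ e e') {n : ℕ} {x : D k A n}
    (h : embed e e' n x ∈ boundaries k A) : x ∈ LinearMap.range (differential (k := k) e e' n) := by
  obtain ⟨u, hu, hux⟩ := h
  obtain ⟨y, hy⟩ := exists_embed_eq H (isHom_proj (n + 1) u) (fun _ => proj_mem_cent _ hu)
  refine ⟨y, embed_injective H n ?_⟩
  rw [embed_differential H, hy, ← proj_d, hux, (isHom_embed x).proj, if_pos rfl]

theorem cohomClass_eq (H : IsDualBasis φ e e') {n : ℕ} {x y : D k A n} (hx : x ∈ cocycles e e' n)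
    (hy : y ∈ cocycles e e' n) (h : embed e e' n x - embed e e' n y ∈ boundaries k A) :
    cohomClass e e' n x hx = cohomClass e e' n y hy := by
  refine congrArg _ ((Submodule.Quotient.eq _).2 (Submodule.mem_comap.2 ?_))
  rw [← map_sub] at h
  exact exists_embed_differential H h

/-- A linear left inverse of the embedding of cocycles exists over a field. The values away from
cocycles are arbitrary; linearity on all of T frees later computations from membership proofs. -/
theorem exists_classMap (H : IsDualBasis φ e e') (n : ℕ) :
    ∃ C : EpsAlg k A →ₗ[k] THNonpos k e e', ∀ x hx,
      C (embed e e' n x) = cohomClass e e' n x hx := by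
  obtain ⟨g, hg⟩ := LinearMap.exists_leftInverse_of_injective
    (embed e e' n ∘ₗ (cocycles (k := k) (A := A) e e' n).subtype)
    (LinearMap.ker_eq_bot.2 ((embed_injective H n).comp Subtype.val_injective))
  refine ⟨DirectSum.lof k ℕ (TH k e e') n ∘ₗ Submodule.mkQ _ ∘ₗ g, fun x hx => ?_⟩
  have := LinearMap.congr_fun hg ⟨x, hx⟩
  exact congrArg (fun z => DirectSum.lof k ℕ (TH k e e') n (Submodule.Quotient.mk z)) this

/-- The class of a cocycle of degree `-n`, extended linearly to `T`. -/
noncomputable def classMap (H : IsDualBasis φ e e') (n : ℕ) :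
    EpsAlg k A →ₗ[k] THNonpos k e e' := (exists_classMap H n).choose

theorem classMap_embed (H : IsDualBasis φ e e') {n : ℕ} (x : D k A n) (hx : x ∈ cocycles e e' n) :
    classMap H n (embed e e' n x) = cohomClass e e' n x hx := (exists_classMap H n).choose_spec x hx

theorem exists_cocycle_embed (H : IsDualBasis φ e e') {n : ℕ} {z : EpsAlg k A}
    (hz : IsCocycle n z) : ∃ x ∈ cocycles e e' n, embed e e' n x = z := by
  obtain ⟨x, rfl⟩ := exists_embed_eq H hz.isHom fun _ => hz.cent
  exact ⟨x, (mem_cocycles_iff H x).2 hz, rfl⟩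

theorem classMap_eq (H : IsDualBasis φ e e') {n : ℕ} {y z : EpsAlg k A} (hy : IsCocycle n y)
    (hz : IsCocycle n z) (h : y - z ∈ boundaries k A) : classMap H n y = classMap H n z := by
  obtain ⟨x, hx, rfl⟩ := exists_cocycle_embed H hy
  obtain ⟨x', hx', rfl⟩ := exists_cocycle_embed H hz
  rw [classMap_embed H x hx, classMap_embed H x' hx', cohomClass_eq H hx hx' h]

theorem classMap_mem_range (H : IsDualBasis φ e e') {n : ℕ} {z : EpsAlg k A} (hz : IsCocycle n z) :
    classMap H n z ∈ LinearMap.range (DirectSum.lof k ℕ (TH k e e') n) := by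
  obtain ⟨x, hx, rfl⟩ := exists_cocycle_embed H hz
  rw [classMap_embed H x hx]
  exact ⟨_, rfl⟩

/-- A linear section of the quotient map: operations defined through representatives are then linear
by construction, and only independence of the choice has to be shown. -/
theorem exists_rep (H : IsDualBasis φ e e') (n : ℕ) :
    ∃ s : TH k e e' n →ₗ[k] EpsAlg k A, ∀ a,
      IsCocycle n (s a) ∧ classMap H n (s a) = DirectSum.lof k ℕ (TH k e e') n a := by
  obtain ⟨g, hg⟩ := LinearMap.exists_rightInverse_of_surjective
    (Submodule.mkQ ((LinearMap.range (differential (k := k) (A := A) e e' n)).submoduleOf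
      (cocycles (k := k) e e' n))) (Submodule.range_mkQ _)
  refine ⟨embed e e' n ∘ₗ (cocycles (k := k) e e' n).subtype ∘ₗ g, fun a => ?_⟩
  refine ⟨(mem_cocycles_iff H _).1 (g a).2, (classMap_embed H _ (g a).2).trans ?_⟩
  exact congrArg _ (LinearMap.congr_fun hg a)

/-- A linear choice of cocycles that represent the classes of degree `-n`. -/
noncomputable def rep (H : IsDualBasis φ e e') (n : ℕ) : TH k e e' n →ₗ[k] EpsAlg k A :=
  (exists_rep H n).choose

theorem isCocycle_rep (H : IsDualBasis φ e e') {n : ℕ} (a : TH k e e' n) :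
    IsCocycle n (rep H n a) := ((exists_rep H n).choose_spec a).1

theorem classMap_rep (H : IsDualBasis φ e e') {n : ℕ} (a : TH k e e' n) :
    classMap H n (rep H n a) = DirectSum.lof k ℕ (TH k e e') n a :=
  ((exists_rep H n).choose_spec a).2

/-- The primitive is homogeneous, as `bv_mem_boundaries` demands. -/
theorem exists_rep_sub_mem (H : IsDualBasis φ e e') {n : ℕ} {z : EpsAlg k A} (hz : IsCocycle n z) :
    ∃ a, classMap H n z = DirectSum.lof k ℕ (TH k e e') n a ∧
      ∃ u ∈ cent k A, IsHom (n + 1) u ∧ rep H n a - z = d k A u := by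
  obtain ⟨x, hx, rfl⟩ := exists_cocycle_embed H hz
  refine ⟨Submodule.Quotient.mk ⟨x, hx⟩, classMap_embed H x hx, ?_⟩
  obtain ⟨y, hy, hyr⟩ := exists_cocycle_embed H (isCocycle_rep H
    (Submodule.Quotient.mk ⟨x, hx⟩ : TH k e e' n))
  have h := classMap_rep H (Submodule.Quotient.mk ⟨x, hx⟩ : TH k e e' n)
  rw [← hyr, classMap_embed H y hy] at h
  have h' := (Submodule.Quotient.eq _).1 (DirectSum.of_injective (β := TH k e e') n h)
  obtain ⟨w, hw⟩ := Submodule.mem_comap.1 h'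
  refine ⟨embed e e' (n + 1) w, embed_mem_cent H w, isHom_embed w, ?_⟩
  rw [← hyr, ← embed_differential H, hw, ← map_sub]
  rfl

/-- The product on the cohomology. -/
noncomputable def thMul (H : IsDualBasis φ e e') :
    THNonpos k e e' →ₗ[k] THNonpos k e e' →ₗ[k] THNonpos k e e' :=
  DirectSum.toModule k ℕ _ fun m => LinearMap.flip (DirectSum.toModule k ℕ _ fun n =>
    LinearMap.flip (((LinearMap.mul k (EpsAlg k A)).compl₁₂ (rep H m) (rep H n)).compr₂
      (classMap H (m + n))))

theorem thMul_classMap (H : IsDualBasis φ e e') {m n : ℕ} {α β : EpsAlg k A} (hα : IsCocycle m α)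
    (hβ : IsCocycle n β) :
    thMul H (classMap H m α) (classMap H n β) = classMap H (m + n) (α * β) := by
  obtain ⟨a, ha, u, hu, -, hua⟩ := exists_rep_sub_mem H hα
  obtain ⟨b, hb, v, hv, -, hvb⟩ := exists_rep_sub_mem H hβ
  rw [ha, hb, thMul, DirectSum.toModule_lof, LinearMap.flip_apply, DirectSum.toModule_lof]
  refine classMap_eq H ((isCocycle_rep H a).mul (isCocycle_rep H b)) (hα.mul hβ) ?_
  have : rep H m a * rep H n b - α * β =
      (rep H m a - α) * rep H n b + α * (rep H n b - β) := by noncomm_ring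
  refine Eq.mpr (congrArg (· ∈ boundaries k A) this) ?_
  rw [hua, hvb]
  exact add_mem (mem_boundaries_mul (isCocycle_rep H b) (d_mem_boundaries hu))
    (mul_mem_boundaries hα (d_mem_boundaries hv))

/-- Connes' operator on the cohomology. -/
noncomputable def thBV (H : IsDualBasis φ e e') : THNonpos k e e' →ₗ[k] THNonpos k e e' :=
  DirectSum.toModule k ℕ _ fun n => classMap H (n + 1) ∘ₗ bv e e' φ n ∘ₗ rep H n

theorem thBV_classMap (H : IsDualBasis φ e e') {n : ℕ} {α : EpsAlg k A} (hα : IsCocycle n α) :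
    thBV H (classMap H n α) = classMap H (n + 1) (bv e e' φ n α) := by
  obtain ⟨a, ha, u, hu, hu', hua⟩ := exists_rep_sub_mem H hα
  rw [ha, thBV, DirectSum.toModule_lof]
  refine classMap_eq H ((isCocycle_rep H a).bv H) (hα.bv H) ?_
  rw [LinearMap.comp_apply, ← map_sub, hua]
  exact bv_mem_boundaries H hu' hu

/-- The failure of `Δ` to be a derivation of the product, with the signs for a first factor of
degree `m`. -/
noncomputable def derivationDefect {V : Type*} [AddCommMonoid V] [Module k V] (m : ℕ)
    (mul : V →ₗ[k] V →ₗ[k] V) (Δ : V →ₗ[k] V) : V →ₗ[k] V →ₗ[k] V :=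
  (-1 : k) ^ (m + 1) • (mul.compr₂ Δ + (-1 : k) • mul ∘ₗ Δ +
    (-1 : k) ^ (m + 1) • mul.compl₂ Δ)

theorem derivationDefect_apply {V : Type*} [AddCommGroup V] [Module k V] (m : ℕ)
    (mul : V →ₗ[k] V →ₗ[k] V) (Δ : V →ₗ[k] V) (a b : V) :
    derivationDefect m mul Δ a b =
      (-1 : k) ^ (m + 1) • (Δ (mul a b) - mul (Δ a) b - (-1 : k) ^ m • mul a (Δ b)) := by
  simp [derivationDefect, pow_succ, sub_eq_add_neg]

theorem map_smul_sub_sub {V W : Type*} [AddCommGroup V] [Module k V] [AddCommGroup W] [Module k W]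
    (f : V →ₗ[k] W) (r s : k) (x y z : V) :
    f (r • (x - y - s • z)) = r • (f x - f y - s • f z) := by simp

/-- The bracket on the cohomology, defined by the failure of Connes' operator to be a
derivation. -/
noncomputable def thBracket (H : IsDualBasis φ e e') :
    THNonpos k e e' →ₗ[k] THNonpos k e e' →ₗ[k] THNonpos k e e' :=
  DirectSum.toModule k ℕ _ fun m => derivationDefect m (thMul H) (thBV H) ∘ₗ
    DirectSum.lof k ℕ (TH k e e') m

theorem thBracket_apply (H : IsDualBasis φ e e') {m : ℕ} {a : THNonpos k e e'}
    (ha : a ∈ LinearMap.range (DirectSum.lof k ℕ (TH k e e') m)) :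
    thBracket H a = derivationDefect m (thMul H) (thBV H) a := by
  obtain ⟨a, rfl⟩ := ha
  rw [thBracket, DirectSum.toModule_lof]
  rfl

end Classes

end TateHochschild

namespace TateHochschild

/-! ### The axioms, reduced to identities between cocycles of T -/

section Axioms

variable {k : Type*} [Field k] {A : Type*} [Ring A] [Algebra k A]
  {ι : Type*} [Fintype ι] {e e' : ι → A} {φ : SymmetrizingForm k A}
  {V : Type*} [AddCommGroup V] [Module k V]

open EpsAlg

/-- The properties of the classes of the cocycles of `T` from which the axioms of a
Batalin-Vilkovisky algebra follow. -/
structure IsClassMap (φ : SymmetrizingForm k A) (e e' : ι → A) (𝒱 : ℤ → Submodule k V)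
    (C : ℕ → EpsAlg k A →ₗ[k] V) (mul br : V →ₗ[k] V →ₗ[k] V) (Δ : V →ₗ[k] V) : Prop where
  isDualBasis : IsDualBasis φ e e'
  isInternal : DirectSum.IsInternal 𝒱
  mem : ∀ {n : ℕ} {α}, IsCocycle n α → C n α ∈ 𝒱 (-n)
  exists_cocycle : ∀ {z : ℤ} {a}, a ∈ 𝒱 z → a = 0 ∨ ∃ n : ℕ, z = -n ∧ ∃ α, IsCocycle n α ∧ C n α = a
  induction : ∀ {p : V → Prop}, (∀ n α, IsCocycle n α → p (C n α)) →
    (∀ a b, p a → p b → p (a + b)) → ∀ a, p a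
  eq_of_sub_mem : ∀ {n : ℕ} {α β}, IsCocycle n α → IsCocycle n β → α - β ∈ boundaries k A →
    C n α = C n β
  mul_class : ∀ {m n : ℕ} {α β}, IsCocycle m α → IsCocycle n β →
    mul (C m α) (C n β) = C (m + n) (α * β)
  bv_class : ∀ {n : ℕ} {α}, IsCocycle n α → Δ (C n α) = C (n + 1) (bv e e' φ n α)
  bv_bv : ∀ {n : ℕ} {α}, IsCocycle n α → bv e e' φ (n + 1) (bv e e' φ n α) = 0
  br_class : ∀ {m : ℕ} {α}, IsCocycle m α → br (C m α) = derivationDefect m mul Δ (C m α)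

/-- Translates the signs of the axioms, with integer degrees -m, into the signs of T, with natural
degrees m; only the parity matters. -/
theorem negOnePow_smul {z : ℤ} {n : ℕ} (h : Even (z + n)) (v : V) :
    z.negOnePow • v = (-1 : k) ^ n • v := by
  rcases Nat.even_or_odd n with hn | hn
  · rw [Int.negOnePow_even z ((Int.even_add.1 h).2 ((Int.even_coe_nat n).2 hn)), hn.neg_one_pow,
      one_smul, one_smul]
  · rw [Int.negOnePow_odd z (by
      rw [← Int.not_even_iff_odd, Int.even_add.1 h, Int.even_coe_nat, Nat.not_even_iff_odd]
      exact hn), hn.neg_one_pow, neg_smul, one_smul, Units.neg_smul, one_smul]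

theorem isCocycle_one : IsCocycle (k := k) (A := A) 0 1 :=
  ⟨by simpa using IsHom.incl (k := k) (1 : A), one_mem _, d_one⟩

namespace IsClassMap

variable {𝒱 : ℤ → Submodule k V} {C : ℕ → EpsAlg k A →ₗ[k] V} {mul br : V →ₗ[k] V →ₗ[k] V}
  {Δ : V →ₗ[k] V} (h : IsClassMap φ e e' 𝒱 C mul br Δ) {m n l : ℕ} {α β γ : EpsAlg k A}
  (hα : IsCocycle m α) (hβ : IsCocycle n β) (hγ : IsCocycle l γ)

include h

theorem induction₃ {p : V → V → V → Prop}
    (h0 : ∀ m n l α β γ, IsCocycle m α → IsCocycle n β → IsCocycle l γ →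
      p (C m α) (C n β) (C l γ))
    (h1 : ∀ a a' b c, p a b c → p a' b c → p (a + a') b c)
    (h2 : ∀ a b b' c, p a b c → p a b' c → p a (b + b') c)
    (h3 : ∀ a b c c', p a b c → p a b c' → p a b (c + c')) (a b c : V) : p a b c := by
  refine h.induction (p := fun a => p a b c) (fun m α hα => ?_) (fun a a' => h1 a a' b c) a
  refine h.induction (p := fun b => p (C m α) b c) (fun n β hβ => ?_) (fun b b' => h2 _ b b' c) b
  exact h.induction (p := fun c => p (C m α) (C n β) c) (fun l γ hγ => h0 m n l α β γ hα hβ hγ)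
    (fun c c' => h3 _ _ c c') c

include hα hβ

/-- The bracket of classes is a derivation defect by definition, and `bracket_sub_mem` makes it the
class of the bracket in T. The latter form yields skew-symmetry, Jacobi and Leibniz; the former, the
seven-term identity. -/
theorem bracket_class : br (C m α) (C n β) = C (m + n + 1) (bracket m n α β) := by
  have H := h.isDualBasis
  have h1 := (hα.bv H).mul hβ
  have h2 := h.mul_class (hα.bv H) hβ
  rw [add_right_comm] at h1 h2
  rw [h.br_class hα, derivationDefect_apply, h.mul_class hα hβ, h.bv_class (hα.mul hβ),
    h.bv_class hα, h.bv_class hβ, h2, h.mul_class hα (hβ.bv H), ← add_assoc,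
    ← map_smul_sub_sub]
  exact (h.eq_of_sub_mem (hα.bracket hβ) (((((hα.mul hβ).bv H).sub h1).sub
    ((hα.mul (hβ.bv H)).smul _)).smul _) (bracket_sub_mem H hα hβ)).symm

theorem mul_comm_class : mul (C m α) (C n β) = (-1 : k) ^ (m * n) • mul (C n β) (C m α) := by
  rw [h.mul_class hα hβ, h.mul_class hβ hα, add_comm n m, ← map_smul]
  have := hβ.mul hα
  rw [add_comm] at this
  exact h.eq_of_sub_mem (hα.mul hβ) (this.smul _) (mul_comm_sub_mem hα hβ)

theorem br_skew_class :
    br (C m α) (C n β) = -((-1 : k) ^ ((m + 1) * (n + 1)) • br (C n β) (C m α)) := by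
  rw [h.bracket_class hα hβ, h.bracket_class hβ hα, add_comm n m, bracket_skew, map_neg, map_smul]

include hγ

theorem mul_assoc_class :
    mul (mul (C m α) (C n β)) (C l γ) = mul (C m α) (mul (C n β) (C l γ)) := by
  rw [h.mul_class hα hβ, h.mul_class (hα.mul hβ) hγ, h.mul_class hβ hγ,
    h.mul_class hα (hβ.mul hγ), mul_assoc, add_assoc]

theorem jacobi_class : br (C m α) (br (C n β) (C l γ)) = br (br (C m α) (C n β)) (C l γ) +
    (-1 : k) ^ ((m + 1) * (n + 1)) • br (C n β) (br (C m α) (C l γ)) := by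
  rw [h.bracket_class hβ hγ, h.bracket_class hα hβ, h.bracket_class hα hγ,
    h.bracket_class hα (hβ.bracket hγ), h.bracket_class (hα.bracket hβ) hγ,
    h.bracket_class hβ (hα.bracket hγ), bracket_bracket hα.isHom hβ.isHom hγ.isHom, map_add,
    map_smul, show m + (n + l + 1) + 1 = m + n + 1 + l + 1 by omega,
    show n + (m + l + 1) + 1 = m + n + 1 + l + 1 by omega]

theorem leibniz_class : br (C m α) (mul (C n β) (C l γ)) = mul (br (C m α) (C n β)) (C l γ) +
    (-1 : k) ^ ((m + 1) * n) • mul (C n β) (br (C m α) (C l γ)) := by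
  have h1 := (hα.bracket hβ).mul hγ
  have h2 := hβ.mul (hα.bracket hγ)
  rw [show m + n + 1 + l = m + (n + l) + 1 by omega] at h1
  rw [show n + (m + l + 1) = m + (n + l) + 1 by omega] at h2
  rw [h.mul_class hβ hγ, h.bracket_class hα hβ, h.bracket_class hα hγ,
    h.bracket_class hα (hβ.mul hγ), h.mul_class (hα.bracket hβ) hγ,
    h.mul_class hβ (hα.bracket hγ), show m + n + 1 + l = m + (n + l) + 1 by omega,
    show n + (m + l + 1) = m + (n + l) + 1 by omega, ← map_smul, ← map_add]
  exact h.eq_of_sub_mem (hα.bracket (hβ.mul hγ)) (h1.add (h2.smul _))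
    (bracket_mul_sub_mem hα hβ hγ)

/-- This is the Leibniz rule with every bracket replaced by its defect: of its nine terms, two
involving Δ of the first class cancel by associativity and commutativity, and `h2`, `h3` bring the
other products into a common order. -/
theorem seven_term_class : Δ (mul (mul (C m α) (C n β)) (C l γ)) =
    mul (Δ (mul (C m α) (C n β))) (C l γ) + (-1 : k) ^ m • mul (C m α) (Δ (mul (C n β) (C l γ))) +
      (-1 : k) ^ (n * (m + 1)) • mul (C n β) (Δ (mul (C m α) (C l γ))) -
      mul (mul (Δ (C m α)) (C n β)) (C l γ) -
      (-1 : k) ^ m • mul (mul (C m α) (Δ (C n β))) (C l γ) -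
      (-1 : k) ^ (m + n) • mul (mul (C m α) (C n β)) (Δ (C l γ)) := by
  have H := h.isDualBasis
  have h1 := h.leibniz_class hα hβ hγ
  have h2 : mul (mul (Δ (C m α)) (C n β)) (C l γ) =
      (-1 : k) ^ ((m + 1) * n) • mul (C n β) (mul (Δ (C m α)) (C l γ)) := by
    rw [h.bv_class hα, h.mul_comm_class (hα.bv H) hβ, map_smul, LinearMap.smul_apply,
      h.mul_assoc_class hβ (hα.bv H) hγ]
  have h3 : mul (mul (C m α) (C n β)) (Δ (C l γ)) =
      (-1 : k) ^ (m * n) • mul (C n β) (mul (C m α) (Δ (C l γ))) := by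
    rw [h.bv_class hγ, h.mul_comm_class hα hβ, map_smul, LinearMap.smul_apply,
      h.mul_assoc_class hβ hα (hγ.bv H)]
  have h4 : mul (Δ (C m α)) (mul (C n β) (C l γ)) = mul (mul (Δ (C m α)) (C n β)) (C l γ) := by
    rw [h.bv_class hα, h.mul_assoc_class (hα.bv H) hβ hγ]
  rw [h.br_class hα, derivationDefect_apply, derivationDefect_apply, derivationDefect_apply, h4,
    ← h.mul_assoc_class hα hβ hγ] at h1
  simp only [map_smul, map_sub, LinearMap.smul_apply, LinearMap.sub_apply] at h1
  rw [h2] at h1 ⊢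
  rw [h3]
  have hs := congrArg (fun v => (-1 : k) ^ (m + 1) • v) h1
  simp only [smul_add] at hs
  have hm := neg_one_pow_eq_or k m
  have hn := neg_one_pow_eq_or k n
  have hmn := neg_one_pow_eq_or k (m * n)
  simp only [pow_add, mul_add, add_mul, mul_one, one_mul, pow_one, mul_comm n m] at hs ⊢
  generalize (-1 : k) ^ m = s₁, (-1 : k) ^ n = s₂, (-1 : k) ^ (m * n) = s₃ at *
  clear h1 h2 h3 h4
  rcases hm with rfl | rfl <;> rcases hn with rfl | rfl <;> rcases hmn with rfl | rfl <;>
    refine sub_eq_zero.1 (Eq.trans ?_ (sub_eq_zero.2 hs)) <;>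
    simp only [one_mul, mul_one, neg_mul, mul_neg, neg_neg] <;> module

end IsClassMap

section

variable {𝒱 : ℤ → Submodule k V} {C : ℕ → EpsAlg k A →ₗ[k] V} {mul br : V →ₗ[k] V →ₗ[k] V}
  {Δ : V →ₗ[k] V} (h : IsClassMap φ e e' 𝒱 C mul br Δ)

include h

theorem IsClassMap.isGradedCommAlgebra : IsGradedCommAlgebra 𝒱 mul (C 0 1) where
  isInternal := h.isInternal
  one_mem := by simpa using h.mem (isCocycle_one (k := k) (A := A))
  mul_mem := by
    intro z w a ha b hb
    -- The pieces of positive degree vanish, so a homogeneous element is zero or the class of a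
    -- cocycle of T.
    rcases h.exists_cocycle ha with rfl | ⟨m, rfl, α, hα, rfl⟩
    · simp
    rcases h.exists_cocycle hb with rfl | ⟨n, rfl, β, hβ, rfl⟩
    · simp
    rw [h.mul_class hα hβ, ← neg_add, ← Nat.cast_add]
    exact h.mem (hα.mul hβ)
  one_mul := h.induction (fun n α hα => by rw [h.mul_class isCocycle_one hα, one_mul, zero_add])
    fun a b ha hb => by rw [map_add, ha, hb]
  mul_one := h.induction (fun n α hα => by rw [h.mul_class hα isCocycle_one, mul_one, add_zero])
    fun a b ha hb => by rw [map_add, LinearMap.add_apply, ha, hb]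
  mul_assoc := h.induction₃ (fun _ _ _ _ _ _ => h.mul_assoc_class)
    (fun a a' b c h1 h2 => by simp only [map_add, LinearMap.add_apply, h1, h2])
    (fun a b b' c h1 h2 => by simp only [map_add, LinearMap.add_apply, h1, h2])
    (fun a b c c' h1 h2 => by simp only [map_add, h1, h2])
  mul_comm := by
    intro z w a ha b hb
    rcases h.exists_cocycle ha with rfl | ⟨m, rfl, α, hα, rfl⟩
    · simp
    rcases h.exists_cocycle hb with rfl | ⟨n, rfl, β, hβ, rfl⟩
    · simp
    rw [h.mul_comm_class hα hβ, negOnePow_smul (k := k) (n := m * n) (by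
      push_cast
      simp [Int.even_add, Int.even_mul])]

theorem IsClassMap.isBVAlgebra : IsBVAlgebra 𝒱 mul (C 0 1) Δ where
  toIsGradedCommAlgebra := h.isGradedCommAlgebra
  Δ_mem := by
    intro z a ha
    rcases h.exists_cocycle ha with rfl | ⟨m, rfl, α, hα, rfl⟩
    · simp
    rw [h.bv_class hα, ← neg_add', ← Nat.cast_succ]
    exact h.mem (hα.bv h.isDualBasis)
  Δ_one := by rw [h.bv_class isCocycle_one, ← map_one (incl k), bv_incl, map_zero]
  Δ_Δ := h.induction (fun n α hα => by
      rw [h.bv_class hα, h.bv_class (hα.bv h.isDualBasis), h.bv_bv hα, map_zero])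
    fun a b ha hb => by rw [map_add, map_add, ha, hb, add_zero]
  seven_term := by
    intro z w a ha b hb
    rcases h.exists_cocycle ha with rfl | ⟨m, rfl, α, hα, rfl⟩
    · simp
    rcases h.exists_cocycle hb with rfl | ⟨n, rfl, β, hβ, rfl⟩
    · simp
    have h1 : ∀ v : V, (-m : ℤ).negOnePow • v = (-1 : k) ^ m • v :=
      negOnePow_smul (by simp)
    have h2 : ∀ v : V, ((-n : ℤ) * (-m - 1)).negOnePow • v = (-1 : k) ^ (n * (m + 1)) • v :=
      negOnePow_smul (by
        push_cast
        simp [Int.even_add, Int.even_sub, Int.even_mul])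
    have h3 : ∀ v : V, (-m + -n : ℤ).negOnePow • v = (-1 : k) ^ (m + n) • v :=
      negOnePow_smul (by
        push_cast
        simp [Int.even_add])
    simp only [h1, h2, h3]
    exact h.induction (fun l γ hγ => h.seven_term_class hα hβ hγ) fun c c' hc hc' => by
      simp only [map_add, hc, hc', smul_add]
      abel

theorem IsClassMap.isGerstenhaberAlgebra : IsGerstenhaberAlgebra 𝒱 mul (C 0 1) br where
  toIsGradedCommAlgebra := h.isGradedCommAlgebra
  br_mem := by
    intro z w a ha b hb
    rcases h.exists_cocycle ha with rfl | ⟨m, rfl, α, hα, rfl⟩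
    · simp
    rcases h.exists_cocycle hb with rfl | ⟨n, rfl, β, hβ, rfl⟩
    · simp
    rw [h.bracket_class hα hβ, ← neg_add, ← neg_add', ← Nat.cast_add, ← Nat.cast_succ]
    exact h.mem (hα.bracket hβ)
  br_skew := by
    intro z w a ha b hb
    rcases h.exists_cocycle ha with rfl | ⟨m, rfl, α, hα, rfl⟩
    · simp
    rcases h.exists_cocycle hb with rfl | ⟨n, rfl, β, hβ, rfl⟩
    · simp
    rw [h.br_skew_class hα hβ, negOnePow_smul (k := k) (n := (m + 1) * (n + 1)) (by
      push_cast
      simp [Int.even_add, Int.even_sub, Int.even_mul])]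
  jacobi := by
    intro z w a ha b hb
    rcases h.exists_cocycle ha with rfl | ⟨m, rfl, α, hα, rfl⟩
    · simp
    rcases h.exists_cocycle hb with rfl | ⟨n, rfl, β, hβ, rfl⟩
    · simp
    have h1 : ∀ v : V, ((-m - 1 : ℤ) * (-n - 1)).negOnePow • v =
        (-1 : k) ^ ((m + 1) * (n + 1)) • v :=
      negOnePow_smul (by
        push_cast
        simp [Int.even_add, Int.even_sub, Int.even_mul])
    simp only [h1]
    exact h.induction (fun l γ hγ => h.jacobi_class hα hβ hγ) fun c c' hc hc' => by
      simp only [map_add, hc, hc', smul_add]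
      abel
  leibniz := by
    intro z w a ha b hb
    rcases h.exists_cocycle ha with rfl | ⟨m, rfl, α, hα, rfl⟩
    · simp
    rcases h.exists_cocycle hb with rfl | ⟨n, rfl, β, hβ, rfl⟩
    · simp
    have h1 : ∀ v : V, ((-m - 1 : ℤ) * -n).negOnePow • v = (-1 : k) ^ ((m + 1) * n) • v :=
      negOnePow_smul (by
        push_cast
        simp [Int.even_add, Int.even_sub, Int.even_mul])
    simp only [h1]
    exact h.induction (fun l γ hγ => h.leibniz_class hα hβ hγ) fun c c' hc hc' => by
      simp only [map_add, hc, hc', smul_add]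
      abel

theorem IsClassMap.bracket_eq : ∀ m : ℤ, ∀ a ∈ 𝒱 m, ∀ b,
    br a b = (m + 1).negOnePow • (Δ (mul a b) - mul (Δ a) b - m.negOnePow • mul a (Δ b)) := by
  intro z a ha b
  rcases h.exists_cocycle ha with rfl | ⟨m, rfl, α, hα, rfl⟩
  · simp
  rw [h.br_class hα, derivationDefect_apply, negOnePow_smul (k := k) (z := -m) (n := m) (by simp),
    negOnePow_smul (k := k) (z := -m + 1) (n := m + 1) (by
      push_cast
      simp [Int.even_add])]

end

end Axioms

end TateHochschild

namespace TateHochschild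

/-! ### The grading of the cohomology and its class maps -/

section Cohomology

variable {k : Type*} [Field k] {A : Type*} [Ring A] [Algebra k A]
  {ι : Type*} [Fintype ι] {e e' : ι → A} {φ : SymmetrizingForm k A}

open EpsAlg

theorem thGrading_neg (n : ℕ) :
    thGrading k e e' (-n) = LinearMap.range (DirectSum.lof k ℕ (TH k e e') n) := by
  have : (- -(n : ℤ)).toNat = n := by simp
  rw [thGrading, if_pos (by simp), this]

theorem eq_zero_or_exists_of_mem_thGrading {z : ℤ} {a : THNonpos k e e'}
    (ha : a ∈ thGrading k e e' z) :
    a = 0 ∨ ∃ n : ℕ, z = -n ∧ a ∈ LinearMap.range (DirectSum.lof k ℕ (TH k e e') n) := by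
  rcases le_or_gt z 0 with hz | hz
  · obtain ⟨n, hn⟩ := Int.eq_ofNat_of_zero_le (neg_nonneg.2 hz)
    obtain rfl : z = -n := by omega
    exact Or.inr ⟨n, rfl, thGrading_neg (k := k) (e := e) (e' := e') n ▸ ha⟩
  · rw [thGrading, if_neg hz.not_ge] at ha
    exact Or.inl ((Submodule.mem_bot k).1 ha)

variable (k e e') in
/-- The decomposition of the cohomology into its graded pieces. -/
noncomputable def thDecompose : THNonpos k e e' →ₗ[k] DirectSum ℤ fun z => thGrading k e e' z :=
  DirectSum.toModule k ℕ _ fun n => DirectSum.lof k ℤ (fun z => thGrading k e e' z) (-n) ∘ₗ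
    (DirectSum.lof k ℕ (TH k e e') n).codRestrict (thGrading k e e' (-n))
      fun x => by rw [thGrading_neg]; exact ⟨x, rfl⟩

theorem isInternal_thGrading : DirectSum.IsInternal (thGrading k e e') := by
  refine Function.bijective_iff_has_inverse.2 ⟨thDecompose k e e', fun x => ?_, fun x => ?_⟩
  · induction x using DirectSum.induction_on with
    | zero => rw [map_zero, map_zero]
    | add x y hx hy => rw [map_add, map_add, hx, hy]
    | of z x =>
      obtain ⟨x, hx⟩ := x
      rw [DirectSum.coeAddMonoidHom_of]
      rcases eq_zero_or_exists_of_mem_thGrading hx with rfl | ⟨n, rfl, y, rfl⟩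
      · rw [map_zero]
        exact (map_zero (DirectSum.of (fun z => thGrading k e e' z) z)).symm
      · rw [thDecompose, DirectSum.toModule_lof]
        rfl
  · induction x using DirectSum.induction_on with
    | zero => rw [map_zero, map_zero]
    | add x y hx hy => rw [map_add, map_add, hx, hy]
    | of n x =>
      have h := DirectSum.toModule_lof (M := TH k e e') k (φ := fun n =>
        DirectSum.lof k ℤ (fun z => thGrading k e e' z) (-n) ∘ₗ
          (DirectSum.lof k ℕ (TH k e e') n).codRestrict (thGrading k e e' (-n))
            fun x => by rw [thGrading_neg]; exact ⟨x, rfl⟩) n x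
      refine (congrArg _ h).trans ?_
      exact DirectSum.coeAddMonoidHom_of (thGrading k e e') _ _

theorem exists_classMap_eq (H : IsDualBasis φ e e') {n : ℕ} {a : THNonpos k e e'}
    (ha : a ∈ LinearMap.range (DirectSum.lof k ℕ (TH k e e') n)) :
    ∃ α, IsCocycle n α ∧ classMap H n α = a := by
  obtain ⟨a, rfl⟩ := ha
  exact ⟨rep H n a, isCocycle_rep H a, classMap_rep H a⟩

theorem bv_bv (H : IsDualBasis φ e e') {n : ℕ} {α : EpsAlg k A} (hα : IsCocycle n α) :
    bv e e' φ (n + 1) (bv e e' φ n α) = 0 := by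
  obtain ⟨x, -, rfl⟩ := exists_cocycle_embed H hα
  rw [← embed_connes H, ← embed_connes H, connes_connes, map_zero]

theorem isClassMap_classMap (H : IsDualBasis φ e e') :
    IsClassMap (V := THNonpos k e e') φ e e' (thGrading k e e') (classMap H) (thMul H) (thBracket H)
      (thBV H) where
  isDualBasis := H
  isInternal := isInternal_thGrading
  mem hα := by
    rw [thGrading_neg]
    exact classMap_mem_range H hα
  exists_cocycle ha := (eq_zero_or_exists_of_mem_thGrading ha).imp_right
    fun ⟨n, hz, h⟩ => ⟨n, hz, exists_classMap_eq H h⟩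
  induction {p} h1 h2 a := by
    induction a using DirectSum.induction_on with
    | zero => simpa using h1 0 0 ⟨.zero _, zero_mem _, map_zero _⟩
    | of n x =>
      obtain ⟨α, hα, h⟩ := exists_classMap_eq H (n := n) ⟨x, rfl⟩
      exact Eq.mp (congrArg p h) (h1 n α hα)
    | add x y hx hy => exact h2 _ _ hx hy
  eq_of_sub_mem := classMap_eq H
  mul_class := thMul_classMap H
  bv_class := thBV_classMap H
  bv_bv := bv_bv H
  br_class hα := thBracket_apply H (classMap_mem_range H hα)

theorem classMap_one (H : IsDualBasis φ e e') : classMap H 0 1 = unitClass k e e' := by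
  refine Eq.trans ?_ (classMap_embed H unitCochain (unit_mem_cocycles e e'))
  congr 1
  change 1 = incl k (cochainZeroEquiv ((cochainZeroEquiv (k := k) (A := A)).symm 1))
  rw [LinearEquiv.apply_symm_apply, map_one]

/-- Turns an identity in T into the statement that an operation on chains preserves cocycles and
induces the operation on classes. -/
theorem classMap_eq_cohomClass (H : IsDualBasis φ e e') {n : ℕ} {α : EpsAlg k A} {x : D k A n}
    (hα : IsCocycle n α) (hx : embed e e' n x = α) :
    ∃ h : x ∈ cocycles e e' n, classMap H n α = cohomClass e e' n x h := by
  subst hx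
  exact ⟨(mem_cocycles_iff H x).2 hα, classMap_embed H x _⟩

end Cohomology

end TateHochschild

/-! ### The Batalin–Vilkovisky structure on the non-positive part -/

open TateHochschild in
/-- The `⋆`-product, the bracket and Connes' operator descend to `H^{≤ 0}(𝒟^*(A, A))` and make it a
BV algebra. For `a` of degree `m = -p-1`, the sign `(-1)^{m+1}` is `(-1)^p`. -/
theorem proposition6p15 {k : Type*} [Field k] {A : Type*} [Ring A] [Algebra k A]
    [FiniteDimensional k A] (φ : SymmetrizingForm k A)
    {ι : Type*} [Fintype ι] [DecidableEq ι] (e : Module.Basis ι k A) (e' : ι → A)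
    (he : ∀ i j, φ.form (e i) (e' j) = if i = j then 1 else 0) :
    ∃ (mul br : THNonpos k e e' →ₗ[k] THNonpos k e e' →ₗ[k] THNonpos k e e')
      (Δ : THNonpos k e e' →ₗ[k] THNonpos k e e'),
      (∀ (m n : ℕ) (x : D k A m) (y : D k A n)
          (hx : x ∈ cocycles e e' m) (hy : y ∈ cocycles e e' n),
        (∃ h : starProduct e e' m n x y ∈ cocycles e e' (m + n),
          mul (cohomClass e e' m x hx) (cohomClass e e' n y hy) =
            cohomClass e e' (m + n) (starProduct e e' m n x y) h) ∧
        (∃ h : lieBracket e e' m n x y ∈ cocycles e e' (m + n + 1),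
          br (cohomClass e e' m x hx) (cohomClass e e' n y hy) =
            cohomClass e e' (m + n + 1) (lieBracket e e' m n x y) h)) ∧
      (∀ (n : ℕ) (x : D k A n) (hx : x ∈ cocycles e e' n),
        ∃ h : connes n x ∈ cocycles e e' (n + 1),
          Δ (cohomClass e e' n x hx) = cohomClass e e' (n + 1) (connes n x) h) ∧
      IsBVAlgebra (thGrading k e e') mul (unitClass k e e') Δ ∧
      IsGerstenhaberAlgebra (thGrading k e e') mul (unitClass k e e') br ∧
      (∀ m : ℤ, ∀ a ∈ thGrading k (⇑e) e' m, ∀ b,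
        br a b = (m + 1).negOnePow •
          (Δ (mul a b) - mul (Δ a) b - m.negOnePow • mul a (Δ b))) := by
  have H : IsDualBasis φ e e' := isDualBasis_of_basis φ e e' he
  have h := isClassMap_classMap H
  refine ⟨thMul H, thBracket H, thBV H, fun m n x y hx hy => ?_, fun n x hx => ?_,
    classMap_one H ▸ h.isBVAlgebra, classMap_one H ▸ h.isGerstenhaberAlgebra, h.bracket_eq⟩
  · have hx' := (mem_cocycles_iff H x).1 hx
    have hy' := (mem_cocycles_iff H y).1 hy
    rw [← classMap_embed H x hx, ← classMap_embed H y hy, thMul_classMap H hx' hy',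
      h.bracket_class hx' hy']
    exact ⟨classMap_eq_cohomClass H (hx'.mul hy') (embed_starProduct H m n x y hx' hy'),
      classMap_eq_cohomClass H (hx'.bracket hy') (embed_lieBracket m n x y)⟩
  · have hx' := (mem_cocycles_iff H x).1 hx
    rw [← classMap_embed H x hx, thBV_classMap H hx']
    exact classMap_eq_cohomClass H (hx'.bv H) (embed_connes H n x)
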